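/- **Setting.** For $v,v_*\in\mathbb R^3$ and $\sigma\in\mathbb S^2$ put $$v'=\frac{v+v_*}{2}+\frac{|v-v_*|\sigma}{2},\qquad v'_*=\frac{v+v_*}{2}-\frac{|v-v_*|\sigma}{2},\qquad \langle v\rangle=(1+|v|^2)^{1/2},$$ $\|g\|_{L^1_s}=\int_{\mathbb R^3}|g(v)|\langle v\rangle^s\,dv$, $L^1_s=\{g:\|g\|_{L^1_s}<\infty\}$, and $\|g\|_{L^1}=\|g\|_{L^1_0}$. For $g$ on $\mathbb R^3$ write $g=g(v)$, $g_*=g(v_*)$, $g'=g(v')$, $g'_*=g(v'_*)$; $d\sigma$ is the area measure of $\mathbb S^2$. *Kernel.* $B(z,\sigma)=B(|z|,\cos\theta)$, $\cos\theta=\langle z,\sigma\rangle/|z|$, is a nonnegative Borel function of $(|z|,\cos\theta)$ with $B(z,-\sigma)=B(z,\sigma)$. It satisfies, with even Borel functions $b_*,b^*$ on $(-1,1)$, a Borel function $\Phi_*$ on $(0,\infty)$ and an exponent $\gamma$: (A1) $0<b_*(c)\le b^*(c)$ for all $c\in(-1,1)$; $\Phi_*(r)>0$ for all $r>0$, $\inf_{r\ge1}\Phi_*(r)\ge1$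 and $\sup_{r>0}\Phi_*(r)<\infty$; (A3) $-4\le\gamma<0$, $\ |z|^\gamma\Phi_*(|z|)b_*(\cos\theta)\le B(z,\sigma)\le|z|^\gamma b^*(\cos\theta)$ for $z\neq0$, $|\cos\theta|<1$, and $\int_0^\pi b^*(\cos\theta)\sin^2\theta\,d\theta<\infty$. *Weak solutions.* Let $\Pi_F(f)=f'f'_*(1-f)(1-f_*)-ff_*(1-f')(1-f'_*)$ and $\Delta\varphi=\varphi(t,v')+\varphi(t,v'_*)-\varphi(t,v)-\varphi(t,v_*)$. A Lebesgue measurable $f:[0,\infty)\times\mathbb R^3\to[0,1]$ with $f(t,\cdot)\in L^1_2$ for all $t\ge 0$ and $\sup_{t\ge0}\|f(t)\|_{L^1_2}<\infty$ is a weak solution with initial datum $f_0$ if $f(0,\cdot)=f_0$ a.e. and, for every $\varphi\in C^2([0,\infty)\times\mathbb R^3)$ that is bounded together with its partial derivatives of order $\le2$: for all $0<T<\infty$, $$\int_0^T dt\int_{\mathbb R^3\times\mathbb R^3\times\mathbb S^2}B(v-v_*,\sigma)\,|\Pi_F(f)|\,|\Delta\varphi|\,d\sigma\,dv_*\,dv<\infty;$$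 $t\mapsto\int f(t)\varphi(t)\,dv$ is absolutely continuous on $[0,T]$ for every $0<T<\infty$; and for a.e. $t\ge0$ $$\frac{d}{dt}\int f(t)\varphi(t)\,dv=\int f(t)\,\partial_t\varphi(t)\,dv-\frac14\int_{\mathbb R^3}\Big(\int_{\mathbb R^3\times\mathbb S^2}B(v-v_*,\sigma)\,\Pi_F(f)\,\Delta\varphi\,d\sigma\,dv_*\Big)dv .$$ It is conservative if $\int f(t,v)(1,v,|v|^2)\,dv=\int f_0(v)(1,v,|v|^2)\,dv$ for all $t\ge0$. *Weak entropy inequalities.* Let $S(g)=\int\big(-(1-g)\log(1-g)-g\log g\big)dv$ and, for $a,b\ge 0$, let $\Gamma(a,b)=(a-b)\log(a/b)$ if $a,b>0$, $\Gamma(0,0)=0$, and $\Gamma(a,b)=\infty$ if exactly one of $a,b$ is $0$. We say that $f$ satisfies the weak entropy inequalities if there is a measurable $q=q(t,v,v_*,\sigma)$ on $[0,\infty)\times\mathbb R^3\times\mathbb R^3\times\mathbb S^2$ with, everywhere, $0\le q\le1$, $$0\le\Pi^{(+)}:=f'f'_*(1-f-f_*)+q\le f'f'_*,\qquad 0\le\Pi^{(-)}:=ff_*(1-f'-f'_*)+q\le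 ff_*,$$ and, for all $t\ge0$, $$S(f(t))-S(f_0)\ \ge\ \int_0^t d\tau\;\frac14\int_{\mathbb R^3\times\mathbb R^3\times\mathbb S^2}B(v-v_*,\sigma)\,\Gamma(\Pi^{(+)},\Pi^{(-)})\,d\sigma\,dv_*\,dv .$$ **Proposition 2.7.** Let $B$ satisfy (A1) and (A3), let $s\ge\max\{2+|\gamma|,4\}$, let $f_0\in L^1_s$ with $0\le f_0\le1$, and let $f$ be a conservative weak solution with initial datum $f_0$ that satisfies the weak entropy inequalities. Then there is a constant $0<C_s<\infty$, depending only on $b_*$, $b^*$, $\gamma$, $s$, $\|f_0\|_{L^1}$, $\|f_0\|_{L^1_2}$ and $\|f_0\|_{L^1_s}$, such that $$\|f(t)\|_{L^1_s}\le C_s(1+t),\qquad \frac1t\int_0^t\|f(\tau)\|_{L^1_{s-|\gamma|}}\,d\tau\le C_s\qquad\text{for all }t>0 .$$ -/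

import Mathlib

open MeasureTheory Set Filter
open scoped ENNReal NNReal RealInnerProductSpace

noncomputable section

namespace BFD

/-- The velocity space `ℝ³`. -/
abbrev V : Type := EuclideanSpace ℝ (Fin 3)

/-- The unit sphere `𝕊²` of `ℝ³`. -/
abbrev S2 : Type := Metric.sphere (0 : V) 1

/-- The area measure `dσ` of the unit sphere (total mass `4π`). -/
def dσ : Measure S2 := (volume : Measure V).toSphere

/-- The Japanese bracket `⟨v⟩ = (1 + |v|²)^{1/2}`. -/
def bracket (v : V) : ℝ := Real.sqrt (1 + ‖v‖ ^ 2)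

/-- The weighted norm `‖g‖_{L¹_s} = ∫ |g(v)| ⟨v⟩^s dv`, with values in `[0, ∞]`. -/
def normL1 (s : ℝ) (g : V → ℝ) : ℝ≥0∞ :=
  ∫⁻ v, ENNReal.ofReal (|g v| * bracket v ^ s)

/-- `g ∈ L¹_s(ℝ³)`, for Lebesgue measurable `g`. -/
def MemL1 (s : ℝ) (g : V → ℝ) : Prop :=
  AEStronglyMeasurable g volume ∧ normL1 s g < ∞

/-- The post-collisional velocity `v' = (v + v_*)/2 + |v - v_*| σ/2`. -/
def post (v w : V) (σ : S2) : V :=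
  (2⁻¹ : ℝ) • (v + w) + (2⁻¹ * ‖v - w‖) • (σ : V)

/-- The post-collisional velocity `v_*' = (v + v_*)/2 - |v - v_*| σ/2`. -/
def postStar (v w : V) (σ : S2) : V :=
  (2⁻¹ : ℝ) • (v + w) - (2⁻¹ * ‖v - w‖) • (σ : V)

/-- `B(z, σ) = B(|z|, cos θ)` with `cos θ = ⟨z, σ⟩ / |z|`. -/
def kernel (B : ℝ → ℝ → ℝ) (z : V) (σ : S2) : ℝ :=
  B ‖z‖ (⟪z, (σ : V)⟫ / ‖z‖)

/-- The standing assumptions on a collision kernel `B(r, cos θ)`: it is a nonnegative Borel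
function of `r = |z|` and `cos θ`, and it is even in `σ`, hence in `cos θ`. -/
structure IsKernel (B : ℝ → ℝ → ℝ) : Prop where
  measurable : Measurable (Function.uncurry B)
  nonneg : ∀ r > 0, ∀ c ∈ Icc (-1 : ℝ) 1, 0 ≤ B r c
  even : ∀ r > 0, ∀ c ∈ Icc (-1 : ℝ) 1, B r (-c) = B r c

/-- Assumption (A1): the angular bounds `b_*`, `b^*` are Borel and even on `(-1, 1)`, with
`0 < b_* ≤ b^*`; the radial function `Φ_*` is Borel and positive on `(0, ∞)`, bounded, and at
least `1` on `[1, ∞)`. -/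
structure A1 (bLow bUp Φ : ℝ → ℝ) : Prop where
  measurable_low : Measurable bLow
  measurable_up : Measurable bUp
  measurable_rad : Measurable Φ
  even_low : ∀ c ∈ Ioo (-1 : ℝ) 1, bLow (-c) = bLow c
  even_up : ∀ c ∈ Ioo (-1 : ℝ) 1, bUp (-c) = bUp c
  low_pos : ∀ c ∈ Ioo (-1 : ℝ) 1, 0 < bLow c
  low_le_up : ∀ c ∈ Ioo (-1 : ℝ) 1, bLow c ≤ bUp c
  rad_pos : ∀ r > 0, 0 < Φ r
  one_le_rad : ∀ r ≥ 1, 1 ≤ Φ r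
  rad_bdd : ∃ K : ℝ, ∀ r > 0, Φ r ≤ K

/-- Assumption (A3): `|z|^γ Φ_*(|z|) b_*(cos θ) ≤ B ≤ |z|^γ b^*(cos θ)` with `-4 ≤ γ < 0`, and
`∫_0^π b^*(cos θ) sin² θ dθ < ∞`. -/
structure A3 (bLow bUp Φ : ℝ → ℝ) (γ : ℝ) (B : ℝ → ℝ → ℝ) : Prop where
  exponent : γ ∈ Ico (-4 : ℝ) 0
  lower : ∀ r > 0, ∀ c ∈ Ioo (-1 : ℝ) 1, r ^ γ * Φ r * bLow c ≤ B r c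
  upper : ∀ r > 0, ∀ c ∈ Ioo (-1 : ℝ) 1, B r c ≤ r ^ γ * bUp c
  cutoff : IntegrableOn (fun θ => bUp (Real.cos θ) * Real.sin θ ^ 2) (Ioo 0 Real.pi)

/-- `Π_F(f) = f' f_*' (1 - f)(1 - f_*) - f f_* (1 - f')(1 - f_*')`, for a function `g = f(t, ·)`
of the velocity. -/
def PiF (g : V → ℝ) (v w : V) (σ : S2) : ℝ :=
  g (post v w σ) * g (postStar v w σ) * (1 - g v) * (1 - g w)
    - g v * g w * (1 - g (post v w σ)) * (1 - g (postStar v w σ))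

/-- `Δφ = φ(v') + φ(v_*') - φ(v) - φ(v_*)`. -/
def Δ (φ : V → ℝ) (v w : V) (σ : S2) : ℝ :=
  φ (post v w σ) + φ (postStar v w σ) - φ v - φ w

/-- `Q(f | Δφ)(v) = ∫_{ℝ³ × 𝕊²} B(v - v_*, σ) Π_F(f) Δφ dσ dv_*`. -/
def QWeak (B : ℝ → ℝ → ℝ) (g φ : V → ℝ) (v : V) : ℝ :=
  ∫ p : V × S2, kernel B (v - p.1) p.2 * PiF g v p.1 p.2 * Δ φ v p.1 p.2
    ∂((volume : Measure V).prod dσ)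

/-- The measure `dσ dv_* dv` on `ℝ³ × ℝ³ × 𝕊²`. -/
def collMeasure : Measure (V × V × S2) :=
  (volume : Measure V).prod ((volume : Measure V).prod dσ)

/-- The closed half space-time `[0, ∞) × ℝ³`. -/
def halfSpace : Set (ℝ × V) := Ici 0 ×ˢ univ

/-- `φ ∈ C²_b([0, ∞) × ℝ³)`: `φ` is `C²` up to the boundary, and it is bounded together with all
its derivatives of order at most two. -/
def IsC2b (φ : ℝ × V → ℝ) : Prop :=
  ContDiffOn ℝ 2 φ halfSpace ∧
    ∀ k ≤ 2, ∃ K : ℝ, ∀ x ∈ halfSpace, ‖iteratedFDerivWithin ℝ k φ halfSpace x‖ ≤ K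

/-- Weak solutions `f : [0, ∞) × ℝ³ → [0, 1]` of the Boltzmann equation for Fermi-Dirac particles
with collision kernel `B` and initial datum `f₀`. -/
structure IsWeakSolution (B : ℝ → ℝ → ℝ) (f₀ : V → ℝ) (f : ℝ → V → ℝ) : Prop where
  aemeasurable : AEMeasurable (fun x : ℝ × V => f x.1 x.2)
    (((volume : Measure ℝ).restrict (Ici 0)).prod (volume : Measure V))
  mem_Icc : ∀ t ≥ 0, ∀ v, f t v ∈ Icc (0 : ℝ) 1
  memL1_two : ∀ t ≥ 0, MemL1 2 (f t)
  sup_lt_top : (⨆ t ∈ Ici (0 : ℝ), normL1 2 (f t)) < ∞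
  initial : f 0 =ᵐ[volume] f₀
  integrable : ∀ φ : ℝ × V → ℝ, IsC2b φ → ∀ T > 0,
    ∫⁻ t in Icc 0 T, (∫⁻ x : V × V × S2,
      ENNReal.ofReal (kernel B (x.1 - x.2.1) x.2.2 * |PiF (f t) x.1 x.2.1 x.2.2|
        * |Δ (fun u => φ (t, u)) x.1 x.2.1 x.2.2|) ∂collMeasure) < ∞
  absolutelyContinuous : ∀ φ : ℝ × V → ℝ, IsC2b φ → ∀ T > 0,
    AbsolutelyContinuousOnInterval (fun t => ∫ v, f t v * φ (t, v)) 0 T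
  equation : ∀ φ : ℝ × V → ℝ, IsC2b φ → ∀ᵐ t ∂((volume : Measure ℝ).restrict (Ici 0)),
    HasDerivAt (fun τ => ∫ v, f τ v * φ (τ, v))
      ((∫ v, f t v * derivWithin (fun τ => φ (τ, v)) (Ici 0) t)
        - (1 / 4) * ∫ v, QWeak B (f t) (fun u => φ (t, u)) v) t

/-- Conservation of mass, momentum and kinetic energy. -/
structure Conserves (f₀ : V → ℝ) (f : ℝ → V → ℝ) : Prop where
  mass : ∀ t ≥ 0, ∫ v, f t v = ∫ v, f₀ v
  momentum : ∀ t ≥ 0, ∫ v, f t v • v = ∫ v, f₀ v • v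
  energy : ∀ t ≥ 0, ∫ v, f t v * ‖v‖ ^ 2 = ∫ v, f₀ v * ‖v‖ ^ 2

/-- The entropy `S(g) = ∫ (-(1 - g) log (1 - g) - g log g) dv` for `0 ≤ g ≤ 1`. The integrand is
nonnegative, so the integral is taken with values in `[0, ∞]`. -/
def entropy (g : V → ℝ) : ℝ≥0∞ :=
  ∫⁻ v, ENNReal.ofReal (-(1 - g v) * Real.log (1 - g v) - g v * Real.log (g v))

/-- `Γ(a, b) = (a - b) log (a / b)` if `a, b > 0`, `Γ(0, 0) = 0`, and `Γ(a, b) = ∞` if exactly one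
of `a, b ≥ 0` vanishes. -/
def Gam (a b : ℝ) : ℝ≥0∞ :=
  if a = 0 ∧ b = 0 then 0
  else if a = 0 ∨ b = 0 then ∞
  else ENNReal.ofReal ((a - b) * Real.log (a / b))

/-- `Π_F^{(+)}(f, q) = f' f_*' (1 - f - f_*) + q`. -/
def PiPlus (g : V → ℝ) (q : V → V → S2 → ℝ) (v w : V) (σ : S2) : ℝ :=
  g (post v w σ) * g (postStar v w σ) * (1 - g v - g w) + q v w σ

/-- `Π_F^{(-)}(f, q) = f f_* (1 - f' - f_*') + q`. -/
def PiMinus (g : V → ℝ) (q : V → V → S2 → ℝ) (v w : V) (σ : S2) : ℝ :=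
  g v * g w * (1 - g (post v w σ) - g (postStar v w σ)) + q v w σ

/-- The entropy dissipation `D(f, q) = ¼ ∫ B Γ(Π_F^{(+)}(f, q), Π_F^{(-)}(f, q)) dσ dv_* dv`. -/
def dissipation (B : ℝ → ℝ → ℝ) (g : V → ℝ) (q : V → V → S2 → ℝ) : ℝ≥0∞ :=
  (1 / 4) * ∫⁻ x : V × V × S2, ENNReal.ofReal (kernel B (x.1 - x.2.1) x.2.2)
    * Gam (PiPlus g q x.1 x.2.1 x.2.2) (PiMinus g q x.1 x.2.1 x.2.2) ∂collMeasure

/-- The weak entropy inequalities: for some measurable `0 ≤ q ≤ 1` with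
`0 ≤ Π_F^{(+)}(f, q) ≤ f' f_*'` and `0 ≤ Π_F^{(-)}(f, q) ≤ f f_*`, one has
`S(f(t)) - S(f₀) ≥ ∫_0^t D(f, q)(τ) dτ` for all `t ≥ 0`, written without subtraction. -/
def WeakEntropy (B : ℝ → ℝ → ℝ) (f₀ : V → ℝ) (f : ℝ → V → ℝ) : Prop :=
  ∃ q : ℝ → V → V → S2 → ℝ,
    AEMeasurable (fun x : ℝ × V × V × S2 => q x.1 x.2.1 x.2.2.1 x.2.2.2)
      (((volume : Measure ℝ).restrict (Ici 0)).prod collMeasure) ∧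
    (∀ t ≥ 0, ∀ v w σ, q t v w σ ∈ Icc (0 : ℝ) 1 ∧
      PiPlus (f t) (q t) v w σ ∈ Icc 0 (f t (post v w σ) * f t (postStar v w σ)) ∧
      PiMinus (f t) (q t) v w σ ∈ Icc 0 (f t v * f t w)) ∧
    ∀ t ≥ 0, entropy f₀ + ∫⁻ τ in Icc 0 t, dissipation B (f τ) (q τ) ≤ entropy (f t)

end BFD

end

open MeasureTheory Set Filter
open scoped ENNReal NNReal RealInnerProductSpace

noncomputable section

namespace BFD

/-! The equation is tested with the energy power `(1 + |v|²) ^ p`, `p = s / 2`, truncated so as to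
become affine at high energy. Mass and energy are conserved in each collision, so subtracting the
affine tail gives a compactly supported `C²` test function with the same collision increment `Δ`.
The inequalities between the weight and its two derivatives hold with constants independent of the
truncation, which is finally removed by Fatou's lemma.

Collisions are split according to whether the relative speed is small compared with the mean energy
of the pair (`Near`).

For close pairs the kernel may be as singular as `|z| ^ (-4)`, `z = v - v_*`, while `Δ` supplies
only `|z|²`. The entropy production supplies the rest: by Young's inequality `|Π⁺ - Π⁻| |Δ|` is at
most `Γ(Π⁺, Π⁻) / (4η) + (η / 2) (Π⁺ + Π⁻) |Δ|²`, and `|Δ|²` carries `|z|⁴` (`near_pointwise`,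
`nearInt_le`). With `η` proportional to `1 / (Y + 1)`, `Y` the truncated moment, the first term is
the entropy production times `Y + 1`, to be removed by an integrating factor, and the second is a
small multiple of the moment of order `p + γ / 2`. The entropy is at most the energy plus a Gaussian
integral (`entropy_le`), so the total entropy production is bounded uniformly in time and the
integrating factor stays between two positive constants. This is why the growth is linear and not
exponential.

For distant pairs the kernel is of order `energy ^ (γ / 2)`, and the invariance of the collision
measure replaces `Π_F` by `-2 f f_* (1 - f') (1 - f'_*)`. A Povzner estimate shows that the increase
of the weight is of lower order (`gainInt_le`, `gain_weight_le_rpow`). A fast particle deflected by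
a slow one loses a fixed fraction of its weight, and the Pauli factors do not suppress this loss:
the change of variables `v_* ↦ v'` bounds the mass met at the outgoing velocities by a multiple of
the energy divided by `1 + |v|²` (`slowLoss_ge`). The loss therefore controls the moment of order `p
+ γ / 2` (`exists_lossInt_ge`).

The argument closes in two passes. A crude Gronwall estimate shows that the moment is finite on
bounded time intervals (`Trajectory.exists_moment_bound`). Then the loss absorbs the small multiple
of the moment of order `p + γ / 2` (`exists_linear_bound`), leaving a bounded source and both
claimed bounds. -/

/-! ### Truncated power weights -/

/-- A continuous cutoff, equal to `1` below `N` and to `0` above `2 N`. -/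
def cutoff (N y : ℝ) : ℝ := max 0 (min 1 (2 - y / N))

/-- The truncated second derivative `y ^ (p - 2)`. -/
def curv (p N y : ℝ) : ℝ := max y 0 ^ (p - 2) * cutoff N y

/-- The first derivative of the truncated weight. -/
def slope (p N x : ℝ) : ℝ := ∫ y in (0 : ℝ)..x, curv p N y

/-- The truncated weight: convex, equal to `x ^ p / (p (p - 1))` up to `N`, affine beyond `2 N`. -/
def wt (p N x : ℝ) : ℝ := ∫ y in (0 : ℝ)..x, slope p N y

lemma cutoff_nonneg (N y : ℝ) : 0 ≤ cutoff N y := le_max_left _ _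

lemma cutoff_le_one (N y : ℝ) : cutoff N y ≤ 1 := max_le zero_le_one (min_le_left _ _)

lemma cutoff_anti {N : ℝ} (hN : 0 < N) {x y : ℝ} (h : x ≤ y) : cutoff N y ≤ cutoff N x := by
  unfold cutoff; gcongr

lemma cutoff_eq_one {N : ℝ} (hN : 0 < N) {y : ℝ} (h : y ≤ N) : cutoff N y = 1 := by
  have : y / N ≤ 1 := (div_le_one hN).2 h
  unfold cutoff
  rw [min_eq_left (by linarith), max_eq_right zero_le_one]

lemma cutoff_eq_zero {N : ℝ} (hN : 0 < N) {y : ℝ} (h : 2 * N ≤ y) : cutoff N y = 0 := by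
  have : 2 ≤ y / N := (le_div_iff₀ hN).2 h
  unfold cutoff
  exact max_eq_left ((min_le_right _ _).trans (by linarith))

section weight

variable {p N : ℝ}

lemma curv_nonneg (y : ℝ) : 0 ≤ curv p N y :=
  mul_nonneg (Real.rpow_nonneg (le_max_right _ _) _) (cutoff_nonneg _ _)

lemma curv_of_nonneg {y : ℝ} (hy : 0 ≤ y) : curv p N y = y ^ (p - 2) * cutoff N y := by
  simp [curv, max_eq_left hy]

lemma continuous_curv (hp : 2 ≤ p) : Continuous (curv p N) := by
  unfold curv cutoff
  refine Continuous.mul ?_ (by fun_prop)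
  exact (continuous_id.max continuous_const).rpow_const fun _ => Or.inr (by linarith)

lemma hasDerivAt_slope (hp : 2 ≤ p) (x : ℝ) : HasDerivAt (slope p N) (curv p N x) x :=
  intervalIntegral.integral_hasDerivAt_right ((continuous_curv hp).intervalIntegrable _ _)
    ((continuous_curv hp).stronglyMeasurableAtFilter _ _) (continuous_curv hp).continuousAt

lemma continuous_slope (hp : 2 ≤ p) : Continuous (slope p N) :=
  continuous_iff_continuousAt.2 fun x => (hasDerivAt_slope hp x).continuousAt

lemma hasDerivAt_wt (hp : 2 ≤ p) (x : ℝ) : HasDerivAt (wt p N) (slope p N x) x :=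
  intervalIntegral.integral_hasDerivAt_right ((continuous_slope hp).intervalIntegrable _ _)
    ((continuous_slope hp).stronglyMeasurableAtFilter _ _) (continuous_slope hp).continuousAt

lemma continuous_wt (hp : 2 ≤ p) : Continuous (wt p N) :=
  continuous_iff_continuousAt.2 fun x => (hasDerivAt_wt hp x).continuousAt

lemma contDiff_wt (hp : 2 ≤ p) : ContDiff ℝ 2 (wt p N) := by
  have h1 : ContDiff ℝ 1 (slope p N) := by
    rw [contDiff_one_iff_deriv]
    refine ⟨fun x => (hasDerivAt_slope hp x).differentiableAt, ?_⟩
    rw [funext fun x => (hasDerivAt_slope (N := N) hp x).deriv]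
    exact continuous_curv hp
  rw [show (2 : WithTop ℕ∞) = 1 + 1 by norm_num, contDiff_succ_iff_deriv]
  refine ⟨fun x => (hasDerivAt_wt hp x).differentiableAt, by simp, ?_⟩
  rwa [funext fun x => (hasDerivAt_wt (N := N) hp x).deriv]

lemma slope_mono (hp : 2 ≤ p) : Monotone (slope p N) :=
  monotone_of_hasDerivAt_nonneg (hasDerivAt_slope hp) fun x => curv_nonneg x

lemma slope_zero : slope p N 0 = 0 := by simp [slope]

lemma wt_zero : wt p N 0 = 0 := by simp [wt]

lemma slope_nonneg (hp : 2 ≤ p) {x : ℝ} (hx : 0 ≤ x) : 0 ≤ slope p N x := by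
  rw [← slope_zero (p := p) (N := N)]; exact slope_mono hp hx

lemma wt_mono (hp : 2 ≤ p) {x y : ℝ} (hx : 0 ≤ x) (hxy : x ≤ y) : wt p N x ≤ wt p N y := by
  refine monotoneOn_of_hasDerivWithinAt_nonneg (f' := slope p N) (convex_Ici 0)
    (continuous_wt hp).continuousOn
    (fun x _ => (hasDerivAt_wt hp x).hasDerivWithinAt) (fun x h => ?_) hx (hx.trans hxy) hxy
  rw [interior_Ici] at h
  exact slope_nonneg hp (le_of_lt h)

lemma wt_nonneg (hp : 2 ≤ p) {x : ℝ} (hx : 0 ≤ x) : 0 ≤ wt p N x := by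
  rw [← wt_zero (p := p) (N := N)]; exact wt_mono hp le_rfl hx

lemma mul_rpow_sub_two {x : ℝ} (hx : 0 ≤ x) (hp : 2 ≤ p) : x * x ^ (p - 2) = x ^ (p - 1) := by
  rcases hx.eq_or_lt with rfl | h
  · rw [zero_mul, Real.zero_rpow (by linarith)]
  · rw [show p - 1 = 1 + (p - 2) by ring, Real.rpow_add h, Real.rpow_one]

lemma integral_rpow_sub_two (hp : 2 ≤ p) (x : ℝ) :
    ∫ y in (0 : ℝ)..x, y ^ (p - 2) = x ^ (p - 1) / (p - 1) := by
  rw [integral_rpow (Or.inl (by linarith)), show p - 2 + 1 = p - 1 by ring,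
    Real.zero_rpow (by linarith), sub_zero]

lemma integral_rpow_sub_one (hp : 2 ≤ p) (x : ℝ) :
    ∫ y in (0 : ℝ)..x, y ^ (p - 1) / (p - 1) = x ^ p / (p * (p - 1)) := by
  rw [intervalIntegral.integral_div, integral_rpow (Or.inl (by linarith)),
    show p - 1 + 1 = p by ring, Real.zero_rpow (by linarith), sub_zero, div_div]

/-- The cutoff decreases, so on `[0, x]` the truncated second derivative is at least `cutoff N x`
times the pure power. The relation between the derivatives of a power thus survives truncation with
the same constant for every `N`. -/
lemma mul_curv_le (hp : 2 ≤ p) (hN : 0 < N) {x : ℝ} (hx : 0 ≤ x) :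
    x * curv p N x ≤ (p - 1) * slope p N x := by
  have hp1 : 0 < p - 1 := by linarith
  have h : ∫ y in (0 : ℝ)..x, y ^ (p - 2) * cutoff N x ≤ slope p N x := by
    refine intervalIntegral.integral_mono_on hx ?_ ((continuous_curv hp).intervalIntegrable _ _) ?_
    · exact (intervalIntegral.intervalIntegrable_rpow' (by linarith)).mul_const _
    · intro y hy
      rw [curv_of_nonneg hy.1]
      exact mul_le_mul_of_nonneg_left (cutoff_anti hN hy.2) (Real.rpow_nonneg hy.1 _)
  rw [intervalIntegral.integral_mul_const, integral_rpow_sub_two hp] at h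
  rw [curv_of_nonneg hx, ← mul_assoc, mul_rpow_sub_two hx hp]
  calc x ^ (p - 1) * cutoff N x = (p - 1) * (x ^ (p - 1) / (p - 1) * cutoff N x) := by field_simp
    _ ≤ _ := by gcongr

/-- The derivative of `p * wt - x * slope` is `(p - 1) * slope - x * curv`, nonnegative by
`mul_curv_le`, and the difference vanishes at `0`. -/
lemma mul_slope_le (hp : 2 ≤ p) (hN : 0 < N) {x : ℝ} (hx : 0 ≤ x) :
    x * slope p N x ≤ p * wt p N x := by
  have h : MonotoneOn (fun y => p * wt p N y - y * slope p N y) (Ici 0) := by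
    refine monotoneOn_of_hasDerivWithinAt_nonneg (convex_Ici 0)
      (f' := fun y => p * slope p N y - (1 * slope p N y + y * curv p N y)) ?_ ?_ ?_
    · exact (((continuous_wt hp).const_mul p).sub
        (continuous_id.mul (continuous_slope hp))).continuousOn
    · intro y _
      exact (((hasDerivAt_wt hp y).const_mul p).sub
        ((hasDerivAt_id y).mul (hasDerivAt_slope hp y))).hasDerivWithinAt
    · intro y hy
      rw [interior_Ici] at hy
      have := mul_curv_le hp hN (le_of_lt hy)
      linarith
  have := h (mem_Ici.2 le_rfl) (mem_Ici.2 hx) hx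
  simp only [wt_zero] at this
  linarith

lemma wt_le_mul_slope (hp : 2 ≤ p) {x : ℝ} (hx : 0 ≤ x) : wt p N x ≤ x * slope p N x := by
  have : wt p N x ≤ ∫ _ in (0 : ℝ)..x, slope p N x :=
    intervalIntegral.integral_mono_on hx ((continuous_slope hp).intervalIntegrable _ _)
      (by simp) fun y hy => slope_mono hp hy.2
  simpa using this

/-- Rescale the integral; doubling the argument lowers the cutoff, so truncation only helps. -/
lemma slope_two_mul_le (hp : 2 ≤ p) (hN : 0 < N) {x : ℝ} (hx : 0 ≤ x) :
    slope p N (2 * x) ≤ 2 ^ (p - 1) * slope p N x := by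
  have h2 : slope p N (2 * x) = 2 * ∫ y in (0 : ℝ)..x, curv p N (2 * y) := by
    rw [intervalIntegral.integral_comp_mul_left _ (two_ne_zero)]
    simp [slope]
  have h : ∫ y in (0 : ℝ)..x, curv p N (2 * y) ≤ ∫ y in (0 : ℝ)..x, 2 ^ (p - 2) * curv p N y := by
    refine intervalIntegral.integral_mono_on hx ?_ ?_ ?_
    · exact ((continuous_curv hp).comp (continuous_const.mul continuous_id)).intervalIntegrable _ _
    · exact (continuous_const.mul (continuous_curv hp)).intervalIntegrable _ _
    · intro y hy
      rw [curv_of_nonneg hy.1, curv_of_nonneg (by linarith [hy.1]),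
        Real.mul_rpow zero_le_two hy.1, ← mul_assoc]
      refine mul_le_mul_of_nonneg_left (cutoff_anti hN (by linarith [hy.1])) ?_
      have := hy.1
      positivity
  rw [intervalIntegral.integral_const_mul] at h
  rw [h2, show p - 1 = 1 + (p - 2) by ring, Real.rpow_add two_pos, Real.rpow_one, mul_assoc]
  exact mul_le_mul_of_nonneg_left h zero_le_two

lemma wt_two_mul_le (hp : 2 ≤ p) (hN : 0 < N) {x : ℝ} (hx : 0 ≤ x) :
    wt p N (2 * x) ≤ 2 ^ p * wt p N x := by
  have h2 : wt p N (2 * x) = 2 * ∫ y in (0 : ℝ)..x, slope p N (2 * y) := by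
    rw [intervalIntegral.integral_comp_mul_left _ (two_ne_zero)]
    simp [wt]
  have h : ∫ y in (0 : ℝ)..x, slope p N (2 * y) ≤
      ∫ y in (0 : ℝ)..x, 2 ^ (p - 1) * slope p N y := by
    refine intervalIntegral.integral_mono_on hx ?_ ?_ ?_
    · exact ((continuous_slope hp).comp (continuous_const.mul continuous_id)).intervalIntegrable _ _
    · exact (continuous_const.mul (continuous_slope hp)).intervalIntegrable _ _
    · intro y hy
      exact slope_two_mul_le hp hN hy.1
  rw [intervalIntegral.integral_const_mul] at h
  rw [h2]
  calc 2 * ∫ y in (0 : ℝ)..x, slope p N (2 * y) ≤ 2 * (2 ^ (p - 1) * wt p N x) := by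
        unfold wt; gcongr
    _ = 2 ^ p * wt p N x := by
        rw [← mul_assoc]
        congr 1
        nth_rw 1 [← Real.rpow_one 2]
        rw [← Real.rpow_add two_pos]; congr 1; ring

lemma slope_le_rpow (hp : 2 ≤ p) {x : ℝ} (hx : 0 ≤ x) : slope p N x ≤ x ^ (p - 1) := by
  have h : slope p N x ≤ ∫ y in (0 : ℝ)..x, y ^ (p - 2) := by
    refine intervalIntegral.integral_mono_on hx ((continuous_curv hp).intervalIntegrable _ _)
      (intervalIntegral.intervalIntegrable_rpow' (by linarith)) fun y hy => ?_
    rw [curv_of_nonneg hy.1]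
    exact mul_le_of_le_one_right (Real.rpow_nonneg hy.1 _) (cutoff_le_one _ _)
  rw [integral_rpow_sub_two hp] at h
  exact h.trans (div_le_self (Real.rpow_nonneg hx _) (by linarith))

lemma wt_le_rpow (hp : 2 ≤ p) {x : ℝ} (hx : 0 ≤ x) : wt p N x ≤ x ^ p := by
  refine (wt_le_mul_slope hp hx).trans ?_
  have := mul_le_mul_of_nonneg_left (slope_le_rpow (N := N) hp hx) hx
  refine this.trans_eq ?_
  have := mul_rpow_sub_two hx (p := p + 1) (by linarith)
  convert this using 2 <;> ring_nf

lemma slope_of_le (hp : 2 ≤ p) (hN : 0 < N) {x : ℝ} (h0 : 0 ≤ x) (hx : x ≤ N) :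
    slope p N x = x ^ (p - 1) / (p - 1) := by
  rw [← integral_rpow_sub_two hp]
  refine intervalIntegral.integral_congr fun y hy => ?_
  rw [uIcc_of_le h0] at hy
  rw [curv_of_nonneg hy.1, cutoff_eq_one hN (hy.2.trans hx), mul_one]

lemma wt_of_le (hp : 2 ≤ p) (hN : 0 < N) {x : ℝ} (h0 : 0 ≤ x) (hx : x ≤ N) :
    wt p N x = x ^ p / (p * (p - 1)) := by
  rw [← integral_rpow_sub_one hp]
  refine intervalIntegral.integral_congr fun y hy => ?_
  rw [uIcc_of_le h0] at hy
  exact slope_of_le hp hN hy.1 (hy.2.trans hx)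

lemma slope_of_ge (hp : 2 ≤ p) (hN : 0 < N) {x : ℝ} (hx : 2 * N ≤ x) :
    slope p N x = slope p N (2 * N) := by
  have h := intervalIntegral.integral_add_adjacent_intervals
    ((continuous_curv (N := N) hp).intervalIntegrable (μ := volume) 0 (2 * N))
    ((continuous_curv (N := N) hp).intervalIntegrable (2 * N) x)
  have h0 : ∫ y in (2 * N)..x, curv p N y = 0 := by
    rw [← intervalIntegral.integral_zero (a := 2 * N) (b := x) (μ := volume) (E := ℝ)]
    refine intervalIntegral.integral_congr fun y hy => ?_
    rw [uIcc_of_le hx] at hy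
    simp [curv, cutoff_eq_zero hN hy.1]
  rw [h0, add_zero] at h
  exact h.symm

lemma slope_le_max (hp : 2 ≤ p) (hN : 0 < N) (x : ℝ) : slope p N x ≤ slope p N (2 * N) := by
  rcases le_total x (2 * N) with h | h
  · exact slope_mono hp h
  · exact (slope_of_ge hp hN h).le

lemma wt_of_ge (hp : 2 ≤ p) (hN : 0 < N) {x : ℝ} (hx : 2 * N ≤ x) :
    wt p N x = wt p N (2 * N) + slope p N (2 * N) * (x - 2 * N) := by
  have h := intervalIntegral.integral_add_adjacent_intervals
    ((continuous_slope (N := N) hp).intervalIntegrable (μ := volume) 0 (2 * N))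
    ((continuous_slope (N := N) hp).intervalIntegrable (2 * N) x)
  have h0 : ∫ y in (2 * N)..x, slope p N y = slope p N (2 * N) * (x - 2 * N) := by
    have h1 : slope p N (2 * N) * (x - 2 * N) = ∫ _ in (2 * N)..x, slope p N (2 * N) := by
      rw [intervalIntegral.integral_const, smul_eq_mul, mul_comm]
    rw [h1]
    refine intervalIntegral.integral_congr fun y hy => ?_
    rw [uIcc_of_le hx] at hy
    exact slope_of_ge hp hN hy.1
  rw [h0] at h
  exact h.symm

/-! ### Increments of `d ↦ Ψ (a + d) + Ψ (a - d)` -/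

lemma hasDerivAt_evenSum (hp : 2 ≤ p) (a d : ℝ) :
    HasDerivAt (fun d => wt p N (a + d) + wt p N (a - d))
      (slope p N (a + d) - slope p N (a - d)) d := by
  have h1 : HasDerivAt (fun d : ℝ => a + d) 1 d := (hasDerivAt_id d).const_add a
  have h2 : HasDerivAt (fun d : ℝ => a - d) (-1) d := (hasDerivAt_id d).const_sub a
  have := ((hasDerivAt_wt (N := N) hp (a + d)).comp d h1).add
    ((hasDerivAt_wt (N := N) hp (a - d)).comp d h2)
  rw [mul_one, mul_neg_one, ← sub_eq_add_neg] at this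
  exact this

/-- Convexity: the derivative in `d` is the difference of the slopes at `a + d` and `a - d`. -/
lemma evenSum_mono (hp : 2 ≤ p) {a d e : ℝ} (hd : 0 ≤ d) (hde : d ≤ e) :
    wt p N (a + d) + wt p N (a - d) ≤ wt p N (a + e) + wt p N (a - e) := by
  refine monotoneOn_of_hasDerivWithinAt_nonneg (convex_Ici 0)
    (f := fun d => wt p N (a + d) + wt p N (a - d))
    (fun x _ => (hasDerivAt_evenSum hp a x).continuousAt.continuousWithinAt)
    (fun x _ => (hasDerivAt_evenSum hp a x).hasDerivWithinAt) (fun x h => ?_)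
    (mem_Ici.2 hd) (mem_Ici.2 (hd.trans hde)) hde
  rw [interior_Ici] at h
  have h : 0 < x := h
  have := slope_mono (N := N) hp (show a - x ≤ a + x by linarith)
  linarith

lemma evenSum_sub_le (hp : 2 ≤ p) {a d e L : ℝ} (hde : d ≤ e)
    (hL : ∀ x ∈ Icc d e, slope p N (a + x) - slope p N (a - x) ≤ L) :
    wt p N (a + e) + wt p N (a - e) - (wt p N (a + d) + wt p N (a - d)) ≤ L * (e - d) := by
  have := monotoneOn_of_hasDerivWithinAt_nonneg (convex_Icc d e)
    (f := fun x => L * x - (wt p N (a + x) + wt p N (a - x)))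
    (f' := fun x => L * 1 - (slope p N (a + x) - slope p N (a - x)))
    (fun x _ => (((hasDerivAt_id x).const_mul L).sub
      (hasDerivAt_evenSum hp a x)).continuousAt.continuousWithinAt)
    (fun x _ => (((hasDerivAt_id x).const_mul L).sub
      (hasDerivAt_evenSum hp a x)).hasDerivWithinAt) (fun x h => ?_)
    (left_mem_Icc.2 hde) (right_mem_Icc.2 hde) hde
  · simp only at this
    linarith
  · have := hL x (interior_subset h)
    linarith

lemma evenSum_abs (a d : ℝ) :
    wt p N (a + |d|) + wt p N (a - |d|) = wt p N (a + d) + wt p N (a - d) := by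
  rcases abs_cases d with ⟨h, _⟩ | ⟨h, _⟩ <;> rw [h]
  rw [add_comm, sub_neg_eq_add, ← sub_eq_add_neg]

/-- One-sided on purpose: a decrease of `|d|` lowers the sum and costs nothing, so only the possible
increase `h` is paid for. -/
lemma evenSum_sub_le_max (hp : 2 ≤ p) {a d e h : ℝ} (he : |e| ≤ a) (hh : 0 ≤ h)
    (hde : |e| - |d| ≤ h) :
    wt p N (a + e) + wt p N (a - e) - (wt p N (a + d) + wt p N (a - d)) ≤
      slope p N (2 * a) * h := by
  have ha : 0 ≤ a := (abs_nonneg _).trans he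
  have hs : 0 ≤ slope p N (2 * a) := slope_nonneg hp (by linarith)
  rw [← evenSum_abs a e, ← evenSum_abs a d]
  rcases le_total |d| |e| with h1 | h1
  · refine (evenSum_sub_le hp (L := slope p N (2 * a)) h1 fun x hx => ?_).trans (by gcongr)
    have h2 : slope p N (a + x) ≤ slope p N (2 * a) := slope_mono hp (by linarith [hx.2])
    have h3 : 0 ≤ slope p N (a - x) := slope_nonneg hp (by linarith [hx.2])
    linarith
  · have := evenSum_mono (N := N) (a := a) hp (abs_nonneg e) h1
    have : 0 ≤ slope p N (2 * a) * h := by positivity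
    linarith

lemma abs_evenSum_sub_le (hp : 2 ≤ p) {a d e h L : ℝ} (hde : |(|e| - |d|)| ≤ h) (hL0 : 0 ≤ L)
    (hL : ∀ x, 0 ≤ x → x ≤ max |d| |e| → slope p N (a + x) - slope p N (a - x) ≤ L) :
    |wt p N (a + e) + wt p N (a - e) - (wt p N (a + d) + wt p N (a - d))| ≤ L * h := by
  rw [← evenSum_abs a e, ← evenSum_abs a d]
  rcases le_total |d| |e| with h1 | h1
  · rw [abs_of_nonneg (sub_nonneg.2 (evenSum_mono hp (abs_nonneg _) h1))]
    refine (evenSum_sub_le hp (L := L) h1 fun x hx => hL x ((abs_nonneg _).trans hx.1)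
      (hx.2.trans (le_max_right _ _))).trans ?_
    gcongr
    exact (le_abs_self _).trans hde
  · rw [abs_of_nonpos (sub_nonpos.2 (evenSum_mono hp (abs_nonneg _) h1)), neg_sub]
    refine (evenSum_sub_le hp (L := L) h1 fun x hx => hL x ((abs_nonneg _).trans hx.1)
      (hx.2.trans (le_max_left _ _))).trans ?_
    gcongr
    rw [abs_sub_comm] at hde
    exact (le_abs_self _).trans hde

/-- For `x ≤ a / 2` the interval of integration stays in `[a / 2, 3 a / 2]`, where the second
derivative is comparable to `slope a / a` by `mul_curv_le` and doubling. -/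
lemma slope_sub_le (hp : 2 ≤ p) (hN : 0 < N) {a x : ℝ} (ha : 0 < a) (hx : 0 ≤ x)
    (hxa : x ≤ a / 2) :
    slope p N (a + x) - slope p N (a - x) ≤ p * 2 ^ (p + 1) * (slope p N a / a) * x := by
  have hs := slope_nonneg (N := N) hp ha.le
  have h1 : slope p N (a + x) - slope p N (a - x) = ∫ y in (a - x)..(a + x), curv p N y :=
    intervalIntegral.integral_interval_sub_left ((continuous_curv hp).intervalIntegrable _ _)
      ((continuous_curv hp).intervalIntegrable _ _)
  have h2 : ∫ y in (a - x)..(a + x), curv p N y ≤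
      ∫ _ in (a - x)..(a + x), p * 2 ^ p * (slope p N a / a) := by
    refine intervalIntegral.integral_mono_on (by linarith)
      ((continuous_curv hp).intervalIntegrable _ _) (by simp) fun y hy => ?_
    have hy0 : 0 < y := by linarith [hy.1]
    have hya : a / 2 ≤ y := by linarith [hy.1]
    have h3 := mul_curv_le hp hN hy0.le
    have h4 : slope p N y ≤ 2 ^ (p - 1) * slope p N a :=
      (slope_mono hp (by linarith [hy.2])).trans (slope_two_mul_le hp hN ha.le)
    have h5 : a / 2 * curv p N y ≤ p * (2 ^ (p - 1) * slope p N a) := by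
      calc a / 2 * curv p N y ≤ y * curv p N y := by gcongr; exact curv_nonneg y
        _ ≤ (p - 1) * slope p N y := h3
        _ ≤ p * (2 ^ (p - 1) * slope p N a) := by
            gcongr
            · exact slope_nonneg hp hy0.le
            · linarith
    have h6 : (2 : ℝ) ^ p = 2 * 2 ^ (p - 1) := by
      nth_rw 2 [← Real.rpow_one 2]
      rw [← Real.rpow_add two_pos]; congr 1; ring
    rw [h6, mul_div_assoc', le_div_iff₀ ha]
    linarith
  rw [h1]
  refine h2.trans_eq ?_
  rw [intervalIntegral.integral_const, Real.rpow_add two_pos, Real.rpow_one, smul_eq_mul]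
  ring

end weight

/-! ### Geometry of collisions -/

/-- The energy density `1 + |v|²`. -/
def en (v : V) : ℝ := 1 + ‖v‖ ^ 2

/-- Half of the total energy of a colliding pair, a collision invariant. -/
def avg (v w : V) : ℝ := (en v + en w) / 2

/-- The centre of mass of a colliding pair. -/
def mid (v w : V) : V := (2⁻¹ : ℝ) • (v + w)

/-- The cosine of the deviation angle. -/
def cs (v w : V) (σ : S2) : ℝ := ⟪v - w, (σ : V)⟫ / ‖v - w‖

/-- The sine of the deviation angle. -/
def sn (c : ℝ) : ℝ := Real.sqrt (1 - c ^ 2)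

lemma one_le_en (v : V) : 1 ≤ en v := by unfold en; nlinarith [sq_nonneg ‖v‖]

lemma en_pos (v : V) : 0 < en v := zero_lt_one.trans_le (one_le_en v)

lemma one_le_avg (v w : V) : 1 ≤ avg v w := by
  have := one_le_en v; have := one_le_en w; unfold avg; linarith

lemma avg_pos (v w : V) : 0 < avg v w := zero_lt_one.trans_le (one_le_avg v w)

lemma sn_nonneg (c : ℝ) : 0 ≤ sn c := Real.sqrt_nonneg _

lemma sn_le_one (c : ℝ) : sn c ≤ 1 := by
  unfold sn; rw [Real.sqrt_le_iff]; constructor <;> nlinarith [sq_nonneg c]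

lemma norm_sphere (σ : S2) : ‖(σ : V)‖ = 1 := by simp

lemma abs_cs_le_one (v w : V) (σ : S2) : |cs v w σ| ≤ 1 := by
  unfold cs
  rw [abs_div, abs_norm]
  refine div_le_one_of_le₀ ?_ (norm_nonneg _)
  simpa [norm_sphere] using abs_real_inner_le_norm (v - w) (σ : V)

lemma kernel_eq (B : ℝ → ℝ → ℝ) (v w : V) (σ : S2) :
    kernel B (v - w) σ = B ‖v - w‖ (cs v w σ) := rfl

lemma norm_sq_mid (v w : V) : ‖mid v w‖ ^ 2 + ‖v - w‖ ^ 2 / 4 = avg v w - 1 := by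
  have h1 := norm_add_sq_real v w
  have h2 := norm_sub_sq_real v w
  have h3 : ‖mid v w‖ ^ 2 = ‖v + w‖ ^ 2 / 4 := by
    unfold mid; rw [norm_smul, mul_pow]; norm_num; ring
  rw [h3]; unfold avg en; linarith

lemma inner_mid_sub (v w : V) : ⟪mid v w, v - w⟫ = (en v - en w) / 2 := by
  unfold mid en
  rw [inner_smul_left, inner_add_left, inner_sub_right, inner_sub_right, real_inner_self_eq_norm_sq,
    real_inner_self_eq_norm_sq, real_inner_comm w v]
  simp; ring

lemma en_eq_left (v w : V) : en v = avg v w + ⟪mid v w, v - w⟫ := by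
  rw [inner_mid_sub]; unfold avg; ring

lemma en_eq_right (v w : V) : en w = avg v w - ⟪mid v w, v - w⟫ := by
  rw [inner_mid_sub]; unfold avg; ring

lemma post_eq (v w : V) (σ : S2) : post v w σ = mid v w + (2⁻¹ * ‖v - w‖) • (σ : V) := rfl

lemma postStar_eq (v w : V) (σ : S2) : postStar v w σ = mid v w - (2⁻¹ * ‖v - w‖) • (σ : V) := rfl

lemma en_post (v w : V) (σ : S2) :
    en (post v w σ) = avg v w + ‖v - w‖ * ⟪mid v w, (σ : V)⟫ := by
  have h := norm_sq_mid v w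
  rw [post_eq, en, norm_add_sq_real, inner_smul_right, norm_smul, norm_sphere]
  simp only [mul_one, Real.norm_eq_abs, sq_abs]
  nlinarith

lemma en_postStar (v w : V) (σ : S2) :
    en (postStar v w σ) = avg v w - ‖v - w‖ * ⟪mid v w, (σ : V)⟫ := by
  have h := norm_sq_mid v w
  rw [postStar_eq, en, norm_sub_sq_real, inner_smul_right, norm_smul, norm_sphere]
  simp only [mul_one, Real.norm_eq_abs, sq_abs]
  nlinarith

lemma en_post_add (v w : V) (σ : S2) : en (post v w σ) + en (postStar v w σ) = en v + en w := by
  rw [en_post, en_postStar]; unfold avg; ring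

lemma post_sub_postStar (v w : V) (σ : S2) :
    post v w σ - postStar v w σ = ‖v - w‖ • (σ : V) := by
  rw [post_eq, postStar_eq, add_sub_sub_cancel, ← add_smul]
  congr 1; ring

lemma post_add_postStar (v w : V) (σ : S2) : post v w σ + postStar v w σ = v + w := by
  rw [post_eq, postStar_eq, add_add_sub_cancel]
  unfold mid
  rw [← add_smul]; norm_num

lemma norm_post_sub (v w : V) (σ : S2) : ‖post v w σ - postStar v w σ‖ = ‖v - w‖ := by
  rw [post_sub_postStar, norm_smul, norm_sphere, mul_one, norm_norm]

lemma mid_post (v w : V) (σ : S2) : mid (post v w σ) (postStar v w σ) = mid v w := by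
  unfold mid; rw [post_add_postStar]

lemma avg_post (v w : V) (σ : S2) : avg (post v w σ) (postStar v w σ) = avg v w := by
  unfold avg; rw [en_post_add]

lemma abs_inner_mid_sub_le (v w : V) : |⟪mid v w, v - w⟫| ≤ ‖mid v w‖ * ‖v - w‖ :=
  abs_real_inner_le_norm _ _

lemma abs_inner_mid_sphere_le (v w : V) (σ : S2) :
    |‖v - w‖ * ⟪mid v w, (σ : V)⟫| ≤ ‖mid v w‖ * ‖v - w‖ := by
  have := abs_real_inner_le_norm (mid v w) (σ : V)
  rw [norm_sphere, mul_one] at this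
  rw [abs_mul, abs_norm, mul_comm]
  gcongr

/-- The change from `(v, w)` to `(mid v w, v - w)` has determinant `-1`, so the Gram determinant is
that of `(v, w)`, from which `⟪v, w⟫ ^ 2` is dropped. -/
lemma gram_mid (v w : V) :
    ‖mid v w‖ ^ 2 * ‖v - w‖ ^ 2 - ⟪mid v w, v - w⟫ ^ 2 ≤ (‖v‖ * ‖w‖) ^ 2 := by
  have h1 := norm_add_sq_real v w
  have h2 := norm_sub_sq_real v w
  have h3 : ‖mid v w‖ ^ 2 = ‖v + w‖ ^ 2 / 4 := by
    unfold mid; rw [norm_smul, mul_pow]; norm_num; ring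
  rw [inner_mid_sub, h3, h1, h2]
  unfold en
  nlinarith [sq_nonneg ⟪v, w⟫]

/-- The energy transfer after the collision, split along and across the incoming direction. -/
lemma exists_transfer (v w : V) (σ : S2) :
    ∃ k : ℝ, ‖v - w‖ * ⟪mid v w, (σ : V)⟫ = cs v w σ * ⟪mid v w, v - w⟫ + k ∧
      |k| ≤ sn (cs v w σ) * (‖v‖ * ‖w‖) ∧ |k| ≤ sn (cs v w σ) * (‖mid v w‖ * ‖v - w‖) := by
  refine ⟨‖v - w‖ * ⟪mid v w, (σ : V)⟫ - cs v w σ * ⟪mid v w, v - w⟫, by ring, ?_⟩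
  have hg := gram_mid v w
  rcases eq_or_ne (v - w) 0 with hz | hz
  · rw [hz]; simp only [norm_zero, inner_zero_right]
    simp only [zero_mul, mul_zero, sub_zero, abs_zero, le_refl, and_true]
    have := sn_nonneg (cs v w σ)
    positivity
  have hr : 0 < ‖v - w‖ := norm_pos_iff.2 hz
  set z := v - w
  set U := mid v w
  set c := cs v w σ
  set D := ⟪U, z⟫
  set P := ⟪U, (σ : V)⟫
  have hc : ⟪z, (σ : V)⟫ = c * ‖z‖ := by
    exact (div_mul_cancel₀ _ hr.ne').symm
  -- Cauchy–Schwarz for the components of `U` and `σ` orthogonal to `z`; the second has length `sin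
  -- θ`, the first is the square root of the Gram determinant over `‖z‖`.
  have hcs := abs_real_inner_le_norm (U - (D / ‖z‖ ^ 2) • z) ((σ : V) - (c / ‖z‖) • z)
  have e1 : ⟪U - (D / ‖z‖ ^ 2) • z, (σ : V) - (c / ‖z‖) • z⟫ = P - c * D / ‖z‖ := by
    simp only [inner_sub_left, inner_sub_right, inner_smul_left, inner_smul_right, hc,
      real_inner_self_eq_norm_sq]
    simp only [conj_trivial]
    field_simp
    ring
  have e2 : ‖U - (D / ‖z‖ ^ 2) • z‖ ^ 2 = ‖U‖ ^ 2 - D ^ 2 / ‖z‖ ^ 2 := by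
    rw [norm_sub_sq_real, inner_smul_right, norm_smul, mul_pow, Real.norm_eq_abs, sq_abs]
    change ‖U‖ ^ 2 - 2 * (D / ‖z‖ ^ 2 * D) + _ = _
    field_simp
    ring
  have e3 : ‖(σ : V) - (c / ‖z‖) • z‖ ^ 2 = 1 - c ^ 2 := by
    rw [norm_sub_sq_real, inner_smul_right, norm_smul, mul_pow, Real.norm_eq_abs, sq_abs,
      real_inner_comm, hc, norm_sphere]
    field_simp
    ring
  have hs : ‖(σ : V) - (c / ‖z‖) • z‖ = sn c := by
    rw [sn, ← e3, Real.sqrt_sq (norm_nonneg _)]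
  rw [hs, e1] at hcs
  have key : |‖z‖ * P - c * D| ≤ sn c * (‖z‖ * ‖U - (D / ‖z‖ ^ 2) • z‖) := by
    have : ‖z‖ * P - c * D = ‖z‖ * (P - c * D / ‖z‖) := by field_simp
    rw [this, abs_mul, abs_norm]
    calc ‖z‖ * |P - c * D / ‖z‖| ≤ ‖z‖ * (‖U - (D / ‖z‖ ^ 2) • z‖ * sn c) := by gcongr
      _ = _ := by ring
  have hu : (‖z‖ * ‖U - (D / ‖z‖ ^ 2) • z‖) ^ 2 = ‖U‖ ^ 2 * ‖z‖ ^ 2 - D ^ 2 := by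
    rw [mul_pow, e2]; field_simp
  constructor
  · refine key.trans (mul_le_mul_of_nonneg_left ?_ (sn_nonneg _))
    exact abs_le_of_sq_le_sq' (hu.trans_le hg) (by positivity) |>.2
  · refine key.trans (mul_le_mul_of_nonneg_left ?_ (sn_nonneg _))
    refine abs_le_of_sq_le_sq' (hu.trans_le ?_) (by positivity) |>.2
    rw [mul_pow]; nlinarith [sq_nonneg D]

/-- The longitudinal part is multiplied by a cosine and cannot grow in absolute value; only the
transverse part can. -/
lemma abs_transfer_sub_le (v w : V) (σ : S2) :
    |‖v - w‖ * ⟪mid v w, (σ : V)⟫| - |⟪mid v w, v - w⟫| ≤ sn (cs v w σ) * (‖v‖ * ‖w‖) := by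
  obtain ⟨k, hk, hk1, -⟩ := exists_transfer v w σ
  rw [hk]
  have h1 := abs_add_le (cs v w σ * ⟪mid v w, v - w⟫) k
  rw [abs_mul] at h1
  have := mul_le_of_le_one_left (abs_nonneg ⟪mid v w, v - w⟫) (abs_cs_le_one v w σ)
  linarith

lemma one_sub_abs_le_sn {c : ℝ} (hc : |c| ≤ 1) : 1 - |c| ≤ sn c := by
  refine Real.le_sqrt_of_sq_le ?_
  rw [← sq_abs c]; nlinarith [abs_nonneg c]

/-- The longitudinal part can shrink by the fraction `1 - |cos θ|`, again at most `sin θ`; together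
with the transverse part this gives the factor `2`. -/
lemma abs_abs_transfer_sub_le (v w : V) (σ : S2) :
    |(|‖v - w‖ * ⟪mid v w, (σ : V)⟫| - |⟪mid v w, v - w⟫|)| ≤
      2 * sn (cs v w σ) * (‖mid v w‖ * ‖v - w‖) := by
  obtain ⟨k, hk, -, hk1⟩ := exists_transfer v w σ
  rw [hk]
  have h1 := abs_add_le (cs v w σ * ⟪mid v w, v - w⟫) k
  have h1' := abs_sub_abs_le_abs_add (cs v w σ * ⟪mid v w, v - w⟫) k
  rw [abs_mul] at h1 h1'
  have h2 := abs_cs_le_one v w σ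
  have h3 := one_sub_abs_le_sn h2
  have h4 := abs_inner_mid_sub_le v w
  have h5 := abs_nonneg ⟪mid v w, v - w⟫
  have h6 := sn_nonneg (cs v w σ)
  have h7 : (1 - |cs v w σ|) * |⟪mid v w, v - w⟫| ≤
    sn (cs v w σ) * (‖mid v w‖ * ‖v - w‖) := by gcongr
  have h8 : 0 ≤ (1 - |cs v w σ|) * |⟪mid v w, v - w⟫| := mul_nonneg (by linarith) h5
  have h9 : 0 ≤ sn (cs v w σ) * (‖mid v w‖ * ‖v - w‖) := by positivity
  rw [abs_le]
  constructor <;> nlinarith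

lemma norm_mid_mul_le (v w : V) : ‖mid v w‖ * ‖v - w‖ ≤ avg v w := by
  nlinarith [norm_sq_mid v w, sq_nonneg (‖mid v w‖ - ‖v - w‖ / 2)]

/-- Colliding pairs that are close to each other relative to their energy. -/
def Near (v w : V) : Prop := 4 * ‖v - w‖ ^ 2 ≤ avg v w

/-- The threshold `4` in `Near` is what makes the energy difference at most half of the mean, so
that both particles of a close pair have energy comparable to `avg`. -/
lemma Near.norm_mid_mul_le {v w : V} (h : Near v w) : ‖mid v w‖ * ‖v - w‖ ≤ avg v w / 2 := by
  have h1 := norm_sq_mid v w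
  have h2 : (‖mid v w‖ * ‖v - w‖) ^ 2 ≤ (avg v w / 2) ^ 2 := by
    unfold Near at h
    rw [mul_pow]
    have : ‖mid v w‖ ^ 2 ≤ avg v w := by nlinarith [sq_nonneg ‖v - w‖]
    calc ‖mid v w‖ ^ 2 * ‖v - w‖ ^ 2 ≤ avg v w * (avg v w / 4) := by
          gcongr
          · exact (avg_pos v w).le
          · linarith
      _ = _ := by ring
  exact abs_le_of_sq_le_sq' h2 (by linarith [avg_pos v w]) |>.2

lemma Near.avg_le_left {v w : V} (h : Near v w) : avg v w ≤ 2 * en v := by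
  have h1 := (abs_inner_mid_sub_le v w).trans h.norm_mid_mul_le
  have := en_eq_left v w
  have := (abs_le.1 h1).1
  linarith

lemma Near.avg_le_right {v w : V} (h : Near v w) : avg v w ≤ 2 * en w := by
  have h1 := (abs_inner_mid_sub_le v w).trans h.norm_mid_mul_le
  have := en_eq_right v w
  have := (abs_le.1 h1).2
  linarith

lemma near_post (v w : V) (σ : S2) : Near (post v w σ) (postStar v w σ) ↔ Near v w := by
  unfold Near; rw [avg_post, norm_post_sub]

lemma norm_mul_norm_le (v w : V) : ‖v‖ * ‖w‖ ≤ Real.sqrt (en v * en w) := by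
  refine Real.le_sqrt_of_sq_le ?_
  unfold en
  rw [mul_pow]; nlinarith [sq_nonneg ‖v‖, sq_nonneg ‖w‖]

/-! ### Increments of the weight in a collision -/

section delta

variable {p N : ℝ}

/-- The truncated weight as a function of the velocity. -/
def vwt (p N : ℝ) (v : V) : ℝ := wt p N (en v)

/-- Before and after the collision the two energies are `avg ± d`, with the same `avg`; the
increment compares one even function of `d` at two values. -/
lemma delta_vwt (v w : V) (σ : S2) :
    Δ (vwt p N) v w σ =
      wt p N (avg v w + ‖v - w‖ * ⟪mid v w, (σ : V)⟫)
        + wt p N (avg v w - ‖v - w‖ * ⟪mid v w, (σ : V)⟫)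
        - (wt p N (avg v w + ⟪mid v w, v - w⟫) + wt p N (avg v w - ⟪mid v w, v - w⟫)) := by
  unfold Δ vwt
  rw [en_post, en_postStar, ← en_eq_left, ← en_eq_right]
  ring

/-- The Povzner inequality. The single factor `sn` makes the angular singularity integrable, the
second sine coming from the area measure. -/
lemma delta_vwt_le (hp : 2 ≤ p) (v w : V) (σ : S2) :
    Δ (vwt p N) v w σ ≤
      slope p N (2 * avg v w) * (sn (cs v w σ) * Real.sqrt (en v * en w)) := by
  rw [delta_vwt]
  refine evenSum_sub_le_max hp ((abs_inner_mid_sphere_le v w σ).trans (norm_mid_mul_le v w))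
    (mul_nonneg (sn_nonneg _) (Real.sqrt_nonneg _)) ((abs_transfer_sub_le v w σ).trans ?_)
  exact mul_le_mul_of_nonneg_left (norm_mul_norm_le v w) (sn_nonneg _)

/-- Depends on `N`; it only serves to prove integrability. -/
lemma abs_delta_vwt_le (hp : 2 ≤ p) (hN : 0 < N) (v w : V) (σ : S2) :
    |Δ (vwt p N) v w σ| ≤ slope p N (2 * N) * (2 * sn (cs v w σ) * avg v w) := by
  rw [delta_vwt]
  refine abs_evenSum_sub_le hp ((abs_abs_transfer_sub_le v w σ).trans ?_)
    (slope_nonneg hp (by linarith)) fun x hx hx2 => ?_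
  · exact mul_le_mul_of_nonneg_left (norm_mid_mul_le v w)
      (mul_nonneg zero_le_two (sn_nonneg _))
  · have h1 : x ≤ avg v w := hx2.trans (max_le
      ((abs_inner_mid_sub_le v w).trans (norm_mid_mul_le v w))
      ((abs_inner_mid_sphere_le v w σ).trans (norm_mid_mul_le v w)))
    have h2 := slope_le_max hp hN (avg v w + x)
    have h3 := slope_nonneg (N := N) hp (show 0 ≤ avg v w - x by linarith)
    linarith

/-- The even sum is stationary at `d = 0`, so its increment is quadratic in the transfer, which is
at most `‖mid‖ * ‖v - w‖`. This yields the two powers of the relative speed. -/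
lemma Near.abs_delta_vwt_le {v w : V} (h : Near v w) (hp : 2 ≤ p) (hN : 0 < N) (σ : S2) :
    |Δ (vwt p N) v w σ| ≤
      p * 2 ^ (p + 2) * (sn (cs v w σ) * ‖v - w‖ ^ 2 * slope p N (avg v w)) := by
  have ha := avg_pos v w
  have hs := slope_nonneg (N := N) hp ha.le
  set X := ‖mid v w‖ * ‖v - w‖ with hX
  have hX0 : 0 ≤ X := by positivity
  have hp0 : 0 ≤ p := by linarith
  rw [delta_vwt]
  refine (abs_evenSum_sub_le hp (abs_abs_transfer_sub_le v w σ)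
    (L := p * 2 ^ (p + 1) * (slope p N (avg v w) / avg v w) * X) (by positivity)
    fun x hx hx2 => ?_).trans ?_
  · have h1 : x ≤ X := hx2.trans (max_le (abs_inner_mid_sub_le v w) (abs_inner_mid_sphere_le v w σ))
    refine (slope_sub_le hp hN ha hx (h1.trans h.norm_mid_mul_le)).trans ?_
    gcongr
  · have h1 : X * X ≤ avg v w * ‖v - w‖ ^ 2 := by
      have : ‖mid v w‖ ^ 2 ≤ avg v w := by nlinarith [norm_sq_mid v w, sq_nonneg ‖v - w‖]
      rw [hX, ← sq, mul_pow]; gcongr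
    have hsn := sn_nonneg (cs v w σ)
    calc p * 2 ^ (p + 1) * (slope p N (avg v w) / avg v w) * X * (2 * sn (cs v w σ) * X)
        = p * 2 ^ (p + 1) * 2 * (slope p N (avg v w) / avg v w) * sn (cs v w σ) * (X * X) := by ring
      _ ≤ p * 2 ^ (p + 1) * 2 * (slope p N (avg v w) / avg v w) * sn (cs v w σ)
          * (avg v w * ‖v - w‖ ^ 2) := by gcongr
      _ = p * (2 ^ (p + 1) * 2) * (sn (cs v w σ) * ‖v - w‖ ^ 2 * slope p N (avg v w)) := by
          field_simp
      _ = _ := by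
          rw [show p + 2 = p + 1 + 1 by ring, Real.rpow_add two_pos (p + 1), Real.rpow_one]

end delta

/-! ### The collision map preserves the collision measure -/

instance : IsFiniteMeasure dσ := by unfold dσ; infer_instance

instance : SigmaFinite ((volume : Measure V).prod dσ) := inferInstance

instance : SFinite ((volume : Measure V).prod dσ) := inferInstance

instance : SFinite collMeasure := by unfold collMeasure; infer_instance

/-- The direction of `z`, or `σ` when `z = 0`. -/
def dir (z : V) (σ : S2) : S2 :=
  ⟨if z = 0 then (σ : V) else ‖z‖⁻¹ • z, by
    split_ifs with h
    · exact σ.2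
    · simp [norm_smul, h]⟩

/-- The collision `(v, v_*, σ) ↦ (v', v_*', (v - v_*) / |v - v_*|)`. -/
def collMap (x : V × V × S2) : V × V × S2 :=
  (post x.1 x.2.1 x.2.2, postStar x.1 x.2.1 x.2.2, dir (x.1 - x.2.1) x.2.2)

lemma measurable_dir : Measurable fun x : V × S2 => dir x.1 x.2 := by
  refine Measurable.subtype_mk ?_
  refine Measurable.ite (measurable_fst (measurableSet_singleton 0)) ?_ ?_ <;> fun_prop

lemma measurable_post : Measurable fun x : V × V × S2 => post x.1 x.2.1 x.2.2 := by
  unfold post; fun_prop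

lemma measurable_postStar : Measurable fun x : V × V × S2 => postStar x.1 x.2.1 x.2.2 := by
  unfold postStar; fun_prop

lemma measurable_collMap : Measurable collMap := by
  refine measurable_post.prodMk (measurable_postStar.prodMk ?_)
  exact measurable_dir.comp (by fun_prop : Measurable fun x : V × V × S2 => (x.1 - x.2.1, x.2.2))

lemma norm_smul_dir (z : V) (σ : S2) : ‖z‖ • (dir z σ : V) = z := by
  unfold dir
  by_cases h : z = 0
  · simp [h]
  · simp only [h, if_false]
    rw [smul_smul, mul_inv_cancel₀ (norm_ne_zero_iff.2 h), one_smul]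

lemma dir_smul {r : ℝ} (hr : 0 < r) (ω σ : S2) : dir (r • (ω : V)) σ = ω := by
  have h : r • (ω : V) ≠ 0 := by
    rw [← norm_ne_zero_iff, norm_smul, norm_sphere, Real.norm_eq_abs, mul_one]
    exact abs_ne_zero.2 hr.ne'
  refine Subtype.ext ?_
  simp only [dir, h, if_false]
  rw [norm_smul, norm_sphere, mul_one, Real.norm_eq_abs, abs_of_pos hr, smul_smul,
    inv_mul_cancel₀ hr.ne', one_smul]

lemma post_post (v w : V) (σ : S2) :
    post (post v w σ) (postStar v w σ) (dir (v - w) σ) = v := by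
  rw [post_eq, mid_post, norm_post_sub, mul_smul, norm_smul_dir]
  unfold mid; module

lemma postStar_post (v w : V) (σ : S2) :
    postStar (post v w σ) (postStar v w σ) (dir (v - w) σ) = w := by
  rw [postStar_eq, mid_post, norm_post_sub, mul_smul, norm_smul_dir]
  unfold mid; module

lemma dir_post (v w : V) (σ : S2) :
    dir (post v w σ - postStar v w σ) (dir (v - w) σ) = σ := by
  rw [post_sub_postStar]
  by_cases h : v - w = 0
  · rw [h, norm_zero, zero_smul]
    exact Subtype.ext (by simp [dir])
  · exact dir_smul (norm_pos_iff.2 h) _ _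

lemma collMap_collMap (x : V × V × S2) : collMap (collMap x) = x := by
  unfold collMap
  simp only [post_post, postStar_post, dir_post]

lemma cs_post (v w : V) (σ : S2) :
    cs (post v w σ) (postStar v w σ) (dir (v - w) σ) = cs v w σ := by
  unfold cs
  rw [norm_post_sub, post_sub_postStar]
  by_cases h : v - w = 0
  · simp [h]
  · rw [inner_smul_left]
    simp only [dir, h, if_false, inner_smul_right, conj_trivial]
    rw [real_inner_comm, ← mul_assoc, mul_inv_cancel₀ (norm_ne_zero_iff.2 h), one_mul]

lemma kernel_post (B : ℝ → ℝ → ℝ) (v w : V) (σ : S2) :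
    kernel B (post v w σ - postStar v w σ) (dir (v - w) σ) = kernel B (v - w) σ := by
  rw [kernel_eq, kernel_eq, cs_post, norm_post_sub]

/-- Polar coordinates in the velocity space. -/
lemma measurePreserving_polar :
    MeasurePreserving (fun x : Ioi (0 : ℝ) × S2 => (x.1 : ℝ) • (x.2 : V))
      ((Measure.volumeIoiPow 2).prod dσ) volume := by
  have h1 := (volume : Measure V).measurePreserving_homeomorphUnitSphereProd
  have hd : Module.finrank ℝ V - 1 = 2 := by simp
  rw [hd] at h1
  have h2 := (MeasurePreserving.symm (homeomorphUnitSphereProd V).toMeasurableEquiv h1)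
  have h3 : MeasurePreserving (Subtype.val : ({0}ᶜ : Set V) → V) (Measure.comap Subtype.val volume)
      (volume : Measure V) := by
    refine ⟨measurable_subtype_coe, ?_⟩
    rw [(MeasurableEmbedding.subtype_coe (measurableSet_singleton _).compl).map_comap,
      Subtype.range_coe, restrict_compl_singleton]
  exact (h3.comp h2).comp Measure.measurePreserving_swap

/-- A composition of two shears, up to exchanging factors: translate `c` by `z / 2` to get `v`, then
reflect `z` to `v - z`. -/
lemma measurePreserving_pair :
    MeasurePreserving (fun x : V × V => (x.1 + (2⁻¹ : ℝ) • x.2, x.1 - (2⁻¹ : ℝ) • x.2))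
      ((volume : Measure V).prod volume) ((volume : Measure V).prod volume) := by
  have h1 : MeasurePreserving (fun x : V × V => (x.1, x.2 + (2⁻¹ : ℝ) • x.1))
      ((volume : Measure V).prod volume) ((volume : Measure V).prod volume) :=
    (MeasurePreserving.id _).skew_product (g := fun z c : V => c + (2⁻¹ : ℝ) • z) (by fun_prop)
      (Eventually.of_forall fun z => (measurePreserving_add_right volume ((2⁻¹ : ℝ) • z)).map_eq)
  have h2 : MeasurePreserving (fun x : V × V => (x.1, x.1 - x.2))
      ((volume : Measure V).prod volume) ((volume : Measure V).prod volume) :=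
    (MeasurePreserving.id _).skew_product (g := fun v z : V => v - z) (by fun_prop)
      (Eventually.of_forall fun v => (Measure.measurePreserving_sub_left volume v).map_eq)
  have h3 := h2.comp ((Measure.measurePreserving_swap.comp h1).comp
    (Measure.measurePreserving_swap (μ := (volume : Measure V)) (ν := (volume : Measure V))))
  convert h3 using 1
  funext x
  simp only [Function.comp, Prod.swap, Prod.mk.injEq, true_and]
  module

/-- Centre of mass and polar coordinates on the space of collisions. -/
def collParam (x : V × Ioi (0 : ℝ) × S2 × S2) : V × V × S2 :=
  (x.1 + (2⁻¹ : ℝ) • (x.2.1 : ℝ) • (x.2.2.1 : V), x.1 - (2⁻¹ : ℝ) • (x.2.1 : ℝ) • (x.2.2.1 : V),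
    x.2.2.2)

/-- The product measure in centre of mass and polar coordinates. -/
def collParamMeasure : Measure (V × Ioi (0 : ℝ) × S2 × S2) :=
  (volume : Measure V).prod ((Measure.volumeIoiPow 2).prod (dσ.prod dσ))

lemma measurePreserving_collParam :
    MeasurePreserving collParam collParamMeasure collMeasure := by
  have h1 : MeasurePreserving
      (fun x : Ioi (0 : ℝ) × S2 × S2 => ((x.1 : ℝ) • (x.2.1 : V), x.2.2))
      ((Measure.volumeIoiPow 2).prod (dσ.prod dσ)) ((volume : Measure V).prod dσ) :=
    (measurePreserving_polar.prod (MeasurePreserving.id dσ)).comp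
      (MeasurePreserving.symm MeasurableEquiv.prodAssoc
        (measurePreserving_prodAssoc (Measure.volumeIoiPow 2) dσ dσ))
  have h2 := (MeasurePreserving.id (volume : Measure V)).prod h1
  have h3 := (measurePreserving_prodAssoc (volume : Measure V) (volume : Measure V) dσ).comp
    ((measurePreserving_pair.prod (MeasurePreserving.id dσ)).comp
      (MeasurePreserving.symm MeasurableEquiv.prodAssoc
        (measurePreserving_prodAssoc (volume : Measure V) (volume : Measure V) dσ)))
  exact h3.comp h2

lemma collMap_collParam (x : V × Ioi (0 : ℝ) × S2 × S2) :
    collMap (collParam x) = collParam (x.1, x.2.1, x.2.2.2, x.2.2.1) := by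
  obtain ⟨c, ⟨r, hr⟩, ω, σ⟩ := x
  have hr : 0 < r := hr
  unfold collParam collMap
  simp only
  have e1 : c + (2⁻¹ : ℝ) • r • (ω : V) - (c - (2⁻¹ : ℝ) • r • (ω : V)) = r • (ω : V) := by module
  have e2 : ‖r • (ω : V)‖ = r := by
    rw [norm_smul, norm_sphere, mul_one, Real.norm_eq_abs, abs_of_pos hr]
  rw [post, postStar, e1, e2, dir_smul hr]
  congr 1
  · module
  · congr 1; module

/-- In centre of mass and polar coordinates a collision merely exchanges the direction of `v - v_*`
with `σ`, which preserves the product measure. -/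
lemma measurePreserving_collMap : MeasurePreserving collMap collMeasure collMeasure := by
  have h1 : MeasurePreserving
      (fun x : V × Ioi (0 : ℝ) × S2 × S2 => (x.1, x.2.1, x.2.2.2, x.2.2.1))
      collParamMeasure collParamMeasure :=
    (MeasurePreserving.id _).prod ((MeasurePreserving.id _).prod Measure.measurePreserving_swap)
  refine ⟨measurable_collMap, ?_⟩
  have h2 := (measurePreserving_collParam.comp h1).map_eq
  rw [show collParam ∘ (fun x : V × Ioi (0 : ℝ) × S2 × S2 => (x.1, x.2.1, x.2.2.2, x.2.2.1)) =
    collMap ∘ collParam from funext fun x => (collMap_collParam x).symm,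
    ← Measure.map_map measurable_collMap measurePreserving_collParam.measurable,
    measurePreserving_collParam.map_eq] at h2
  exact h2

/-- The collision map as a measurable involution. -/
def collEquiv : V × V × S2 ≃ᵐ V × V × S2 where
  toFun := collMap
  invFun := collMap
  left_inv := collMap_collMap
  right_inv := collMap_collMap
  measurable_toFun := measurable_collMap
  measurable_invFun := measurable_collMap

lemma lintegral_collMap (F : V × V × S2 → ℝ≥0∞) :
    ∫⁻ x, F (collMap x) ∂collMeasure = ∫⁻ x, F x ∂collMeasure :=
  measurePreserving_collMap.lintegral_comp_emb collEquiv.measurableEmbedding F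

lemma integral_collMap (F : V × V × S2 → ℝ) :
    ∫ x, F (collMap x) ∂collMeasure = ∫ x, F x ∂collMeasure :=
  measurePreserving_collMap.integral_comp collEquiv.measurableEmbedding F

lemma quasiMeasurePreserving_pre :
    Measure.QuasiMeasurePreserving (fun x : V × V × S2 => x.1) collMeasure volume :=
  Measure.quasiMeasurePreserving_fst

lemma quasiMeasurePreserving_preStar :
    Measure.QuasiMeasurePreserving (fun x : V × V × S2 => x.2.1) collMeasure volume :=
  Measure.quasiMeasurePreserving_fst.comp Measure.quasiMeasurePreserving_snd

lemma quasiMeasurePreserving_post :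
    Measure.QuasiMeasurePreserving (fun x : V × V × S2 => post x.1 x.2.1 x.2.2)
      collMeasure volume :=
  quasiMeasurePreserving_pre.comp measurePreserving_collMap.quasiMeasurePreserving

lemma quasiMeasurePreserving_postStar :
    Measure.QuasiMeasurePreserving (fun x : V × V × S2 => postStar x.1 x.2.1 x.2.2)
      collMeasure volume :=
  quasiMeasurePreserving_preStar.comp measurePreserving_collMap.quasiMeasurePreserving

/-! ### Zonal integrals on the sphere -/

lemma norm_eq_sqrt_coords (y : V) : ‖y‖ = Real.sqrt (y 0 ^ 2 + (y 1 ^ 2 + y 2 ^ 2)) := by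
  rw [EuclideanSpace.norm_eq, Fin.sum_univ_three]
  simp [add_assoc]

/-- An integral over `ℝ³` in Cartesian coordinates. -/
lemma lintegral_coords (F : ℝ → ℝ → ℝ≥0∞) (hF : Measurable (Function.uncurry F)) :
    ∫⁻ y : V, F (y 0) (Real.sqrt (y 1 ^ 2 + y 2 ^ 2)) =
      ∫⁻ a : ℝ, ∫⁻ b : ℝ × ℝ, F a (Real.sqrt (b.1 ^ 2 + b.2 ^ 2)) := by
  have h1 : MeasurePreserving (fun y : V => (y 0, (y 1, y 2))) volume
      ((volume : Measure ℝ).prod (volume : Measure (ℝ × ℝ))) := by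
    have e1 := PiLp.volume_preserving_ofLp (Fin 3)
    have e2 := volume_preserving_piFinSuccAbove (fun _ : Fin 3 => ℝ) 0
    have e3 := (MeasurePreserving.id (volume : Measure ℝ)).prod (volume_preserving_finTwoArrow ℝ)
    exact e3.comp (e2.comp e1)
  have hG : Measurable fun q : ℝ × ℝ × ℝ => F q.1 (Real.sqrt (q.2.1 ^ 2 + q.2.2 ^ 2)) :=
    hF.comp (by fun_prop : Measurable fun q : ℝ × ℝ × ℝ => (q.1, Real.sqrt (q.2.1 ^ 2 + q.2.2 ^ 2)))
  rw [← lintegral_prod (fun q : ℝ × ℝ × ℝ => F q.1 (Real.sqrt (q.2.1 ^ 2 + q.2.2 ^ 2)))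
    hG.aemeasurable, ← h1.lintegral_comp hG]

/-- Radial integrals in the plane. -/
lemma lintegral_radial (g : ℝ → ℝ≥0∞) (hg : Measurable g) :
    ∫⁻ b : ℝ × ℝ, g (Real.sqrt (b.1 ^ 2 + b.2 ^ 2)) =
      ENNReal.ofReal (2 * Real.pi) * ∫⁻ r in Ioi (0 : ℝ), ENNReal.ofReal r * g r := by
  rw [← lintegral_comp_polarCoord_symm, polarCoord_target, Measure.volume_eq_prod,
    ← Measure.prod_restrict]
  have hm : Measurable fun r : ℝ => ENNReal.ofReal r * g r := by fun_prop
  have h : ∀ q ∈ Ioi (0 : ℝ) ×ˢ Ioo (-Real.pi) Real.pi, ENNReal.ofReal q.1 •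
      g (Real.sqrt ((polarCoord.symm q).1 ^ 2 + (polarCoord.symm q).2 ^ 2)) =
      (ENNReal.ofReal q.1 * g q.1) * 1 := by
    rintro ⟨r, θ⟩ ⟨hr, -⟩
    have hr : 0 < r := hr
    simp only [polarCoord_symm_apply, smul_eq_mul, mul_one]
    congr 2
    rw [mul_pow, mul_pow, ← mul_add, Real.cos_sq_add_sin_sq, mul_one, Real.sqrt_sq hr.le]
  rw [Measure.prod_restrict, setLIntegral_congr_fun (measurableSet_Ioi.prod measurableSet_Ioo) h,
    ← Measure.prod_restrict, lintegral_prod_mul hm.aemeasurable aemeasurable_const]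
  rw [lintegral_one, Measure.restrict_apply_univ, Real.volume_Ioo, mul_comm]
  congr 2; ring

/-- Polar coordinates in a half plane, the second coordinate being the distance to an axis. -/
lemma lintegral_half_plane (h : ℝ → ℝ≥0∞) (hh : Measurable h) :
    ∫⁻ a : ℝ, ∫⁻ r in Ioi (0 : ℝ), ENNReal.ofReal r *
        (h (a / Real.sqrt (a ^ 2 + r ^ 2)) * (Iio (1 : ℝ)).indicator 1 (Real.sqrt (a ^ 2 + r ^ 2)))
      = (∫⁻ R in Ioi (0 : ℝ), ENNReal.ofReal (R ^ 2) * (Iio (1 : ℝ)).indicator 1 R) *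
        ∫⁻ θ in Ioo 0 Real.pi, h (Real.cos θ) * ENNReal.ofReal (Real.sin θ) := by
  have hind : Measurable ((Iio (1 : ℝ)).indicator (1 : ℝ → ℝ≥0∞)) :=
    measurable_one.indicator measurableSet_Iio
  -- `ENNReal.ofReal r` vanishes for `r ≤ 0`, so the half plane can be replaced by the plane and
  -- polar coordinates used there.
  have e1 : ∀ a : ℝ, ∫⁻ r in Ioi (0 : ℝ), ENNReal.ofReal r *
        (h (a / Real.sqrt (a ^ 2 + r ^ 2)) * (Iio (1 : ℝ)).indicator 1 (Real.sqrt (a ^ 2 + r ^ 2)))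
      = ∫⁻ r, ENNReal.ofReal r *
        (h (a / Real.sqrt (a ^ 2 + r ^ 2)) *
          (Iio (1 : ℝ)).indicator 1 (Real.sqrt (a ^ 2 + r ^ 2))) := by
    intro a
    rw [← lintegral_indicator measurableSet_Ioi]
    refine lintegral_congr fun r => ?_
    by_cases hr : 0 < r
    · rw [indicator_of_mem (mem_Ioi.2 hr)]
    · rw [indicator_of_notMem (by simpa using hr), ENNReal.ofReal_of_nonpos (not_lt.1 hr), zero_mul]
  simp_rw [e1]
  rw [← lintegral_prod (fun q : ℝ × ℝ => ENNReal.ofReal q.2 *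
        (h (q.1 / Real.sqrt (q.1 ^ 2 + q.2 ^ 2)) *
          (Iio (1 : ℝ)).indicator 1 (Real.sqrt (q.1 ^ 2 + q.2 ^ 2)))) (by
    refine Measurable.aemeasurable ?_
    refine Measurable.mul (by fun_prop) (Measurable.mul ?_ ?_)
    · exact hh.comp (by fun_prop)
    · exact hind.comp (by fun_prop)),
    ← Measure.volume_eq_prod, ← lintegral_comp_polarCoord_symm, polarCoord_target,
    Measure.volume_eq_prod]
  have hq : ∀ q ∈ Ioi (0 : ℝ) ×ˢ Ioo (-Real.pi) Real.pi, ENNReal.ofReal q.1 •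
      (ENNReal.ofReal (polarCoord.symm q).2 *
        (h ((polarCoord.symm q).1 / Real.sqrt ((polarCoord.symm q).1 ^ 2 +
          (polarCoord.symm q).2 ^ 2)) *
          (Iio (1 : ℝ)).indicator 1 (Real.sqrt ((polarCoord.symm q).1 ^ 2 +
            (polarCoord.symm q).2 ^ 2)))) =
      (ENNReal.ofReal (q.1 ^ 2) * (Iio (1 : ℝ)).indicator 1 q.1) *
        (h (Real.cos q.2) * ENNReal.ofReal (Real.sin q.2)) := by
    rintro ⟨r, θ⟩ ⟨hr, -⟩
    have hr : 0 < r := hr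
    simp only [polarCoord_symm_apply, smul_eq_mul]
    have hs : Real.sqrt ((r * Real.cos θ) ^ 2 + (r * Real.sin θ) ^ 2) = r := by
      rw [mul_pow, mul_pow, ← mul_add, Real.cos_sq_add_sin_sq, mul_one, Real.sqrt_sq hr.le]
    rw [hs, mul_div_cancel_left₀ _ hr.ne', ENNReal.ofReal_mul hr.le, sq, ENNReal.ofReal_mul hr.le]
    ring
  rw [setLIntegral_congr_fun (measurableSet_Ioi.prod measurableSet_Ioo) hq,
    ← Measure.prod_restrict, lintegral_prod_mul
      (f := fun R : ℝ => ENNReal.ofReal (R ^ 2) * (Iio (1 : ℝ)).indicator 1 R)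
      (g := fun θ : ℝ => h (Real.cos θ) * ENNReal.ofReal (Real.sin θ))]
  · congr 1
    rw [← lintegral_indicator measurableSet_Ioo, ← lintegral_indicator measurableSet_Ioo]
    refine lintegral_congr fun θ => ?_
    by_cases h0 : θ ∈ Ioo 0 Real.pi
    · rw [indicator_of_mem h0, indicator_of_mem
        (show θ ∈ Ioo (-Real.pi) Real.pi from ⟨by linarith [h0.1, Real.pi_pos], h0.2⟩)]
    · rw [indicator_of_notMem h0]
      by_cases h1 : θ ∈ Ioo (-Real.pi) Real.pi
      · rw [indicator_of_mem h1, ENNReal.ofReal_of_nonpos, mul_zero]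
        refine Real.sin_nonpos_of_nonpos_of_neg_pi_le ?_ h1.1.le
        by_contra h2
        exact h0 ⟨not_le.1 h2, h1.2⟩
      · rw [indicator_of_notMem h1]
  · exact (Measurable.mul (by fun_prop) hind).aemeasurable
  · exact (Measurable.mul (hh.comp Real.measurable_cos) (by fun_prop)).aemeasurable

/-- Archimedes' hat-box theorem, for functions of the angle with the first coordinate axis. -/
lemma lintegral_cone (h : ℝ → ℝ≥0∞) (hh : Measurable h) :
    ∫⁻ y : V, h (y 0 / ‖y‖) * (Iio (1 : ℝ)).indicator 1 ‖y‖ =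
      ENNReal.ofReal (2 * Real.pi) *
      ((∫⁻ R in Ioi (0 : ℝ), ENNReal.ofReal (R ^ 2) * (Iio (1 : ℝ)).indicator 1 R) *
        ∫⁻ θ in Ioo 0 Real.pi, h (Real.cos θ) * ENNReal.ofReal (Real.sin θ)) := by
  have hind : Measurable ((Iio (1 : ℝ)).indicator (1 : ℝ → ℝ≥0∞)) :=
    measurable_one.indicator measurableSet_Iio
  set F : ℝ → ℝ → ℝ≥0∞ := fun a r => h (a / Real.sqrt (a ^ 2 + r ^ 2)) *
    (Iio (1 : ℝ)).indicator 1 (Real.sqrt (a ^ 2 + r ^ 2)) with hFdef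
  have hF : Measurable (Function.uncurry F) := by
    refine Measurable.mul ?_ ?_
    · exact hh.comp (by fun_prop : Measurable fun q : ℝ × ℝ => q.1 / Real.sqrt (q.1 ^ 2 + q.2 ^ 2))
    · exact hind.comp (by fun_prop : Measurable fun q : ℝ × ℝ => Real.sqrt (q.1 ^ 2 + q.2 ^ 2))
  have e1 : ∀ y : V, h (y 0 / ‖y‖) * (Iio (1 : ℝ)).indicator 1 ‖y‖ =
      F (y 0) (Real.sqrt (y 1 ^ 2 + y 2 ^ 2)) := by
    intro y
    simp only [hFdef]
    rw [Real.sq_sqrt (by positivity), norm_eq_sqrt_coords]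
  simp_rw [e1]
  rw [lintegral_coords F hF]
  have e2 : ∀ a, ∫⁻ b : ℝ × ℝ, F a (Real.sqrt (b.1 ^ 2 + b.2 ^ 2)) =
      ENNReal.ofReal (2 * Real.pi) * ∫⁻ r in Ioi (0 : ℝ), ENNReal.ofReal r * F a r := fun a =>
    lintegral_radial (F a) (hF.comp measurable_prodMk_left)
  simp_rw [e2]
  rw [lintegral_const_mul', lintegral_half_plane h hh]
  exact ENNReal.ofReal_ne_top

/-- The same integral over the unit ball as in `lintegral_cone`, now in spherical coordinates.
Comparing the two gives the formula on the sphere once the common radial factor is cancelled. -/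
lemma lintegral_cone_eq_sphere (ω : S2) (h : ℝ → ℝ≥0∞) (hh : Measurable h) :
    ∫⁻ y : V, h (⟪(ω : V), y⟫ / ‖y‖) * (Iio (1 : ℝ)).indicator 1 ‖y‖ =
      (∫⁻ r : Ioi (0 : ℝ), (Iio (1 : ℝ)).indicator 1 (r : ℝ) ∂(Measure.volumeIoiPow 2)) *
        ∫⁻ σ : S2, h ⟪(ω : V), (σ : V)⟫ ∂dσ := by
  have hind : Measurable ((Iio (1 : ℝ)).indicator (1 : ℝ → ℝ≥0∞)) :=
    measurable_one.indicator measurableSet_Iio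
  rw [← measurePreserving_polar.lintegral_comp (by
    refine Measurable.mul (hh.comp (by fun_prop)) (hind.comp (by fun_prop))),
    ← lintegral_prod_mul]
  · refine lintegral_congr fun x => ?_
    have hr : 0 < (x.1 : ℝ) := x.1.2
    rw [inner_smul_right, norm_smul, norm_sphere, mul_one, Real.norm_eq_abs, abs_of_pos hr,
      mul_div_cancel_left₀ _ hr.ne', mul_comm]
  · exact (hind.comp measurable_subtype_coe).aemeasurable
  · exact (hh.comp (by fun_prop)).aemeasurable

/-- Archimedes' hat-box theorem. -/
theorem lintegral_zonal (ω : S2) (h : ℝ → ℝ≥0∞) (hh : Measurable h) :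
    ∫⁻ σ : S2, h ⟪(ω : V), (σ : V)⟫ ∂dσ =
      ENNReal.ofReal (2 * Real.pi) *
        ∫⁻ θ in Ioo 0 Real.pi, h (Real.cos θ) * ENNReal.ofReal (Real.sin θ) := by
  have hind : Measurable ((Iio (1 : ℝ)).indicator (1 : ℝ → ℝ≥0∞)) :=
    measurable_one.indicator measurableSet_Iio
  have hK : ∫⁻ r : Ioi (0 : ℝ), (Iio (1 : ℝ)).indicator 1 (r : ℝ) ∂(Measure.volumeIoiPow 2) =
      ENNReal.ofReal (1 / 3) := by
    have h1 : ∫⁻ r : Ioi (0 : ℝ), (Iio (1 : ℝ)).indicator 1 (r : ℝ) ∂(Measure.volumeIoiPow 2) =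
        Measure.volumeIoiPow 2 (Iio ⟨1, mem_Ioi.2 one_pos⟩) := by
      rw [← lintegral_indicator_one measurableSet_Iio]
      rfl
    rw [h1, Measure.volumeIoiPow_apply_Iio]
    norm_num
  have hK2 : ∫⁻ r : Ioi (0 : ℝ), (Iio (1 : ℝ)).indicator 1 (r : ℝ) ∂(Measure.volumeIoiPow 2) =
      ∫⁻ R in Ioi (0 : ℝ), ENNReal.ofReal (R ^ 2) * (Iio (1 : ℝ)).indicator 1 R := by
    rw [Measure.volumeIoiPow, lintegral_withDensity_eq_lintegral_mul _
      (by fun_prop : Measurable fun r : Ioi (0 : ℝ) => ENNReal.ofReal ((r : ℝ) ^ 2))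
      (g := fun r : Ioi (0 : ℝ) => (Iio (1 : ℝ)).indicator 1 (r : ℝ)) (hind.comp measurable_subtype_coe)]
    exact lintegral_subtype_comap measurableSet_Ioi
      (fun R : ℝ => ENNReal.ofReal (R ^ 2) * (Iio (1 : ℝ)).indicator 1 R)
  -- An orthonormal basis starting with `ω` rotates the axis `ω` to the first coordinate axis.
  obtain ⟨b, hb⟩ := Orthonormal.exists_orthonormalBasis_extension_of_card_eq (𝕜 := ℝ) (E := V)
    (ι := Fin 3) (by simp) (v := fun _ => (ω : V)) (s := {0}) (by
      constructor
      · simp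
      · intro i j hij; exact absurd (Subsingleton.elim i j) hij)
  have hb0 : b 0 = ω := hb 0 rfl
  have h3 := lintegral_cone_eq_sphere ω h hh
  have hrep : MeasurePreserving b.repr (volume : Measure V) (volume : Measure V) :=
    b.measurePreserving_repr
  have h4 : ∫⁻ y : V, h (⟪(ω : V), y⟫ / ‖y‖) * (Iio (1 : ℝ)).indicator 1 ‖y‖ =
      ∫⁻ y : V, h (y 0 / ‖y‖) * (Iio (1 : ℝ)).indicator 1 ‖y‖ := by
    rw [← hrep.lintegral_comp (f := fun y : V => h (y 0 / ‖y‖) * (Iio (1 : ℝ)).indicator 1 ‖y‖) (by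
      refine Measurable.mul (hh.comp (by fun_prop)) (hind.comp (by fun_prop)))]
    refine lintegral_congr fun y => ?_
    rw [b.repr_apply_apply, hb0, LinearIsometryEquiv.norm_map]
  rw [h4, lintegral_cone h hh, ← hK2, hK, mul_left_comm] at h3
  exact ((ENNReal.mul_right_inj (by simp) ENNReal.ofReal_ne_top).1 h3).symm

lemma lintegral_cs {v w : V} (hvw : v ≠ w) (h : ℝ → ℝ≥0∞) (hh : Measurable h) :
    ∫⁻ σ : S2, h (cs v w σ) ∂dσ =
      ENNReal.ofReal (2 * Real.pi) *
        ∫⁻ θ in Ioo 0 Real.pi, h (Real.cos θ) * ENNReal.ofReal (Real.sin θ) := by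
  have hz : v - w ≠ 0 := sub_ne_zero.2 hvw
  have hω : ‖(‖v - w‖⁻¹ • (v - w) : V)‖ = 1 := by
    rw [norm_smul, norm_inv, norm_norm, inv_mul_cancel₀ (norm_ne_zero_iff.2 hz)]
  rw [← lintegral_zonal ⟨‖v - w‖⁻¹ • (v - w), by simpa using hω⟩ h hh]
  refine lintegral_congr fun σ => ?_
  rw [cs, inner_smul_left, conj_trivial, inv_mul_eq_div]

/-! ### Change of variables `v_* ↦ v'` -/

/-- Let `a` be the difference of the norms and `e` the vector on the right. If `e` were small
compared with `a`, then `z₁ = z₂ + a σ + e` would force `z₂ + a σ` to have norm close to `‖z₂‖ + a`.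
This is impossible when `z₂` and `σ` make an angle of at least `π / 3`. -/
lemma norm_sub_le_of_deviation {z₁ z₂ : V} (σ : S2)
    (h2 : ⟪z₂, (σ : V)⟫ ≤ ‖z₂‖ / 2) (h12 : ‖z₁‖ ≤ 2 * ‖z₂‖) (h21 : ‖z₂‖ ≤ ‖z₁‖) :
    ‖z₁ - z₂‖ ≤ 5 * ‖z₁ - z₂ - (‖z₁‖ - ‖z₂‖) • (σ : V)‖ := by
  set a := ‖z₁‖ - ‖z₂‖ with ha
  have ha0 : 0 ≤ a := sub_nonneg.2 h21
  set e := z₁ - z₂ - a • (σ : V) with he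
  have e1 : z₁ - z₂ = e + a • (σ : V) := by rw [he]; abel
  have e2 : z₁ = (z₂ + a • (σ : V)) + e := by rw [he]; abel
  have haσ : ‖a • (σ : V)‖ = a := by
    rw [norm_smul, norm_sphere, mul_one, Real.norm_eq_abs, abs_of_nonneg ha0]
  have h3 : ‖z₁ - z₂‖ ≤ ‖e‖ + a := by
    rw [e1]; exact (norm_add_le _ _).trans_eq (by rw [haσ])
  suffices a ≤ 4 * ‖e‖ by linarith
  have he0 := norm_nonneg e
  have hz2 := norm_nonneg z₂
  rcases le_total ‖z₁‖ ‖e‖ with h | h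
  · linarith
  have h4 : ‖z₁‖ ≤ ‖z₂ + a • (σ : V)‖ + ‖e‖ := by
    nth_rw 1 [e2]; exact norm_add_le _ _
  have h5 : ‖z₂ + a • (σ : V)‖ ^ 2 ≤ ‖z₂‖ ^ 2 + a * ‖z₂‖ + a ^ 2 := by
    rw [norm_add_sq_real, inner_smul_right, haσ]
    nlinarith
  have h6 : (‖z₁‖ - ‖e‖) ^ 2 ≤ ‖z₂ + a • (σ : V)‖ ^ 2 :=
    pow_le_pow_left₀ (by linarith) (by linarith) 2
  have hz1 : ‖z₁‖ = ‖z₂‖ + a := by rw [ha]; ring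
  rcases hz2.eq_or_lt with h0 | h0
  · rw [← h0] at h12 h21 hz1; linarith
  · by_contra h7
    push Not at h7
    rw [hz1] at h6 h12 h
    nlinarith

/-- `post v w σ` equals `v` minus half of `(v - w) - ‖v - w‖ σ`; the half turns the constant `5`
into `10`. -/
lemma dist_le_dist_post {v w₁ w₂ : V} (σ : S2) (h1 : ⟪v - w₁, (σ : V)⟫ ≤ ‖v - w₁‖ / 2)
    (h2 : ⟪v - w₂, (σ : V)⟫ ≤ ‖v - w₂‖ / 2) (h12 : ‖v - w₁‖ ≤ 2 * ‖v - w₂‖)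
    (h21 : ‖v - w₂‖ ≤ 2 * ‖v - w₁‖) :
    dist w₁ w₂ ≤ 10 * dist (post v w₁ σ) (post v w₂ σ) := by
  wlog h : ‖v - w₂‖ ≤ ‖v - w₁‖ generalizing w₁ w₂
  · rw [dist_comm, dist_comm (post v w₁ σ)]
    exact this h2 h1 h21 h12 (le_of_not_ge h)
  have h3 := norm_sub_le_of_deviation σ h2 h12 h
  have e1 : v - w₁ - (v - w₂) = w₂ - w₁ := by abel
  have e2 : post v w₁ σ - post v w₂ σ =
      -((2⁻¹ : ℝ) • (v - w₁ - (v - w₂) - (‖v - w₁‖ - ‖v - w₂‖) • (σ : V))) := by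
    unfold post; module
  rw [dist_comm, dist_eq_norm, dist_eq_norm, e2, norm_neg, norm_smul]
  rw [e1] at h3 ⊢
  norm_num
  linarith

/-- A map that does not contract distances by more than `K` does not contract volumes by more
than `K ^ 3`. -/
lemma volume_inter_preimage_le {T : V → V} {A : Set V} {K : ℝ≥0}
    (h : ∀ x ∈ A, ∀ y ∈ A, dist x y ≤ K * dist (T x) (T y)) (S : Set V) :
    volume (A ∩ T ⁻¹' S) ≤ (K : ℝ≥0∞) ^ 3 * volume S := by
  have hinj : InjOn T A := fun x hx y hy hxy => by
    have := h x hx y hy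
    rw [hxy, dist_self, mul_zero] at this
    exact dist_le_zero.1 this
  set g := Function.invFunOn T A
  have hg : LipschitzOnWith K g (T '' A) := by
    refine LipschitzOnWith.of_dist_le_mul ?_
    rintro _ ⟨x, hx, rfl⟩ _ ⟨y, hy, rfl⟩
    rw [show g (T x) = x from hinj.leftInvOn_invFunOn hx,
      show g (T y) = y from hinj.leftInvOn_invFunOn hy]
    exact h x hx y hy
  have hsub : A ∩ T ⁻¹' S ⊆ g '' (T '' A ∩ S) := fun x hx =>
    ⟨T x, ⟨mem_image_of_mem T hx.1, hx.2⟩, hinj.leftInvOn_invFunOn hx.1⟩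
  have hd : (Module.finrank ℝ V : ℝ) = 3 := by simp
  -- Hausdorff measure of dimension `3` is a Haar measure, hence proportional to volume, and scales
  -- by `K ^ 3` under the Lipschitz inverse of `T`.
  have hH : Measure.IsAddHaarMeasure (Measure.hausdorffMeasure 3 : Measure V) := by
    have := isAddHaarMeasure_hausdorffMeasure (E := V)
    rwa [hd] at this
  have hvol := Measure.isAddLeftInvariant_eq_smul (volume : Measure V) (Measure.hausdorffMeasure 3)
  rw [hvol]
  rw [Measure.smul_apply, Measure.smul_apply, ENNReal.smul_def, ENNReal.smul_def, smul_eq_mul,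
    smul_eq_mul, mul_left_comm]
  gcongr
  refine (measure_mono hsub).trans ?_
  have h1 := (hg.mono (inter_subset_left (t := S))).hausdorffMeasure_image_le
    (d := 3) (by norm_num)
  refine h1.trans ?_
  rw [show ((3 : ℝ)) = ((3 : ℕ) : ℝ) by norm_num, ENNReal.rpow_natCast]
  gcongr
  exact inter_subset_right

lemma lintegral_comp_le {T : V → V} (hT : Measurable T) {A : Set V} {K : ℝ≥0}
    (h : ∀ x ∈ A, ∀ y ∈ A, dist x y ≤ K * dist (T x) (T y)) {u : V → ℝ≥0∞} (hu : Measurable u) :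
    ∫⁻ x in A, u (T x) ≤ (K : ℝ≥0∞) ^ 3 * ∫⁻ x, u x := by
  rw [← lintegral_map hu hT, ← smul_eq_mul, ← lintegral_smul_measure]
  refine lintegral_mono' ?_ le_rfl
  refine Measure.le_iff.2 fun S hS => ?_
  rw [Measure.map_apply hT hS, Measure.restrict_apply (hT hS), inter_comm]
  exact volume_inter_preimage_le h S

/-! ### Collisions of a fast particle with a slow one -/

section fast

variable {R : ℝ} {v w : V} {σ : S2}

/-- Here `1024 = 32 ^ 2`. -/
lemma mul_norm_le_of_fast (hv : 1024 * (1 + R ^ 2) ≤ en v) (hw : ‖w‖ ≤ R) :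
    ‖v‖ * ‖w‖ ≤ en v / 32 := by
  have h1 : (‖v‖ * ‖w‖) ^ 2 ≤ (en v / 32) ^ 2 := by
    have h2 : ‖w‖ ^ 2 ≤ R ^ 2 := by gcongr
    have h3 : ‖v‖ ^ 2 ≤ en v := by unfold en; linarith
    rw [mul_pow]
    calc ‖v‖ ^ 2 * ‖w‖ ^ 2 ≤ en v * (en v / 1024) := by
          gcongr
          · exact (en_pos v).le
          · linarith
      _ = _ := by ring
  exact abs_le_of_sq_le_sq' h1 (by linarith [en_pos v]) |>.2

lemma en_le_of_fast (hv : 1024 * (1 + R ^ 2) ≤ en v) (hw : ‖w‖ ≤ R) :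
    en w ≤ en v / 1024 := by
  have : ‖w‖ ^ 2 ≤ R ^ 2 := by gcongr
  unfold en at *; linarith

lemma norm_sub_sq_of_fast (hv : 1024 * (1 + R ^ 2) ≤ en v) (hw : ‖w‖ ≤ R) :
    en v / 2 ≤ ‖v - w‖ ^ 2 ∧ ‖v - w‖ ^ 2 ≤ 2 * en v := by
  have h1 := mul_norm_le_of_fast hv hw
  have h2 := en_le_of_fast hv hw
  have h3 := abs_le.1 (abs_real_inner_le_norm v w)
  have h4 : 1024 ≤ en v := by nlinarith [sq_nonneg R]
  rw [norm_sub_sq_real]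
  have h5 : ‖v‖ ^ 2 = en v - 1 := by unfold en; ring
  have h6 : ‖w‖ ^ 2 = en w - 1 := by unfold en; ring
  have h7 := one_le_en w
  constructor <;> nlinarith

lemma not_near_of_fast (hv : 1024 * (1 + R ^ 2) ≤ en v) (hw : ‖w‖ ≤ R) :
    ¬ Near v w := by
  have h1 := (norm_sub_sq_of_fast hv hw).1
  have h2 := en_le_of_fast hv hw
  have h3 := en_pos v
  unfold Near avg
  linarith

lemma one_le_norm_sub_of_fast (hv : 1024 * (1 + R ^ 2) ≤ en v) (hw : ‖w‖ ≤ R) :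
    1 ≤ ‖v - w‖ := by
  have h1 := (norm_sub_sq_of_fast hv hw).1
  have h4 : 1024 ≤ en v := by nlinarith [sq_nonneg R]
  nlinarith [norm_nonneg (v - w)]

lemma norm_sub_le_two_mul_of_fast {w₁ w₂ : V} (hv : 1024 * (1 + R ^ 2) ≤ en v)
    (h1 : ‖w₁‖ ≤ R) (h2 : ‖w₂‖ ≤ R) : ‖v - w₁‖ ≤ 2 * ‖v - w₂‖ := by
  have e1 := (norm_sub_sq_of_fast hv h1).2
  have e2 := (norm_sub_sq_of_fast hv h2).1
  refine abs_le_of_sq_le_sq' (by rw [mul_pow]; linarith) (by positivity) |>.2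

/-- `9 / 32` is `1/2 · 1/2` from the longitudinal part plus `1 / 32` from the transverse part. -/
lemma abs_transfer_of_fast (hv : 1024 * (1 + R ^ 2) ≤ en v) (hw : ‖w‖ ≤ R)
    (hσ : |cs v w σ| ≤ 1 / 2) :
    |‖v - w‖ * ⟪mid v w, (σ : V)⟫| ≤ en v * (9 / 32) := by
  obtain ⟨k, hk, hk1, -⟩ := exists_transfer v w σ
  have h1 := mul_norm_le_of_fast hv hw
  have h2 := en_le_of_fast hv hw
  have h3 := one_le_en w
  have h4 : |k| ≤ en v / 32 :=
    (hk1.trans (mul_le_of_le_one_left (by positivity) (sn_le_one _))).trans h1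
  have h5 : |⟪mid v w, v - w⟫| ≤ en v / 2 := by
    rw [inner_mid_sub, abs_le]; constructor <;> linarith
  rw [hk]
  refine (abs_add_le _ _).trans ?_
  rw [abs_mul]
  nlinarith [abs_nonneg (cs v w σ), abs_nonneg ⟪mid v w, v - w⟫]

/-- The mean energy lies between `1/2` and `1/2 + 1/2048` of `en v`, and the transfer is at most
`9/32` of it; the fractions `1/8` and `51/64` leave some room. -/
lemma en_post_of_fast (hv : 1024 * (1 + R ^ 2) ≤ en v) (hw : ‖w‖ ≤ R)
    (hσ : |cs v w σ| ≤ 1 / 2) :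
    en v / 8 ≤ en (post v w σ) ∧ en v / 8 ≤ en (postStar v w σ) ∧
      en (post v w σ) ≤ en v * (51 / 64) ∧ en (postStar v w σ) ≤ en v * (51 / 64) := by
  have h1 := abs_le.1 (abs_transfer_of_fast hv hw hσ)
  have h2 := en_le_of_fast hv hw
  have h3 := one_le_en w
  have h4 := one_le_en v
  rw [en_post, en_postStar]
  unfold avg
  refine ⟨?_, ?_, ?_, ?_⟩ <;> linarith

/-- The weight `⟨v⟩ ^ (2 p)`. -/
def pwt (p : ℝ) (v : V) : ℝ := en v ^ p

/-- The outgoing particles share the total energy and neither takes more than `51/64` of `en v`.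
Since `p - 1 ≥ 1`, the sum of their `p`-th powers is at most `51/64 · en v ^ (p - 1)` times the
total energy, and `1 - 51/64 · (1 + 1/1024)` exceeds `1/16`. -/
lemma delta_pwt_of_fast {p : ℝ} (hp : 2 ≤ p) (hv : 1024 * (1 + R ^ 2) ≤ en v)
    (hw : ‖w‖ ≤ R) (hσ : |cs v w σ| ≤ 1 / 2) :
    en v ^ p / 16 ≤ -Δ (pwt p) v w σ := by
  obtain ⟨-, -, h1, h2⟩ := en_post_of_fast hv hw hσ
  have h3 := en_le_of_fast hv hw
  have hx := en_pos v
  have hy := en_pos w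
  have key : ∀ u : V, en u ≤ en v * (51 / 64) →
      en u ^ p ≤ 51 / 64 * en v ^ (p - 1) * en u := by
    intro u hu
    have hu0 := en_pos u
    have e1 : en u ^ p = en u ^ (p - 1) * en u := by
      nth_rw 3 [← Real.rpow_one (en u)]
      rw [← Real.rpow_add hu0]; congr 1; ring
    rw [e1]
    gcongr
    calc en u ^ (p - 1) ≤ (en v * (51 / 64)) ^ (p - 1) :=
          Real.rpow_le_rpow hu0.le hu (by linarith)
      _ = en v ^ (p - 1) * (51 / 64) ^ (p - 1) := Real.mul_rpow hx.le (by norm_num)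
      _ ≤ en v ^ (p - 1) * (51 / 64) ^ (1 : ℝ) := by
          gcongr ?_ * ?_
          exact Real.rpow_le_rpow_of_exponent_ge (by norm_num) (by norm_num) (by linarith)
      _ = _ := by rw [Real.rpow_one]; ring
  have k1 := key _ h1
  have k2 := key _ h2
  have hsum := en_post_add v w σ
  have hw0 : 0 ≤ en w ^ p := Real.rpow_nonneg hy.le _
  have hvp : en v ^ p = en v ^ (p - 1) * en v := by
    nth_rw 3 [← Real.rpow_one (en v)]
    rw [← Real.rpow_add hx]; congr 1; ring
  have hq : 0 < en v ^ (p - 1) := Real.rpow_pos_of_pos hx _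
  have h5 : en v ^ (p - 1) * en w ≤ en v ^ (p - 1) * (en v / 1024) := by gcongr
  have h6 : 51 / 64 * en v ^ (p - 1) * en (post v w σ) +
      51 / 64 * en v ^ (p - 1) * en (postStar v w σ) =
      51 / 64 * (en v ^ (p - 1) * en v) + 51 / 64 * (en v ^ (p - 1) * en w) := by
    rw [← mul_add, hsum]; ring
  unfold Δ pwt
  rw [hvp] at *
  nlinarith [mul_pos hq hx]

end fast

/-! ### Weighted integrals -/

/-- The integral of `g` with weight `θ (1 + |v|²)`. -/
def wint (θ : ℝ → ℝ) (g : V → ℝ) : ℝ≥0∞ := ∫⁻ v, ENNReal.ofReal (g v * θ (en v))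

lemma measurable_en : Measurable en := by unfold en; fun_prop

lemma measurable_cs : Measurable fun x : V × V × S2 => cs x.1 x.2.1 x.2.2 := by
  unfold cs; fun_prop

lemma measurable_sn : Measurable sn := by unfold sn; fun_prop

lemma measurable_avg : Measurable fun x : V × V × S2 => avg x.1 x.2.1 := by
  have := measurable_en
  unfold avg; fun_prop

lemma measurable_kernel {B : ℝ → ℝ → ℝ} (hB : Measurable (Function.uncurry B)) :
    Measurable fun x : V × V × S2 => kernel B (x.1 - x.2.1) x.2.2 := by
  have : Measurable fun x : V × V × S2 => (‖x.1 - x.2.1‖, cs x.1 x.2.1 x.2.2) :=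
    (by fun_prop : Measurable fun x : V × V × S2 => ‖x.1 - x.2.1‖).prodMk measurable_cs
  exact hB.comp this

lemma lintegral_coll {F : V × V × S2 → ℝ≥0∞} (hF : AEMeasurable F collMeasure) :
    ∫⁻ x, F x ∂collMeasure = ∫⁻ v, ∫⁻ w, ∫⁻ σ, F (v, w, σ) ∂dσ := by
  unfold collMeasure at *
  rw [lintegral_prod _ hF]
  refine lintegral_congr_ae ?_
  filter_upwards [hF.aestronglyMeasurable.prodMk_left] with v hv
  exact lintegral_prod _ hv.aemeasurable

lemma measurable_slice (v : V) : Measurable fun q : V × S2 => ((v, q.1, q.2) : V × V × S2) := by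
  fun_prop

/-- Collisions of pairs that are not close to each other relative to their energy. -/
def farSet : Set (V × V × S2) := {x | ¬ Near x.1 x.2.1}

lemma measurableSet_farSet : MeasurableSet farSet := by
  have h1 : Measurable fun x : V × V × S2 => 4 * ‖x.1 - x.2.1‖ ^ 2 := by fun_prop
  exact (measurableSet_le h1 measurable_avg).compl

/-- The loss factor `f f_* (1 - f') (1 - f_*')`. -/
def lossFactor (g : V → ℝ) (v w : V) (σ : S2) : ℝ :=
  g v * g w * ((1 - g (post v w σ)) * (1 - g (postStar v w σ)))

/-- The decrease of `ψ` in collisions of distant pairs. -/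
def lossInt (B : ℝ → ℝ → ℝ) (g ψ : V → ℝ) : ℝ≥0∞ :=
  ∫⁻ x in farSet, ENNReal.ofReal
    (kernel B (x.1 - x.2.1) x.2.2 * lossFactor g x.1 x.2.1 x.2.2 * -Δ ψ x.1 x.2.1 x.2.2)
    ∂collMeasure

/-! ### Lower bound for the loss term -/

/-- The lower angular function, cut off and restricted to deviations between `π/3` and `2π/3`. -/
def angLow (bLow : ℝ → ℝ) (c : ℝ) : ℝ≥0∞ :=
  {c : ℝ | |c| ≤ 1 / 2}.indicator (fun c => ENNReal.ofReal (min (bLow c) 1)) c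

lemma measurable_angLow {bLow : ℝ → ℝ} (hb : Measurable bLow) : Measurable (angLow bLow) := by
  refine Measurable.indicator (by fun_prop) ?_
  exact measurableSet_le (by fun_prop) measurable_const

lemma angLow_le (bLow : ℝ → ℝ) (c : ℝ) :
    angLow bLow c ≤ {c : ℝ | |c| ≤ 1 / 2}.indicator (fun _ => 1) c := by
  refine indicator_le_indicator' fun _ => ?_
  rw [← ENNReal.ofReal_one]
  exact ENNReal.ofReal_le_ofReal (min_le_right _ _)

/-- The total angular mass of `angLow`. -/
def angMass (bLow : ℝ → ℝ) : ℝ≥0∞ :=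
  ENNReal.ofReal (2 * Real.pi) *
    ∫⁻ θ in Ioo 0 Real.pi, angLow bLow (Real.cos θ) * ENNReal.ofReal (Real.sin θ)

lemma angMass_ne_top (bLow : ℝ → ℝ) : angMass bLow ≠ ∞ := by
  refine ENNReal.mul_ne_top ENNReal.ofReal_ne_top (ne_of_lt ?_)
  calc ∫⁻ θ in Ioo 0 Real.pi, angLow bLow (Real.cos θ) * ENNReal.ofReal (Real.sin θ)
      ≤ ∫⁻ θ in Ioo 0 Real.pi, 1 := by
        refine lintegral_mono fun θ => ?_
        refine mul_le_one' ((angLow_le _ _).trans (indicator_le_self' (by simp) _)) ?_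
        exact ENNReal.ofReal_le_one.2 (Real.sin_le_one θ)
    _ < ∞ := by simp

lemma angMass_pos {bLow : ℝ → ℝ} (hb : Measurable bLow)
    (hpos : ∀ c ∈ Ioo (-1 : ℝ) 1, 0 < bLow c) : 0 < angMass bLow := by
  refine ENNReal.mul_pos (by simp [Real.pi_pos]) ?_
  have hm : Measurable fun θ => angLow bLow (Real.cos θ) * ENNReal.ofReal (Real.sin θ) :=
    ((measurable_angLow hb).comp Real.measurable_cos).mul (by fun_prop)
  have hsub : Ioo (Real.pi / 3) (Real.pi - Real.pi / 3) ⊆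
      Function.support (fun θ => angLow bLow (Real.cos θ) * ENNReal.ofReal (Real.sin θ))
        ∩ Ioo 0 Real.pi := by
    intro θ hθ
    have hπ := Real.pi_pos
    have h0 : θ ∈ Ioo 0 Real.pi := ⟨by linarith [hθ.1], by linarith [hθ.2]⟩
    have h1 : Real.cos θ < 1 / 2 := by
      rw [← Real.cos_pi_div_three]
      exact Real.cos_lt_cos_of_nonneg_of_le_pi (by linarith) h0.2.le hθ.1
    have h2 : -(1 / 2) < Real.cos θ := by
      rw [← Real.cos_pi_div_three, ← Real.cos_pi_sub]
      exact Real.cos_lt_cos_of_nonneg_of_le_pi h0.1.le (by linarith) hθ.2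
    refine ⟨?_, h0⟩
    rw [Function.mem_support]
    refine (ENNReal.mul_pos ?_ ?_).ne'
    · unfold angLow
      rw [indicator_of_mem (show Real.cos θ ∈ {c : ℝ | |c| ≤ 1 / 2} from
        abs_le.2 ⟨h2.le, h1.le⟩)]
      exact (ENNReal.ofReal_pos.2 (lt_min (hpos _ ⟨by linarith, by linarith⟩) one_pos)).ne'
    · exact (ENNReal.ofReal_pos.2 (Real.sin_pos_of_mem_Ioo h0)).ne'
  refine ((setLIntegral_pos_iff hm).2 (lt_of_lt_of_le ?_ (measure_mono hsub))).ne'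
  rw [Real.volume_Ioo, ENNReal.ofReal_pos]
  linarith [Real.pi_pos]

lemma lintegral_angLow {bLow : ℝ → ℝ} (hb : Measurable bLow) {v w : V} (h : v ≠ w) :
    ∫⁻ σ, angLow bLow (cs v w σ) ∂dσ = angMass bLow :=
  lintegral_cs h _ (measurable_angLow hb)

/-! ### Pauli blocking in collisions with slow particles. -/

section slow

variable {g : V → ℝ} {R : ℝ} {v : V}

lemma inner_le_of_abs_cs {w : V} {σ : S2} (h : |cs v w σ| ≤ 1 / 2) :
    ⟪v - w, (σ : V)⟫ ≤ ‖v - w‖ / 2 ∧ ⟪v - w, ((-σ : S2) : V)⟫ ≤ ‖v - w‖ / 2 := by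
  rcases eq_or_ne (v - w) 0 with hz | hz
  · simp [hz]
  have hr := norm_pos_iff.2 hz
  have h1 : ⟪v - w, (σ : V)⟫ = cs v w σ * ‖v - w‖ := (div_mul_cancel₀ _ hr.ne').symm
  have h2 := abs_le.1 h
  rw [show ((-σ : S2) : V) = -(σ : V) from rfl, inner_neg_right, h1]
  constructor <;> nlinarith

lemma postStar_eq_post_neg (v w : V) (σ : S2) : postStar v w σ = post v w (-σ) := by
  rw [post_eq, postStar_eq, show ((-σ : S2) : V) = -(σ : V) from rfl, smul_neg, sub_eq_add_neg]

/-- The outgoing energy is at least `en v / 8`, so the mass is at most `8 / en v` times the energy;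
the change of variables costs `10 ^ 3`. -/
lemma lintegral_outgoing_le {T : V → V} (hT : Measurable T) (hg : Measurable g)
    (hg0 : ∀ u, 0 ≤ g u) {A : Set V} (hA : MeasurableSet A)
    (h1 : ∀ w₁ ∈ A, ∀ w₂ ∈ A, dist w₁ w₂ ≤ 10 * dist (T w₁) (T w₂))
    (h2 : ∀ w ∈ A, en v / 8 ≤ en (T w)) :
    ∫⁻ w in A, ENNReal.ofReal (g (T w)) ≤ ENNReal.ofReal (8000 / en v) * wint id g := by
  have hv := en_pos v
  have hu : Measurable fun u => ENNReal.ofReal (g u * id (en u)) := by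
    have := measurable_en
    fun_prop
  calc ∫⁻ w in A, ENNReal.ofReal (g (T w))
      ≤ ∫⁻ w in A, ENNReal.ofReal (8 / en v) * ENNReal.ofReal (g (T w) * id (en (T w))) := by
        refine setLIntegral_mono' hA fun w hw => ?_
        rw [← ENNReal.ofReal_mul (by positivity)]
        refine ENNReal.ofReal_le_ofReal ?_
        have h3 : 1 ≤ 8 / en v * en (T w) := by
          have := h2 w hw
          rw [div_mul_eq_mul_div, le_div_iff₀ hv]; linarith
        calc g (T w) = g (T w) * 1 := (mul_one _).symm
          _ ≤ g (T w) * (8 / en v * en (T w)) := by gcongr; exact hg0 _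
          _ = _ := by simp only [id]; ring
    _ = ENNReal.ofReal (8 / en v) * ∫⁻ w in A, ENNReal.ofReal (g (T w) * id (en (T w))) :=
        lintegral_const_mul _ (hu.comp hT)
    _ ≤ ENNReal.ofReal (8 / en v) * (((10 : ℝ≥0) : ℝ≥0∞) ^ 3 * wint id g) := by
        gcongr
        exact lintegral_comp_le hT (K := 10) (by simpa using h1) hu
    _ = _ := by
        rw [← mul_assoc, ← ENNReal.ofReal_coe_nnreal, ← ENNReal.ofReal_pow (by positivity),
          ← ENNReal.ofReal_mul (by positivity)]
        congr 2
        push_cast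
        ring

/-- The part of the outgoing mass in collisions of `v` with slow particles. -/
lemma lintegral_outgoing_post_le (hg : Measurable g) (hg0 : ∀ u, 0 ≤ g u)
    (hv : 1024 * (1 + R ^ 2) ≤ en v) :
    ∫⁻ w in Metric.closedBall 0 R, ∫⁻ σ, {c : ℝ | |c| ≤ 1 / 2}.indicator (fun _ => 1) (cs v w σ) *
      (ENNReal.ofReal (g (post v w σ)) + ENNReal.ofReal (g (postStar v w σ))) ∂dσ ≤
    2 * (dσ univ * (ENNReal.ofReal (8000 / en v) * wint id g)) := by
  have hcs : Measurable fun q : V × S2 => cs v q.1 q.2 :=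
    (measurable_cs.comp (measurable_slice v) :)
  have hp : Measurable fun q : V × S2 => post v q.1 q.2 :=
    (measurable_post.comp (measurable_slice v) :)
  have hp' : Measurable fun q : V × S2 => postStar v q.1 q.2 :=
    (measurable_postStar.comp (measurable_slice v) :)
  have hset : MeasurableSet {c : ℝ | |c| ≤ 1 / 2} :=
    measurableSet_le (by fun_prop) measurable_const
  have hind : Measurable ({c : ℝ | |c| ≤ 1 / 2}.indicator (fun _ => (1 : ℝ≥0∞))) :=
    measurable_const.indicator hset
  rw [lintegral_lintegral_swap]
  · have hσ : ∀ σ : S2, ∫⁻ w in Metric.closedBall 0 R,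
        {c : ℝ | |c| ≤ 1 / 2}.indicator (fun _ => 1) (cs v w σ) *
        (ENNReal.ofReal (g (post v w σ)) + ENNReal.ofReal (g (postStar v w σ))) ≤
        2 * (ENNReal.ofReal (8000 / en v) * wint id g) := by
      intro σ
      have hm : Measurable fun w : V => (w, σ) := by fun_prop
      set A : Set V := Metric.closedBall 0 R ∩ {w | |cs v w σ| ≤ 1 / 2} with hA
      have hAm' : MeasurableSet {w | |cs v w σ| ≤ 1 / 2} := (hcs.comp hm) hset
      have hAm : MeasurableSet A := Metric.isClosed_closedBall.measurableSet.inter hAm'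
      have hAn : ∀ w ∈ A, ‖w‖ ≤ R := fun w hw => by simpa using hw.1
      have e1 : ∫⁻ w in Metric.closedBall 0 R,
          {c : ℝ | |c| ≤ 1 / 2}.indicator (fun _ => 1) (cs v w σ) *
          (ENNReal.ofReal (g (post v w σ)) + ENNReal.ofReal (g (postStar v w σ))) =
          ∫⁻ w in A, (ENNReal.ofReal (g (post v w σ)) + ENNReal.ofReal (g (postStar v w σ))) := by
        rw [hA, inter_comm, ← Measure.restrict_restrict hAm', ← lintegral_indicator hAm']
        refine lintegral_congr fun w => ?_
        by_cases h : |cs v w σ| ≤ 1 / 2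
        · rw [indicator_of_mem (show cs v w σ ∈ {c : ℝ | |c| ≤ 1 / 2} from h),
            indicator_of_mem (show w ∈ {w | |cs v w σ| ≤ 1 / 2} from h), one_mul]
        · rw [indicator_of_notMem (show cs v w σ ∉ {c : ℝ | |c| ≤ 1 / 2} from h),
            indicator_of_notMem (show w ∉ {w | |cs v w σ| ≤ 1 / 2} from h), zero_mul]
      rw [e1, lintegral_add_left (by
        exact (hg.comp (hp.comp hm)).ennreal_ofReal), two_mul]
      refine add_le_add ?_ ?_
      · refine lintegral_outgoing_le (hp.comp hm) hg hg0 hAm (fun w₁ h₁ w₂ h₂ => ?_) fun w hw =>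
          (en_post_of_fast hv (hAn w hw) hw.2).1
        exact dist_le_dist_post σ (inner_le_of_abs_cs h₁.2).1 (inner_le_of_abs_cs h₂.2).1
          (norm_sub_le_two_mul_of_fast hv (hAn _ h₁) (hAn _ h₂))
          (norm_sub_le_two_mul_of_fast hv (hAn _ h₂) (hAn _ h₁))
      · refine lintegral_outgoing_le (hp'.comp hm) hg hg0 hAm (fun w₁ h₁ w₂ h₂ => ?_) fun w hw =>
          (en_post_of_fast hv (hAn w hw) hw.2).2.1
        simp only [Function.comp, postStar_eq_post_neg]
        exact dist_le_dist_post (-σ) (inner_le_of_abs_cs h₁.2).2 (inner_le_of_abs_cs h₂.2).2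
          (norm_sub_le_two_mul_of_fast hv (hAn _ h₁) (hAn _ h₂))
          (norm_sub_le_two_mul_of_fast hv (hAn _ h₂) (hAn _ h₁))
    refine (lintegral_mono hσ).trans_eq ?_
    rw [lintegral_const]
    ring
  · refine Measurable.aemeasurable ?_
    exact (hind.comp hcs).mul ((hg.comp hp).ennreal_ofReal.add (hg.comp hp').ennreal_ofReal)

/-- Chebyshev's inequality: the energy leaves at most half of the mass outside the ball. -/
lemma lintegral_slow_ge {m₀ M₂ : ℝ} (hg0 : ∀ u, 0 ≤ g u)
    (hm₀ : ENNReal.ofReal m₀ ≤ ∫⁻ u, ENNReal.ofReal (g u)) (hm₀' : 0 ≤ m₀)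
    (hM₂ : wint id g ≤ ENNReal.ofReal M₂) (hR0 : 0 ≤ R)
    (hR : M₂ / (1 + R ^ 2) ≤ m₀ / 2) :
    ENNReal.ofReal (m₀ / 2) ≤ ∫⁻ w in Metric.closedBall 0 R, ENNReal.ofReal (g w) := by
  have hR1 : 0 < 1 + R ^ 2 := by positivity
  have hB : MeasurableSet (Metric.closedBall (0 : V) R) := Metric.isClosed_closedBall.measurableSet
  have h1 : ∫⁻ u in (Metric.closedBall 0 R)ᶜ, ENNReal.ofReal (g u) ≤ ENNReal.ofReal (m₀ / 2) := by
    calc ∫⁻ u in (Metric.closedBall 0 R)ᶜ, ENNReal.ofReal (g u)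
        ≤ ∫⁻ u in (Metric.closedBall 0 R)ᶜ,
          ENNReal.ofReal (1 / (1 + R ^ 2)) * ENNReal.ofReal (g u * id (en u)) := by
          refine setLIntegral_mono' hB.compl fun u hu => ?_
          rw [← ENNReal.ofReal_mul (by positivity)]
          refine ENNReal.ofReal_le_ofReal ?_
          have h2 : R < ‖u‖ := by simpa using hu
          have h3 : 1 + R ^ 2 ≤ en u := by unfold en; gcongr
          have h4 : 1 ≤ 1 / (1 + R ^ 2) * en u := by
            rw [div_mul_eq_mul_div, le_div_iff₀ hR1, one_mul, one_mul]
            exact h3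
          calc g u = g u * 1 := (mul_one _).symm
            _ ≤ g u * (1 / (1 + R ^ 2) * en u) := by gcongr; exact hg0 _
            _ = _ := by simp only [id]; ring
      _ ≤ ∫⁻ u, ENNReal.ofReal (1 / (1 + R ^ 2)) * ENNReal.ofReal (g u * id (en u)) :=
          setLIntegral_le_lintegral _ _
      _ = ENNReal.ofReal (1 / (1 + R ^ 2)) * wint id g := lintegral_const_mul' _ _ (by simp)
      _ ≤ ENNReal.ofReal (1 / (1 + R ^ 2)) * ENNReal.ofReal M₂ := by gcongr
      _ = ENNReal.ofReal (M₂ / (1 + R ^ 2)) := by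
          rw [← ENNReal.ofReal_mul (by positivity)]; congr 1; ring
      _ ≤ _ := ENNReal.ofReal_le_ofReal hR
  rw [← lintegral_add_compl _ hB] at hm₀
  have h5 : ENNReal.ofReal m₀ = ENNReal.ofReal (m₀ / 2) + ENNReal.ofReal (m₀ / 2) := by
    rw [← ENNReal.ofReal_add (by positivity) (by positivity)]; congr 1; ring
  rw [h5] at hm₀
  exact (ENNReal.add_le_add_iff_right ENNReal.ofReal_ne_top).1
    (hm₀.trans (add_le_add_right h1 _))

end slow

/-- The angular and slow-particle part of the loss term. -/
def slowLoss (bLow : ℝ → ℝ) (g : V → ℝ) (R : ℝ) (v : V) : ℝ≥0∞ :=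
  ∫⁻ w in Metric.closedBall 0 R, ∫⁻ σ, angLow bLow (cs v w σ) *
    ENNReal.ofReal (g w * ((1 - g (post v w σ)) * (1 - g (postStar v w σ)))) ∂dσ

/-- For values in `[0, 1]`, `g_* (1 - g') (1 - g'_*) ≥ g_* - g' - g'_*`. Integrated over slow
particles and moderate angles, `g_*` contributes at least `angMass * m₀ / 2`, while the outgoing
terms are of order `1 / en v` and remove at most half of that. -/
lemma slowLoss_ge {bLow : ℝ → ℝ} (hb : Measurable bLow) {g : V → ℝ} (hg : Measurable g)
    (hg01 : ∀ u, g u ∈ Icc (0 : ℝ) 1) {m₀ M₂ R : ℝ} (hm₀' : 0 ≤ m₀) (hM₂' : 0 ≤ M₂)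
    (hm₀ : ENNReal.ofReal m₀ ≤ ∫⁻ u, ENNReal.ofReal (g u))
    (hM₂ : wint id g ≤ ENNReal.ofReal M₂) (hR0 : 0 ≤ R) (hR : M₂ / (1 + R ^ 2) ≤ m₀ / 2)
    {v : V} (hv : 1024 * (1 + R ^ 2) ≤ en v)
    (hv' : 16000 * (dσ univ).toReal * M₂ / en v ≤ (angMass bLow).toReal * m₀ / 4) :
    ENNReal.ofReal ((angMass bLow).toReal * m₀ / 4) ≤ slowLoss bLow g R v := by
  have hcs : Measurable fun q : V × S2 => cs v q.1 q.2 := (measurable_cs.comp (measurable_slice v) :)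
  have hp : Measurable fun q : V × S2 => post v q.1 q.2 :=
    (measurable_post.comp (measurable_slice v) :)
  have hp' : Measurable fun q : V × S2 => postStar v q.1 q.2 :=
    (measurable_postStar.comp (measurable_slice v) :)
  have hang : Measurable fun q : V × S2 => angLow bLow (cs v q.1 q.2) :=
    ((measurable_angLow hb).comp hcs :)
  have hh : Measurable fun q : V × S2 =>
      ENNReal.ofReal (g q.1 * ((1 - g (post v q.1 q.2)) * (1 - g (postStar v q.1 q.2)))) := by
    have e1 : Measurable fun q : V × S2 => g (post v q.1 q.2) := hg.comp hp
    have e2 : Measurable fun q : V × S2 => g (postStar v q.1 q.2) := hg.comp hp'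
    fun_prop
  have hB : MeasurableSet (Metric.closedBall (0 : V) R) := Metric.isClosed_closedBall.measurableSet
  have h1 := lintegral_slow_ge (fun u => (hg01 u).1) hm₀ hm₀' hM₂ hR0 hR
  have h2 := lintegral_outgoing_post_le hg (fun u => (hg01 u).1) hv
  set b₀ := (angMass bLow).toReal with hb₀
  have hb₀' : angMass bLow = ENNReal.ofReal b₀ := (ENNReal.ofReal_toReal (angMass_ne_top _)).symm
  have hb₀0 : 0 ≤ b₀ := ENNReal.toReal_nonneg
  have hne : ∀ w ∈ Metric.closedBall (0 : V) R, v ≠ w := by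
    rintro w hw rfl
    have h3 := one_le_norm_sub_of_fast hv (by simpa using hw)
    rw [sub_self, norm_zero] at h3
    linarith
  have h3 : angMass bLow * ∫⁻ w in Metric.closedBall 0 R, ENNReal.ofReal (g w) =
      ∫⁻ w in Metric.closedBall 0 R, ∫⁻ σ, angLow bLow (cs v w σ) * ENNReal.ofReal (g w) ∂dσ := by
    rw [← lintegral_const_mul _ hg.ennreal_ofReal]
    refine setLIntegral_congr_fun hB fun w hw => ?_
    rw [lintegral_mul_const' _ _ ENNReal.ofReal_ne_top, lintegral_angLow hb (hne w hw)]
  have h4 : angMass bLow * ∫⁻ w in Metric.closedBall 0 R, ENNReal.ofReal (g w) ≤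
      slowLoss bLow g R v + ∫⁻ w in Metric.closedBall 0 R, ∫⁻ σ,
      {c : ℝ | |c| ≤ 1 / 2}.indicator (fun _ => 1) (cs v w σ) *
      (ENNReal.ofReal (g (post v w σ)) + ENNReal.ofReal (g (postStar v w σ))) ∂dσ := by
    rw [h3, slowLoss, ← lintegral_add_left]
    · refine lintegral_mono fun w => ?_
      rw [← lintegral_add_left]
      · refine lintegral_mono fun σ => ?_
        have e1 := angLow_le bLow (cs v w σ)
        have e2 : ENNReal.ofReal (g w) ≤
            ENNReal.ofReal (g w * ((1 - g (post v w σ)) * (1 - g (postStar v w σ)))) +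
            (ENNReal.ofReal (g (post v w σ)) + ENNReal.ofReal (g (postStar v w σ))) := by
          obtain ⟨a0, a1⟩ := hg01 (post v w σ)
          obtain ⟨b0, b1⟩ := hg01 (postStar v w σ)
          obtain ⟨c0, c1⟩ := hg01 w
          have : 0 ≤ g w * ((1 - g (post v w σ)) * (1 - g (postStar v w σ))) :=
            mul_nonneg c0 (mul_nonneg (by linarith) (by linarith))
          rw [← ENNReal.ofReal_add a0 b0, ← ENNReal.ofReal_add this (by linarith)]
          refine ENNReal.ofReal_le_ofReal ?_
          nlinarith [mul_nonneg c0 (mul_nonneg a0 b0), mul_nonneg (sub_nonneg.2 c1) a0,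
            mul_nonneg (sub_nonneg.2 c1) b0]
        calc angLow bLow (cs v w σ) * ENNReal.ofReal (g w)
            ≤ angLow bLow (cs v w σ) * (_ + _) := mul_le_mul_right e2 _
          _ = _ := mul_add _ _ _
          _ ≤ _ := by gcongr
      · exact ((hang.mul hh).comp (by fun_prop : Measurable fun σ : S2 => (w, σ)) :)
    · exact (hang.mul hh).lintegral_prod_right'
  rw [hb₀'] at h4
  have h5 : ENNReal.ofReal (b₀ * m₀ / 4) + ENNReal.ofReal (b₀ * m₀ / 4) ≤
      slowLoss bLow g R v + ENNReal.ofReal (b₀ * m₀ / 4) := by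
    calc ENNReal.ofReal (b₀ * m₀ / 4) + ENNReal.ofReal (b₀ * m₀ / 4)
        = ENNReal.ofReal b₀ * ENNReal.ofReal (m₀ / 2) := by
          rw [← ENNReal.ofReal_add (by positivity) (by positivity), ← ENNReal.ofReal_mul hb₀0]
          congr 1; ring
      _ ≤ ENNReal.ofReal b₀ * ∫⁻ w in Metric.closedBall 0 R, ENNReal.ofReal (g w) := by gcongr
      _ ≤ _ := h4
      _ ≤ slowLoss bLow g R v + 2 * (dσ univ * (ENNReal.ofReal (8000 / en v) * wint id g)) := by
          gcongr
      _ ≤ slowLoss bLow g R v +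
          2 * (dσ univ * (ENNReal.ofReal (8000 / en v) * ENNReal.ofReal M₂)) := by gcongr
      _ ≤ _ := by
          gcongr
          have hx := en_pos v
          rw [← ENNReal.ofReal_toReal (measure_ne_top dσ univ),
            ← ENNReal.ofReal_mul (by positivity), ← ENNReal.ofReal_mul ENNReal.toReal_nonneg,
            two_mul, ← ENNReal.ofReal_add (by positivity) (by positivity)]
          refine ENNReal.ofReal_le_ofReal (le_trans (le_of_eq ?_) hv')
          ring
  exact (ENNReal.add_le_add_iff_right ENNReal.ofReal_ne_top).1 h5

/-- The factor `1/4 = 2 ^ (-2)` bounds `2 ^ (γ / 2)` from below because `γ ≥ -4`. -/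
lemma quarter_le_rpow_norm {γ : ℝ} (hγ : γ ∈ Ico (-4 : ℝ) 0) {R : ℝ} {v w : V}
    (hv : 1024 * (1 + R ^ 2) ≤ en v) (hw : ‖w‖ ≤ R) :
    en v ^ (γ / 2) / 4 ≤ ‖v - w‖ ^ γ := by
  have h1 := (norm_sub_sq_of_fast hv hw).2
  have h2 := one_le_norm_sub_of_fast hv hw
  have hx := en_pos v
  have e1 : ‖v - w‖ ^ γ = (‖v - w‖ ^ 2) ^ (γ / 2) := by
    rw [← Real.rpow_natCast, ← Real.rpow_mul (norm_nonneg _)]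
    congr 1; push_cast; ring
  have e2 : (2 * en v) ^ (γ / 2) ≤ (‖v - w‖ ^ 2) ^ (γ / 2) :=
    Real.rpow_le_rpow_of_nonpos (by positivity) h1 (by linarith [hγ.2])
  have e3 : (2 : ℝ) ^ (-2 : ℝ) ≤ 2 ^ (γ / 2) :=
    Real.rpow_le_rpow_of_exponent_le (by norm_num) (by linarith [hγ.1])
  rw [e1]
  refine le_trans ?_ e2
  rw [Real.mul_rpow (by norm_num) hx.le, div_eq_inv_mul]
  gcongr
  refine le_trans (le_of_eq ?_) e3
  rw [show (-2 : ℝ) = -(2 : ℕ) by norm_num, Real.rpow_neg (by norm_num), Real.rpow_natCast]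
  norm_num

/-- The loss term controls a moment, for Borel `g`. -/
lemma lossInt_ge_of_measurable {bLow : ℝ → ℝ} (hb : Measurable bLow)
    (hbpos : ∀ c ∈ Ioo (-1 : ℝ) 1, 0 < bLow c)
    {B : ℝ → ℝ → ℝ} {γ : ℝ} (hγ : γ ∈ Ico (-4 : ℝ) 0)
    (hB : ∀ r ≥ 1, ∀ c ∈ Ioo (-1 : ℝ) 1, r ^ γ * bLow c ≤ B r c)
    {g : V → ℝ} (hg : Measurable g)
    (hg01 : ∀ u, g u ∈ Icc (0 : ℝ) 1) {m₀ M₂ R X p : ℝ} (hp : 2 ≤ p)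
    (hm₀' : 0 ≤ m₀) (hM₂' : 0 ≤ M₂)
    (hm₀ : ENNReal.ofReal m₀ ≤ ∫⁻ u, ENNReal.ofReal (g u))
    (hM₂ : wint id g ≤ ENNReal.ofReal M₂) (hR0 : 0 ≤ R) (hR : M₂ / (1 + R ^ 2) ≤ m₀ / 2)
    (hX : 1024 * (1 + R ^ 2) ≤ X)
    (hX' : 16000 * (dσ univ).toReal * M₂ / X ≤ (angMass bLow).toReal * m₀ / 4) :
    ENNReal.ofReal ((angMass bLow).toReal * m₀ / 256) *
      ∫⁻ v in {v | X ≤ en v}, ENNReal.ofReal (g v * en v ^ (p + γ / 2)) ≤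
      lossInt B g (pwt p) := by
  have hS : MeasurableSet {v : V | X ≤ en v} := measurableSet_le measurable_const measurable_en
  have hBall : MeasurableSet (Metric.closedBall (0 : V) R) :=
    Metric.isClosed_closedBall.measurableSet
  have hXpos : 0 < X := by nlinarith [sq_nonneg R]
  have hgm : Measurable fun v => ENNReal.ofReal (g v * en v ^ (p + γ / 2)) := by
    have := measurable_en
    fun_prop
  have hang : Measurable fun x : V × V × S2 => angLow bLow (cs x.1 x.2.1 x.2.2) :=
    ((measurable_angLow hb).comp measurable_cs :)
  have hh : Measurable fun x : V × V × S2 => ENNReal.ofReal (g x.2.1 *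
      ((1 - g (post x.1 x.2.1 x.2.2)) * (1 - g (postStar x.1 x.2.1 x.2.2)))) := by
    have e1 : Measurable fun x : V × V × S2 => g (post x.1 x.2.1 x.2.2) := hg.comp measurable_post
    have e2 : Measurable fun x : V × V × S2 => g (postStar x.1 x.2.1 x.2.2) :=
      hg.comp measurable_postStar
    exact ((hg.comp (measurable_fst.comp measurable_snd)).mul
      ((measurable_const.sub e1).mul (measurable_const.sub e2))).ennreal_ofReal
  set S : Set (V × V × S2) := {x | X ≤ en x.1 ∧ x.2.1 ∈ Metric.closedBall (0 : V) R} with hSdef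
  have hSm : MeasurableSet S := by
    refine MeasurableSet.inter ?_ ?_
    · exact measurableSet_le measurable_const (measurable_en.comp measurable_fst)
    · exact (measurable_fst.comp measurable_snd) hBall
  have hSfar : S ⊆ farSet := fun x hx =>
    not_near_of_fast (hX.trans hx.1) (by simpa using hx.2)
  set G : V × V × S2 → ℝ≥0∞ := fun x =>
    ENNReal.ofReal (g x.1 * en x.1 ^ (p + γ / 2)) * (angLow bLow (cs x.1 x.2.1 x.2.2) *
      ENNReal.ofReal (g x.2.1 *
      ((1 - g (post x.1 x.2.1 x.2.2)) * (1 - g (postStar x.1 x.2.1 x.2.2))))) with hGdef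
  have hG : Measurable G := (hgm.comp measurable_fst).mul (hang.mul hh)
  -- `1/64` is `1/4` from the kernel times `1/16` from the decrease of the weight; with the `1/4` of
  -- `slowLoss_ge` it makes `256`.
  have hpt : ∀ x ∈ S, ENNReal.ofReal (1 / 64) * G x ≤ ENNReal.ofReal
      (kernel B (x.1 - x.2.1) x.2.2 * lossFactor g x.1 x.2.1 x.2.2 *
        -Δ (pwt p) x.1 x.2.1 x.2.2) := by
    rintro ⟨v, w, σ⟩ ⟨hv, hw⟩
    have hv : X ≤ en v := hv
    have hw : ‖w‖ ≤ R := by simpa using hw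
    have hv' := hX.trans hv
    simp only [hGdef]
    by_cases hc : |cs v w σ| ≤ 1 / 2
    swap
    · rw [angLow, indicator_of_notMem (show cs v w σ ∉ {c : ℝ | |c| ≤ 1 / 2} from hc)]
      simp
    have hc1 : cs v w σ ∈ Ioo (-1 : ℝ) 1 := by
      have := abs_le.1 hc; constructor <;> linarith
    rw [angLow, indicator_of_mem (show cs v w σ ∈ {c : ℝ | |c| ≤ 1 / 2} from hc)]
    have hx := en_pos v
    have hmin : 0 ≤ min (bLow (cs v w σ)) 1 := le_min (hbpos _ hc1).le zero_le_one
    obtain ⟨a0, a1⟩ := hg01 (post v w σ)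
    obtain ⟨b0, b1⟩ := hg01 (postStar v w σ)
    obtain ⟨c0, c1⟩ := hg01 w
    obtain ⟨d0, d1⟩ := hg01 v
    have hP : 0 ≤ (1 - g (post v w σ)) * (1 - g (postStar v w σ)) :=
      mul_nonneg (by linarith) (by linarith)
    have hxq : 0 ≤ en v ^ (p + γ / 2) := by positivity
    rw [← ENNReal.ofReal_mul hmin, ← ENNReal.ofReal_mul (mul_nonneg d0 hxq),
      ← ENNReal.ofReal_mul (by norm_num)]
    refine ENNReal.ofReal_le_ofReal ?_
    have hk : en v ^ (γ / 2) / 4 * min (bLow (cs v w σ)) 1 ≤ kernel B (v - w) σ := by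
      rw [kernel_eq]
      refine le_trans ?_ (hB _ (one_le_norm_sub_of_fast hv' hw) _ hc1)
      gcongr
      · exact quarter_le_rpow_norm hγ hv' hw
      · exact min_le_left _ _
    have hd := delta_pwt_of_fast hp hv' hw hc
    have hL : 0 ≤ lossFactor g v w σ := mul_nonneg (mul_nonneg d0 c0) hP
    calc 1 / 64 * (g v * en v ^ (p + γ / 2) * (min (bLow (cs v w σ)) 1 *
          (g w * ((1 - g (post v w σ)) * (1 - g (postStar v w σ))))))
        = en v ^ (γ / 2) / 4 * min (bLow (cs v w σ)) 1 * lossFactor g v w σ * (en v ^ p / 16) := by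
          rw [Real.rpow_add hx]; unfold lossFactor; ring
      _ ≤ kernel B (v - w) σ * lossFactor g v w σ * -Δ (pwt p) v w σ := by
          gcongr
          exact mul_nonneg ((mul_nonneg (by positivity) hmin).trans hk) hL
  have hslow : ∫⁻ x, S.indicator G x ∂collMeasure =
      ∫⁻ v in {v | X ≤ en v}, ENNReal.ofReal (g v * en v ^ (p + γ / 2)) * slowLoss bLow g R v := by
    rw [lintegral_coll (hG.indicator hSm).aemeasurable, ← lintegral_indicator hS]
    refine lintegral_congr fun v => ?_
    by_cases hv : X ≤ en v
    · rw [indicator_of_mem (show v ∈ {v | X ≤ en v} from hv), slowLoss,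
        ← lintegral_const_mul' _ _ ENNReal.ofReal_ne_top, ← lintegral_indicator hBall]
      refine lintegral_congr fun w => ?_
      by_cases hw : w ∈ Metric.closedBall (0 : V) R
      · rw [indicator_of_mem hw, ← lintegral_const_mul' _ _ ENNReal.ofReal_ne_top]
        refine lintegral_congr fun σ => ?_
        rw [indicator_of_mem (show (v, w, σ) ∈ S from ⟨hv, hw⟩)]
      · rw [indicator_of_notMem hw]
        refine (lintegral_congr fun σ => ?_).trans lintegral_zero
        rw [indicator_of_notMem (show (v, w, σ) ∉ S from fun h => hw h.2)]
    · rw [indicator_of_notMem (show v ∉ {v | X ≤ en v} from hv)]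
      refine (lintegral_congr fun w => ?_).trans lintegral_zero
      refine (lintegral_congr fun σ => ?_).trans lintegral_zero
      rw [indicator_of_notMem (show (v, w, σ) ∉ S from fun h => hv h.1)]
  calc ENNReal.ofReal ((angMass bLow).toReal * m₀ / 256) *
        ∫⁻ v in {v | X ≤ en v}, ENNReal.ofReal (g v * en v ^ (p + γ / 2))
      = ENNReal.ofReal (1 / 64) * ∫⁻ v in {v | X ≤ en v},
          ENNReal.ofReal (g v * en v ^ (p + γ / 2)) *
          ENNReal.ofReal ((angMass bLow).toReal * m₀ / 4) := by
        rw [lintegral_mul_const _ hgm, mul_comm (lintegral _ _), ← mul_assoc,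
          ← ENNReal.ofReal_mul (by norm_num)]
        congr 2; ring
    _ ≤ ENNReal.ofReal (1 / 64) * ∫⁻ v in {v | X ≤ en v},
          ENNReal.ofReal (g v * en v ^ (p + γ / 2)) * slowLoss bLow g R v := by
        refine mul_le_mul' le_rfl (setLIntegral_mono' hS fun v hv => ?_)
        have hv : X ≤ en v := hv
        gcongr
        refine slowLoss_ge hb hg hg01 hm₀' hM₂' hm₀ hM₂ hR0 hR (hX.trans hv) (le_trans ?_ hX')
        gcongr
    _ = ENNReal.ofReal (1 / 64) * ∫⁻ x, S.indicator G x ∂collMeasure := by rw [hslow]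
    _ = ∫⁻ x in S, ENNReal.ofReal (1 / 64) * G x ∂collMeasure := by
        rw [lintegral_indicator hSm, lintegral_const_mul' _ _ ENNReal.ofReal_ne_top]
    _ ≤ ∫⁻ x in S, ENNReal.ofReal (kernel B (x.1 - x.2.1) x.2.2 *
          lossFactor g x.1 x.2.1 x.2.2 * -Δ (pwt p) x.1 x.2.1 x.2.2) ∂collMeasure :=
        setLIntegral_mono' hSm hpt
    _ ≤ lossInt B g (pwt p) := lintegral_mono_set hSfar

/-- Clipping keeps the values in `[0, 1]` everywhere. A Borel version is needed because the change
of variables composes `g` with `post` at fixed `v` and `σ`. -/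
lemma exists_measurable_version {g : V → ℝ} (hg : AEMeasurable g) (hg01 : ∀ u, g u ∈ Icc (0 : ℝ) 1) :
    ∃ g' : V → ℝ, Measurable g' ∧ (∀ u, g' u ∈ Icc (0 : ℝ) 1) ∧ g =ᵐ[volume] g' := by
  refine ⟨fun u => max 0 (min 1 (hg.mk g u)),
    measurable_const.max (measurable_const.min hg.measurable_mk),
    fun u => ⟨le_max_left _ _, max_le zero_le_one (min_le_left _ _)⟩, ?_⟩
  filter_upwards [hg.ae_eq_mk] with u hu
  rw [← hu, min_eq_right (hg01 u).2, max_eq_right (hg01 u).1]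

lemma wint_congr {g g' : V → ℝ} (h : g =ᵐ[volume] g') (θ : ℝ → ℝ) : wint θ g = wint θ g' := by
  refine lintegral_congr_ae ?_
  filter_upwards [h] with u hu
  rw [hu]

/-- All four velocity maps on the space of collisions pull null sets back to null sets; for the
outgoing ones this is the invariance of the collision measure. -/
lemma lossInt_congr {g g' : V → ℝ} (h : g =ᵐ[volume] g') (B : ℝ → ℝ → ℝ) (ψ : V → ℝ) :
    lossInt B g ψ = lossInt B g' ψ := by
  refine lintegral_congr_ae (ae_restrict_of_ae ?_)
  filter_upwards [quasiMeasurePreserving_pre.ae h, quasiMeasurePreserving_preStar.ae h,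
    quasiMeasurePreserving_post.ae h, quasiMeasurePreserving_postStar.ae h] with x h1 h2 h3 h4
  rw [lossFactor, lossFactor, h1, h2, h3, h4]

/-- The loss term controls a moment, with constants depending only on the angular lower bound,
the mass and the energy. -/
theorem exists_lossInt_ge {bLow : ℝ → ℝ} (hb : Measurable bLow)
    (hbpos : ∀ c ∈ Ioo (-1 : ℝ) 1, 0 < bLow c) {m₀ M₂ : ℝ} (hm₀' : 0 < m₀) (hM₂' : 0 ≤ M₂) :
    ∃ c > 0, ∃ X > 0, ∀ (γ p : ℝ) (B : ℝ → ℝ → ℝ) (g : V → ℝ), γ ∈ Ico (-4 : ℝ) 0 → 2 ≤ p →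
      0 ≤ p + γ / 2 →
      (∀ r ≥ 1, ∀ c ∈ Ioo (-1 : ℝ) 1, r ^ γ * bLow c ≤ B r c) → AEMeasurable g →
      (∀ u, g u ∈ Icc (0 : ℝ) 1) → ∫⁻ u, ENNReal.ofReal (g u) = ENNReal.ofReal m₀ →
      wint id g ≤ ENNReal.ofReal M₂ →
      ENNReal.ofReal c * wint (fun x => x ^ (p + γ / 2)) g ≤
        lossInt B g (pwt p) + ENNReal.ofReal (c * X ^ (p + γ / 2) * m₀) := by
  set b := (angMass bLow).toReal
  have hbp : 0 < b := ENNReal.toReal_pos (angMass_pos hb hbpos).ne' (angMass_ne_top _)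
  set D := (dσ univ).toReal
  have hD : 0 ≤ D := ENNReal.toReal_nonneg
  -- Chosen so that `M₂ / (1 + R ^ 2) ≤ m₀ / 2`.
  set R := Real.sqrt (2 * M₂ / m₀) with hRdef
  have hR2 : R ^ 2 = 2 * M₂ / m₀ := Real.sq_sqrt (by positivity)
  -- The first term makes `v` fast relative to the ball of radius `R`; the second makes the outgoing
  -- mass at most half of the slow contribution, with `64000 = 4 · 16000`.
  set X := 1024 * (1 + R ^ 2) + 64000 * D * M₂ / (b * m₀) with hX
  have hX1 : 1024 * (1 + R ^ 2) ≤ X := le_add_of_nonneg_right (by positivity)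
  have hX0 : 0 < X := lt_of_lt_of_le (by positivity) hX1
  refine ⟨b * m₀ / 256, by positivity, X, hX0, fun γ p B g hγ hp hq hB hg hg01 hm₀ hM₂ => ?_⟩
  obtain ⟨g', hg', hg'01, hgg'⟩ := exists_measurable_version hg hg01
  have hm : ∫⁻ u, ENNReal.ofReal (g' u) = ∫⁻ u, ENNReal.ofReal (g u) := by
    refine lintegral_congr_ae ?_
    filter_upwards [hgg'] with u hu
    rw [hu]
  rw [wint_congr hgg'] at hM₂ ⊢
  rw [lossInt_congr hgg']
  rw [← hm] at hm₀
  have h1 := lossInt_ge_of_measurable hb hbpos hγ hB hg' hg'01 hp hm₀'.le hM₂' hm₀.ge hM₂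
    (Real.sqrt_nonneg _) (R := R) (by
      rw [hR2, div_le_iff₀ (by positivity)]
      have : m₀ / 2 * (1 + 2 * M₂ / m₀) = m₀ / 2 + M₂ := by field_simp
      linarith) hX1 (by
      rw [div_le_iff₀ hX0]
      have h2 : b * m₀ / 4 * (64000 * D * M₂ / (b * m₀)) = 16000 * D * M₂ := by
        field_simp; ring
      have h3 : 0 ≤ b * m₀ / 4 * (1024 * (1 + R ^ 2)) := by positivity
      change 16000 * D * M₂ ≤ b * m₀ / 4 * X
      rw [hX, mul_add]; linarith)
  have hS : MeasurableSet {v : V | X ≤ en v} := measurableSet_le measurable_const measurable_en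
  -- Below energy `X` the moment is bounded by the mass, which produces the additive constant.
  have h2 : ∫⁻ v in {v : V | X ≤ en v}ᶜ, ENNReal.ofReal (g' v * en v ^ (p + γ / 2)) ≤
      ENNReal.ofReal (X ^ (p + γ / 2)) * ENNReal.ofReal m₀ := by
    rw [← hm₀, ← lintegral_const_mul' _ _ ENNReal.ofReal_ne_top]
    refine (setLIntegral_mono' hS.compl fun v hv => ?_).trans (setLIntegral_le_lintegral _ _)
    rw [← ENNReal.ofReal_mul (by positivity), mul_comm]
    refine ENNReal.ofReal_le_ofReal ?_
    have hv : en v < X := by simpa using hv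
    have := en_pos v
    have := (hg'01 v).1
    gcongr
  have h3 : wint (fun x => x ^ (p + γ / 2)) g' =
      (∫⁻ v in {v : V | X ≤ en v}, ENNReal.ofReal (g' v * en v ^ (p + γ / 2))) +
      ∫⁻ v in {v : V | X ≤ en v}ᶜ, ENNReal.ofReal (g' v * en v ^ (p + γ / 2)) :=
    (lintegral_add_compl _ hS).symm
  rw [h3, mul_add]
  refine add_le_add h1 ?_
  refine (mul_le_mul_right h2 _).trans_eq ?_
  rw [← ENNReal.ofReal_mul (by positivity), ← ENNReal.ofReal_mul (by positivity), mul_assoc]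

/-! ### Upper bounds -/

/-- The angular upper bound, weighted with the sine of the deviation angle. -/
def angUp (bUp : ℝ → ℝ) (c : ℝ) : ℝ≥0∞ := ENNReal.ofReal (bUp c * sn c)

/-- The total angular mass of `angUp`. -/
def upMass (bUp : ℝ → ℝ) : ℝ≥0∞ :=
  ENNReal.ofReal (2 * Real.pi) *
    ∫⁻ θ in Ioo 0 Real.pi, angUp bUp (Real.cos θ) * ENNReal.ofReal (Real.sin θ)

lemma measurable_angUp {bUp : ℝ → ℝ} (hb : Measurable bUp) : Measurable (angUp bUp) :=
  (hb.mul measurable_sn).ennreal_ofReal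

/-- Of the two sines in the cutoff condition, one is carried by `angUp` and one by the area measure.
-/
lemma upMass_ne_top {bUp : ℝ → ℝ}
    (h : IntegrableOn (fun θ => bUp (Real.cos θ) * Real.sin θ ^ 2) (Ioo 0 Real.pi)) :
    upMass bUp ≠ ∞ := by
  refine ENNReal.mul_ne_top ENNReal.ofReal_ne_top (ne_of_lt (lt_of_le_of_lt ?_ h.2))
  refine setLIntegral_mono' measurableSet_Ioo fun θ hθ => ?_
  have hs := Real.sin_pos_of_mem_Ioo hθ
  rw [angUp, sn, ← Real.abs_sin_eq_sqrt_one_sub_cos_sq, abs_of_pos hs,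
    ← ENNReal.ofReal_mul' hs.le, mul_assoc, ← sq]
  exact Real.ofReal_le_enorm _

lemma aemeasurable_weight {g : V → ℝ} (hg : AEMeasurable g) {θ : ℝ → ℝ} (hθ : Measurable θ) :
    AEMeasurable fun v => ENNReal.ofReal (g v * θ (en v)) :=
  (hg.mul (hθ.comp measurable_en).aemeasurable).ennreal_ofReal

/-- The angular integral is the same for all pairs off the diagonal, a null set, so the integral
factorizes. -/
lemma lintegral_tensor {bUp : ℝ → ℝ} (hb : Measurable bUp) {g : V → ℝ} (hg : AEMeasurable g)
    {θ ρ : ℝ → ℝ} (hθ : Measurable θ) (hρ : Measurable ρ) :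
    ∫⁻ x : V × V × S2, ENNReal.ofReal (g x.1 * θ (en x.1)) *
      (ENNReal.ofReal (g x.2.1 * ρ (en x.2.1)) * angUp bUp (cs x.1 x.2.1 x.2.2)) ∂collMeasure =
      upMass bUp * (wint θ g * wint ρ g) := by
  have h1 := aemeasurable_weight hg hθ
  have h2 := aemeasurable_weight hg hρ
  rw [lintegral_coll]
  · have e1 : ∀ v : V, ∫⁻ w, ∫⁻ σ, ENNReal.ofReal (g v * θ (en v)) *
        (ENNReal.ofReal (g w * ρ (en w)) * angUp bUp (cs v w σ)) ∂dσ =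
        ENNReal.ofReal (g v * θ (en v)) * (wint ρ g * upMass bUp) := by
      intro v
      have e2 : ∀ᵐ w : V, ∫⁻ σ, ENNReal.ofReal (g v * θ (en v)) *
          (ENNReal.ofReal (g w * ρ (en w)) * angUp bUp (cs v w σ)) ∂dσ =
          ENNReal.ofReal (g v * θ (en v)) * (ENNReal.ofReal (g w * ρ (en w)) * upMass bUp) := by
        have : ∀ᵐ w : V, w ∈ ({v}ᶜ : Set V) :=
          measure_eq_zero_iff_ae_notMem.1 (measure_singleton v)
        filter_upwards [this] with w hw
        rw [lintegral_const_mul' _ _ ENNReal.ofReal_ne_top,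
          lintegral_const_mul' _ _ ENNReal.ofReal_ne_top,
          lintegral_cs (fun h => hw h.symm) _ (measurable_angUp hb)]
        rfl
      rw [lintegral_congr_ae e2, lintegral_const_mul' _ _ ENNReal.ofReal_ne_top,
        lintegral_mul_const'' _ h2]
      rfl
    simp_rw [e1]
    rw [lintegral_mul_const'' _ h1, ← wint]
    ring
  · exact (h1.comp_quasiMeasurePreserving quasiMeasurePreserving_pre).mul
      ((h2.comp_quasiMeasurePreserving quasiMeasurePreserving_preStar).mul
        ((measurable_angUp hb).comp measurable_cs).aemeasurable)

/-! #### The entropy production controls close collisions -/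

/-- Apply `log (1 + x) ≥ 2 x / (x + 2)` at `x = (a - b) / b`, after reducing to `b ≤ a` by symmetry.
-/
lemma sq_div_le_mul_log {a b : ℝ} (ha : 0 < a) (hb : 0 < b) :
    2 * (a - b) ^ 2 / (a + b) ≤ (a - b) * Real.log (a / b) := by
  wlog h : b ≤ a generalizing a b
  · have := this hb ha (le_of_not_ge h)
    rw [← neg_sub a b, neg_sq, add_comm, ← inv_div a b, Real.log_inv, neg_mul_neg] at this
    exact this
  have h1 := Real.le_log_one_add_of_nonneg (x := (a - b) / b) (div_nonneg (by linarith) hb.le)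
  have e1 : 1 + (a - b) / b = a / b := by field_simp; ring
  have e2 : 2 * ((a - b) / b) / ((a - b) / b + 2) = 2 * (a - b) / (a + b) := by
    have e3 : (a - b) / b + 2 = (a + b) / b := by field_simp; ring
    rw [e3]; field_simp
  rw [e1, e2] at h1
  have h2 : 0 ≤ a - b := sub_nonneg.2 h
  calc 2 * (a - b) ^ 2 / (a + b) = (a - b) * (2 * (a - b) / (a + b)) := by ring
    _ ≤ _ := by gcongr

/-- Weighted Young inequality: the difference of the two sides is a square over `2 η (a + b)`. -/
lemma abs_sub_mul_le {a b δ η : ℝ} (hη : 0 < η) (hab : 0 < a + b) :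
    |a - b| * δ ≤ (1 / (4 * η)) * (2 * (a - b) ^ 2 / (a + b)) + η / 2 * ((a + b) * δ ^ 2) := by
  have e : (1 / (4 * η)) * (2 * (a - b) ^ 2 / (a + b)) + η / 2 * ((a + b) * δ ^ 2) -
      |a - b| * δ = (|a - b| - η * (a + b) * δ) ^ 2 / (2 * η * (a + b)) := by
    rw [← sq_abs (a - b)]
    field_simp
    ring
  have : 0 ≤ (|a - b| - η * (a + b) * δ) ^ 2 / (2 * η * (a + b)) := by positivity
  linarith

lemma ofReal_abs_sub_mul_le {a b δ η : ℝ} (ha : 0 ≤ a) (hb : 0 ≤ b) (hη : 0 < η) :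
    ENNReal.ofReal (|a - b| * δ) ≤
      ENNReal.ofReal (1 / (4 * η)) * Gam a b + ENNReal.ofReal (η / 2 * ((a + b) * δ ^ 2)) := by
  unfold Gam
  split_ifs with h1 h2
  · simp [h1.1, h1.2]
  · rw [ENNReal.mul_top]
    · simp
    · exact (ENNReal.ofReal_pos.2 (by positivity)).ne'
  · push Not at h2
    have ha' : 0 < a := lt_of_le_of_ne ha h2.1.symm
    have hb' : 0 < b := lt_of_le_of_ne hb h2.2.symm
    have h3 := sq_div_le_mul_log ha' hb'
    have h4 : 0 ≤ 2 * (a - b) ^ 2 / (a + b) := by positivity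
    rw [← ENNReal.ofReal_mul (by positivity), ← ENNReal.ofReal_add
      (mul_nonneg (by positivity) (h4.trans h3)) (by positivity)]
    refine ENNReal.ofReal_le_ofReal ((abs_sub_mul_le hη (by positivity)).trans ?_)
    gcongr

lemma PiPlus_sub_PiMinus (g : V → ℝ) (q : V → V → S2 → ℝ) (v w : V) (σ : S2) :
    PiPlus g q v w σ - PiMinus g q v w σ = PiF g v w σ := by
  unfold PiPlus PiMinus PiF; ring

lemma delta_collMap (ψ : V → ℝ) (v w : V) (σ : S2) :
    Δ ψ (post v w σ) (postStar v w σ) (dir (v - w) σ) = -Δ ψ v w σ := by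
  unfold Δ; rw [post_post, postStar_post]; ring

/-- A function of the velocity with values in `[0, 1]`, together with the auxiliary function of the
weak entropy inequality. -/
structure EntropyPair (g : V → ℝ) (q : V → V → S2 → ℝ) : Prop where
  meas : AEMeasurable g
  mem : ∀ u, g u ∈ Icc (0 : ℝ) 1
  plus : ∀ v w σ, PiPlus g q v w σ ∈ Icc 0 (g (post v w σ) * g (postStar v w σ))
  minus : ∀ v w σ, PiMinus g q v w σ ∈ Icc 0 (g v * g w)

/-- The properties of the collision kernel that enter the upper bounds. -/
structure UpperKernel (bUp : ℝ → ℝ) (γ : ℝ) (B : ℝ → ℝ → ℝ) : Prop where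
  meas : Measurable (Function.uncurry B)
  nonneg : ∀ r > 0, ∀ c ∈ Icc (-1 : ℝ) 1, 0 ≤ B r c
  meas_up : Measurable bUp
  exponent : γ ∈ Ico (-4 : ℝ) 0
  upper : ∀ r > 0, ∀ c ∈ Ioo (-1 : ℝ) 1, B r c ≤ r ^ γ * bUp c

/-! ### Pointwise kernel bounds and close collisions. -/

section estimates

variable {bUp : ℝ → ℝ} {γ : ℝ} {B : ℝ → ℝ → ℝ} {g : V → ℝ} {q : V → V → S2 → ℝ} {p N : ℝ}

lemma UpperKernel.kernel_nonneg (hB : UpperKernel bUp γ B) {v w : V} (h : v ≠ w) (σ : S2) :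
    0 ≤ kernel B (v - w) σ :=
  hB.nonneg _ (norm_pos_iff.2 (sub_ne_zero.2 h)) _ (abs_le.1 (abs_cs_le_one v w σ))

/-- The upper bound on the kernel is assumed only for `|cos θ| < 1`; at the endpoints the sine
vanishes. -/
lemma UpperKernel.kernel_mul_sn_le (hB : UpperKernel bUp γ B) {v w : V} (h : v ≠ w) (σ : S2) :
    kernel B (v - w) σ * sn (cs v w σ) ≤ ‖v - w‖ ^ γ * (bUp (cs v w σ) * sn (cs v w σ)) := by
  have hr : 0 < ‖v - w‖ := norm_pos_iff.2 (sub_ne_zero.2 h)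
  have h1 := abs_cs_le_one v w σ
  rcases h1.lt_or_eq with h2 | h2
  · rw [← mul_assoc]
    gcongr
    · exact sn_nonneg _
    · exact hB.upper _ hr _ (abs_lt.1 h2)
  · have : sn (cs v w σ) = 0 := by
      rw [sn, ← sq_abs, h2]; simp
    rw [this]; simp

lemma UpperKernel.bUp_mul_sn_nonneg (hB : UpperKernel bUp γ B) {v w : V} (h : v ≠ w) (σ : S2) :
    0 ≤ bUp (cs v w σ) * sn (cs v w σ) := by
  have hr : 0 < ‖v - w‖ := norm_pos_iff.2 (sub_ne_zero.2 h)
  have h1 := hB.kernel_mul_sn_le h σ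
  have h2 := mul_nonneg (hB.kernel_nonneg h σ) (sn_nonneg (cs v w σ))
  have h3 : 0 < ‖v - w‖ ^ γ := Real.rpow_pos_of_pos hr _
  by_contra h4
  push Not at h4
  nlinarith

lemma ne_of_not_near {v w : V} (h : ¬ Near v w) : v ≠ w := by
  rintro rfl
  apply h
  unfold Near
  rw [sub_self, norm_zero]
  have := avg_pos v v
  simp [this.le]

/-- `16 = 4 ^ 2` bounds `(1/4) ^ (γ / 2)` because `γ ≥ -4`. -/
lemma rpow_norm_le_of_not_near (hγ : γ ∈ Ico (-4 : ℝ) 0) {v w : V} (h : ¬ Near v w) :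
    ‖v - w‖ ^ γ ≤ 16 * avg v w ^ (γ / 2) := by
  have ha := avg_pos v w
  have h1 : avg v w / 4 ≤ ‖v - w‖ ^ 2 := by unfold Near at h; linarith
  have e1 : ‖v - w‖ ^ γ = (‖v - w‖ ^ 2) ^ (γ / 2) := by
    rw [← Real.rpow_natCast, ← Real.rpow_mul (norm_nonneg _)]
    congr 1; push_cast; ring
  have e2 : (‖v - w‖ ^ 2) ^ (γ / 2) ≤ (avg v w / 4) ^ (γ / 2) :=
    Real.rpow_le_rpow_of_nonpos (by positivity) h1 (by linarith [hγ.2])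
  have e3 : (4 : ℝ)⁻¹ ^ (γ / 2) ≤ 4⁻¹ ^ (-2 : ℝ) :=
    Real.rpow_le_rpow_of_exponent_ge (by norm_num) (by norm_num) (by linarith [hγ.1])
  have e4 : (4 : ℝ)⁻¹ ^ (-2 : ℝ) = 16 := by
    rw [show (-2 : ℝ) = -(2 : ℕ) by norm_num, Real.rpow_neg (by norm_num), Real.rpow_natCast]
    norm_num
  rw [e1]
  refine e2.trans ?_
  rw [div_eq_inv_mul, Real.mul_rpow (by norm_num) ha.le]
  gcongr
  exact e3.trans_eq e4

lemma delta_self (ψ : V → ℝ) (v : V) (σ : S2) : Δ ψ v v σ = 0 := by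
  have : mid v v = v := by unfold mid; module
  unfold Δ
  rw [post_eq, postStar_eq, sub_self, norm_zero, mul_zero, zero_smul, add_zero, sub_zero, this]
  ring

lemma measurable_delta {ψ : V → ℝ} (hψ : Measurable ψ) :
    Measurable fun x : V × V × S2 => Δ ψ x.1 x.2.1 x.2.2 := by
  have h1 := hψ.comp measurable_post
  have h2 := hψ.comp measurable_postStar
  have h3 := hψ.comp (measurable_fst : Measurable fun x : V × V × S2 => x.1)
  have h4 := hψ.comp (measurable_fst.comp measurable_snd : Measurable fun x : V × V × S2 => x.2.1)
  exact ((h1.add h2).sub h3).sub h4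

lemma measurable_vwt (hp : 2 ≤ p) : Measurable (vwt p N) :=
  (continuous_wt hp).measurable.comp measurable_en

/-- The variation of `ψ` in collisions of close pairs. -/
def nearInt (B : ℝ → ℝ → ℝ) (g ψ : V → ℝ) : ℝ≥0∞ :=
  ∫⁻ x in farSetᶜ, ENNReal.ofReal
    (kernel B (x.1 - x.2.1) x.2.2 * |PiF g x.1 x.2.1 x.2.2| * |Δ ψ x.1 x.2.1 x.2.2|) ∂collMeasure

/-- The increase of `ψ` in collisions of distant pairs. -/
def gainInt (B : ℝ → ℝ → ℝ) (g ψ : V → ℝ) : ℝ≥0∞ :=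
  ∫⁻ x in farSet, ENNReal.ofReal
    (kernel B (x.1 - x.2.1) x.2.2 * lossFactor g x.1 x.2.1 x.2.2 * Δ ψ x.1 x.2.1 x.2.2)
    ∂collMeasure

lemma aemeasurable_pre (hg : AEMeasurable g) :
    AEMeasurable (fun x : V × V × S2 => g x.1) collMeasure :=
  hg.comp_quasiMeasurePreserving quasiMeasurePreserving_pre

lemma aemeasurable_preStar (hg : AEMeasurable g) :
    AEMeasurable (fun x : V × V × S2 => g x.2.1) collMeasure :=
  hg.comp_quasiMeasurePreserving quasiMeasurePreserving_preStar

lemma aemeasurable_post (hg : AEMeasurable g) :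
    AEMeasurable (fun x : V × V × S2 => g (post x.1 x.2.1 x.2.2)) collMeasure :=
  hg.comp_quasiMeasurePreserving quasiMeasurePreserving_post

lemma aemeasurable_postStar (hg : AEMeasurable g) :
    AEMeasurable (fun x : V × V × S2 => g (postStar x.1 x.2.1 x.2.2)) collMeasure :=
  hg.comp_quasiMeasurePreserving quasiMeasurePreserving_postStar

lemma mem_farSet_collMap (x : V × V × S2) : collMap x ∈ farSet ↔ x ∈ farSet :=
  not_congr (near_post x.1 x.2.1 x.2.2)

/-- The square of the variation in close collisions, on outgoing pairs. -/
lemma near_sq_collMap (ψ : V → ℝ) :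
    ∫⁻ x in farSetᶜ, ENNReal.ofReal (kernel B (x.1 - x.2.1) x.2.2 *
      (g (post x.1 x.2.1 x.2.2) * g (postStar x.1 x.2.1 x.2.2) * Δ ψ x.1 x.2.1 x.2.2 ^ 2))
      ∂collMeasure =
    ∫⁻ x in farSetᶜ, ENNReal.ofReal (kernel B (x.1 - x.2.1) x.2.2 *
      (g x.1 * g x.2.1 * Δ ψ x.1 x.2.1 x.2.2 ^ 2)) ∂collMeasure := by
  rw [← lintegral_indicator measurableSet_farSet.compl,
    ← lintegral_indicator measurableSet_farSet.compl, ← lintegral_collMap]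
  refine lintegral_congr fun x => ?_
  obtain ⟨v, w, σ⟩ := x
  by_cases h : (v, w, σ) ∈ farSet
  · rw [indicator_of_notMem (by simpa [mem_farSet_collMap] using h),
      indicator_of_notMem (by simpa using h)]
  · rw [indicator_of_mem (by simpa [mem_farSet_collMap] using h),
      indicator_of_mem (by simpa using h)]
    simp only [collMap, post_post, postStar_post, delta_collMap, kernel_post, neg_sq]

/-- Squaring the increment gives `‖v - w‖ ^ 4`, which compensates the singularity `‖v - w‖ ^ γ`
exactly when `γ ≥ -4`. Of the two sines, one tames the kernel and the other is bounded by `1`. -/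
lemma near_pointwise (hB : UpperKernel bUp γ B) (hp : 2 ≤ p) (hN : 0 < N) {v w : V}
    (h : Near v w) (hvw : v ≠ w) (σ : S2) :
    kernel B (v - w) σ * Δ (vwt p N) v w σ ^ 2 ≤
      (p * 2 ^ (p + 2)) ^ 2 * (avg v w ^ ((γ + 4) / 2) * slope p N (avg v w) ^ 2) *
        (bUp (cs v w σ) * sn (cs v w σ)) := by
  have ha := avg_pos v w
  have hr : 0 < ‖v - w‖ := norm_pos_iff.2 (sub_ne_zero.2 hvw)
  have hk := hB.kernel_nonneg hvw σ
  have h1 := h.abs_delta_vwt_le hp hN σ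
  have hs := sn_nonneg (cs v w σ)
  have h2 : Δ (vwt p N) v w σ ^ 2 ≤
      (p * 2 ^ (p + 2) * (sn (cs v w σ) * ‖v - w‖ ^ 2 * slope p N (avg v w))) ^ 2 := by
    rw [← sq_abs]; gcongr
  have h3 : ‖v - w‖ ^ γ * ‖v - w‖ ^ 4 ≤ avg v w ^ ((γ + 4) / 2) := by
    have e1 : ‖v - w‖ ^ γ * ‖v - w‖ ^ 4 = (‖v - w‖ ^ 2) ^ ((γ + 4) / 2) := by
      rw [← Real.rpow_natCast _ 4, ← Real.rpow_add hr, ← Real.rpow_natCast _ 2,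
        ← Real.rpow_mul hr.le]
      congr 1; push_cast; ring
    rw [e1]
    refine Real.rpow_le_rpow (by positivity) ?_ (by linarith [hB.exponent.1])
    unfold Near at h; nlinarith [sq_nonneg ‖v - w‖]
  have h4 := hB.kernel_mul_sn_le hvw σ
  have h5 := hB.bUp_mul_sn_nonneg hvw σ
  set k := kernel B (v - w) σ
  set s := sn (cs v w σ)
  set C := p * 2 ^ (p + 2)
  set D := slope p N (avg v w)
  calc k * Δ (vwt p N) v w σ ^ 2 ≤ k * (C * (s * ‖v - w‖ ^ 2 * D)) ^ 2 := by gcongr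
    _ = C ^ 2 * D ^ 2 * ‖v - w‖ ^ 4 * s * (k * s) := by ring
    _ ≤ C ^ 2 * D ^ 2 * ‖v - w‖ ^ 4 * 1 * (‖v - w‖ ^ γ * (bUp (cs v w σ) * s)) := by
        gcongr
        exact sn_le_one _
    _ = C ^ 2 * D ^ 2 * (‖v - w‖ ^ γ * ‖v - w‖ ^ 4) * (bUp (cs v w σ) * s) := by ring
    _ ≤ C ^ 2 * D ^ 2 * avg v w ^ ((γ + 4) / 2) * (bUp (cs v w σ) * s) := by gcongr
    _ = _ := by ring

/-- Close collisions are controlled by the entropy production and a product of moments. -/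
theorem nearInt_le (hB : UpperKernel bUp γ B) (hp : 2 ≤ p) (hN : 0 < N) (hgq : EntropyPair g q)
    {θ : ℝ → ℝ} (hθ : Measurable θ) {K η : ℝ} (hη : 0 < η) (hK : 0 ≤ K)
    (hθ0 : ∀ x ≥ 1, 0 ≤ θ x)
    (hw : ∀ a x y, 1 ≤ a → 1 ≤ x → 1 ≤ y → a ≤ 2 * x → a ≤ 2 * y →
      a ^ ((γ + 4) / 2) * slope p N a ^ 2 ≤ K * (θ x * wt p N y)) :
    nearInt B g (vwt p N) ≤ ENNReal.ofReal (1 / η) * dissipation B g q +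
      ENNReal.ofReal (η * ((p * 2 ^ (p + 2)) ^ 2 * K)) *
        (upMass bUp * (wint θ g * wint (wt p N) g)) := by
  have hm := hgq.meas
  have m1 := aemeasurable_pre hm
  have m2 := aemeasurable_preStar hm
  have mk := (measurable_kernel hB.meas).aemeasurable (μ := collMeasure)
  have md := (measurable_delta (measurable_vwt (N := N) hp)).aemeasurable (μ := collMeasure)
  have hfc := measurableSet_farSet.compl
  set C := (p * 2 ^ (p + 2)) ^ 2 with hC
  have hC0 : 0 ≤ C := sq_nonneg _
  -- pointwise estimate
  have hpt : ∀ x ∈ farSetᶜ, ENNReal.ofReal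
      (kernel B (x.1 - x.2.1) x.2.2 * |PiF g x.1 x.2.1 x.2.2| * |Δ (vwt p N) x.1 x.2.1 x.2.2|) ≤
      ENNReal.ofReal (1 / (4 * η)) * (ENNReal.ofReal (kernel B (x.1 - x.2.1) x.2.2) *
        Gam (PiPlus g q x.1 x.2.1 x.2.2) (PiMinus g q x.1 x.2.1 x.2.2)) +
      (ENNReal.ofReal (η / 2) * ENNReal.ofReal (kernel B (x.1 - x.2.1) x.2.2 *
        (g (post x.1 x.2.1 x.2.2) * g (postStar x.1 x.2.1 x.2.2) *
          Δ (vwt p N) x.1 x.2.1 x.2.2 ^ 2)) +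
      ENNReal.ofReal (η / 2) * ENNReal.ofReal (kernel B (x.1 - x.2.1) x.2.2 *
        (g x.1 * g x.2.1 * Δ (vwt p N) x.1 x.2.1 x.2.2 ^ 2))) := by
    rintro ⟨v, w, σ⟩ -
    simp only
    by_cases hvw : v = w
    · subst hvw; simp [delta_self]
    have hk := hB.kernel_nonneg hvw σ
    obtain ⟨a0, a1⟩ := hgq.plus v w σ
    obtain ⟨b0, b1⟩ := hgq.minus v w σ
    have h1 := ofReal_abs_sub_mul_le (δ := |Δ (vwt p N) v w σ|) a0 b0 hη
    rw [PiPlus_sub_PiMinus] at h1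
    have h2 := mul_le_mul_right h1 (ENNReal.ofReal (kernel B (v - w) σ))
    rw [← ENNReal.ofReal_mul hk, ← mul_assoc] at h2
    refine h2.trans ?_
    rw [mul_add]
    refine add_le_add (le_of_eq (by ring)) ?_
    rw [← ENNReal.ofReal_mul hk, ← ENNReal.ofReal_mul (by positivity),
      ← ENNReal.ofReal_mul (by positivity)]
    have c1 : 0 ≤ g (post v w σ) * g (postStar v w σ) := mul_nonneg (hgq.mem _).1 (hgq.mem _).1
    have c2 : 0 ≤ g v * g w := mul_nonneg (hgq.mem _).1 (hgq.mem _).1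
    rw [← ENNReal.ofReal_add (by positivity) (by positivity)]
    refine ENNReal.ofReal_le_ofReal ?_
    rw [sq_abs]
    calc kernel B (v - w) σ * (η / 2 * ((PiPlus g q v w σ + PiMinus g q v w σ) *
          Δ (vwt p N) v w σ ^ 2))
        ≤ kernel B (v - w) σ * (η / 2 * ((g (post v w σ) * g (postStar v w σ) + g v * g w) *
          Δ (vwt p N) v w σ ^ 2)) := by gcongr
      _ = _ := by ring
  -- the quadratic term
  have hquad : ∫⁻ x in farSetᶜ, ENNReal.ofReal (kernel B (x.1 - x.2.1) x.2.2 *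
        (g x.1 * g x.2.1 * Δ (vwt p N) x.1 x.2.1 x.2.2 ^ 2)) ∂collMeasure ≤
      ENNReal.ofReal (C * K) * (upMass bUp * (wint θ g * wint (wt p N) g)) := by
    rw [← lintegral_tensor hB.meas_up hm hθ (continuous_wt hp).measurable,
      ← lintegral_const_mul' _ _ ENNReal.ofReal_ne_top]
    refine (setLIntegral_mono' hfc ?_).trans (setLIntegral_le_lintegral _ _)
    rintro ⟨v, w, σ⟩ hx
    have hx : Near v w := not_not.1 hx
    simp only
    by_cases hvw : v = w
    · subst hvw; simp [delta_self]
    have h1 := near_pointwise hB hp hN hx hvw σ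
    have h2 := hB.bUp_mul_sn_nonneg hvw σ
    have h3 := hw (avg v w) (en v) (en w) (one_le_avg v w) (one_le_en v) (one_le_en w)
      hx.avg_le_left hx.avg_le_right
    have hv0 := (hgq.mem v).1
    have hw0 := (hgq.mem w).1
    have e1 := hθ0 _ (one_le_en v)
    have e2 := wt_nonneg (N := N) hp (en_pos w).le
    rw [angUp, ← ENNReal.ofReal_mul (mul_nonneg hw0 e2), ← ENNReal.ofReal_mul (mul_nonneg hv0 e1),
      ← ENNReal.ofReal_mul (by positivity)]
    refine ENNReal.ofReal_le_ofReal ?_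
    calc kernel B (v - w) σ * (g v * g w * Δ (vwt p N) v w σ ^ 2)
        = g v * g w * (kernel B (v - w) σ * Δ (vwt p N) v w σ ^ 2) := by ring
      _ ≤ g v * g w * (C * (avg v w ^ ((γ + 4) / 2) * slope p N (avg v w) ^ 2) *
            (bUp (cs v w σ) * sn (cs v w σ))) := by gcongr
      _ ≤ g v * g w * (C * (K * (θ (en v) * wt p N (en w))) *
            (bUp (cs v w σ) * sn (cs v w σ))) := by gcongr
      _ = _ := by ring
  have mq : AEMeasurable (fun x : V × V × S2 => ENNReal.ofReal (η / 2) *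
      ENNReal.ofReal (kernel B (x.1 - x.2.1) x.2.2 *
        (g x.1 * g x.2.1 * Δ (vwt p N) x.1 x.2.1 x.2.2 ^ 2))) (collMeasure.restrict farSetᶜ) :=
    ((mk.mul ((m1.mul m2).mul (md.pow_const 2))).ennreal_ofReal.const_mul _).restrict
  calc nearInt B g (vwt p N) ≤ _ := setLIntegral_mono' hfc hpt
    _ ≤ (∫⁻ x in farSetᶜ, ENNReal.ofReal (1 / (4 * η)) *
          (ENNReal.ofReal (kernel B (x.1 - x.2.1) x.2.2) *
            Gam (PiPlus g q x.1 x.2.1 x.2.2) (PiMinus g q x.1 x.2.1 x.2.2)) ∂collMeasure) +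
        ((∫⁻ x in farSetᶜ, ENNReal.ofReal (η / 2) * ENNReal.ofReal (kernel B (x.1 - x.2.1) x.2.2 *
          (g (post x.1 x.2.1 x.2.2) * g (postStar x.1 x.2.1 x.2.2) *
            Δ (vwt p N) x.1 x.2.1 x.2.2 ^ 2)) ∂collMeasure) +
        ∫⁻ x in farSetᶜ, ENNReal.ofReal (η / 2) * ENNReal.ofReal (kernel B (x.1 - x.2.1) x.2.2 *
          (g x.1 * g x.2.1 * Δ (vwt p N) x.1 x.2.1 x.2.2 ^ 2)) ∂collMeasure) := by
        rw [← lintegral_add_right' _ mq, ← lintegral_add_right']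
        refine AEMeasurable.add ?_ mq
        exact ((mk.mul (((aemeasurable_post hm).mul (aemeasurable_postStar hm)).mul
          (md.pow_const 2))).ennreal_ofReal.const_mul _).restrict
    _ ≤ ENNReal.ofReal (1 / η) * dissipation B g q + (ENNReal.ofReal (η / 2) *
          (ENNReal.ofReal (C * K) * (upMass bUp * (wint θ g * wint (wt p N) g))) +
          ENNReal.ofReal (η / 2) *
          (ENNReal.ofReal (C * K) * (upMass bUp * (wint θ g * wint (wt p N) g)))) := by
        gcongr ?_ + (?_ + ?_)
        · rw [lintegral_const_mul' _ _ ENNReal.ofReal_ne_top, dissipation, ← mul_assoc]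
          -- The `1/4` is the one in the definition of `dissipation`.
          have e : ENNReal.ofReal (1 / η) * (1 / 4) = ENNReal.ofReal (1 / (4 * η)) := by
            rw [show (1 / 4 : ℝ≥0∞) = ENNReal.ofReal (1 / 4) by
              rw [ENNReal.ofReal_div_of_pos (by norm_num)]; simp,
              ← ENNReal.ofReal_mul (by positivity)]
            congr 1; field_simp
          rw [e]
          exact mul_le_mul_right (setLIntegral_le_lintegral _ _) _
        -- The collision map turns the quadratic term in the outgoing pair into the one in the
        -- incoming pair, so both halves obey the same bound.
        · rw [lintegral_const_mul' _ _ ENNReal.ofReal_ne_top, near_sq_collMap]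
          gcongr
        · rw [lintegral_const_mul' _ _ ENNReal.ofReal_ne_top]
          gcongr
    _ = _ := by
        rw [← add_mul, ← ENNReal.ofReal_add (by positivity) (by positivity), ← mul_assoc,
          ← ENNReal.ofReal_mul (by positivity)]
        congr 3; ring

end estimates

/-! ### Distant pairs, and the splitting of the collision integral. -/

section estimates

variable {bUp : ℝ → ℝ} {γ : ℝ} {B : ℝ → ℝ → ℝ} {g : V → ℝ} {p N : ℝ}

lemma lossFactor_mem (hg : ∀ u, g u ∈ Icc (0 : ℝ) 1) (v w : V) (σ : S2) :
    lossFactor g v w σ ∈ Icc 0 (g v * g w) := by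
  have h1 := hg (post v w σ)
  have h2 := hg (postStar v w σ)
  have h3 := mul_nonneg (hg v).1 (hg w).1
  have h4 : 0 ≤ 1 - g (post v w σ) := by linarith [h1.2]
  have h5 : 0 ≤ 1 - g (postStar v w σ) := by linarith [h2.2]
  refine ⟨mul_nonneg h3 (mul_nonneg h4 h5), mul_le_of_le_one_right h3 ?_⟩
  exact mul_le_one₀ (by linarith [h1.1]) h5 (by linarith [h2.1])

lemma kernel_mul_sn_le_of_far (hB : UpperKernel bUp γ B) {v w : V} (h : ¬ Near v w) (σ : S2) :
    kernel B (v - w) σ * sn (cs v w σ) ≤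
      16 * avg v w ^ (γ / 2) * (bUp (cs v w σ) * sn (cs v w σ)) :=
  (hB.kernel_mul_sn_le (ne_of_not_near h) σ).trans (mul_le_mul_of_nonneg_right
    (rpow_norm_le_of_not_near hB.exponent h) (hB.bUp_mul_sn_nonneg (ne_of_not_near h) σ))

/-- The gain in collisions of distant pairs is controlled by a product of moments. -/
theorem gainInt_le (hB : UpperKernel bUp γ B) (hp : 2 ≤ p) (hm : AEMeasurable g)
    (hg : ∀ u, g u ∈ Icc (0 : ℝ) 1) {θ : ℝ → ℝ} (hθ : Measurable θ) {K : ℝ} (hK : 0 ≤ K)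
    (hθ0 : ∀ x ≥ 1, 0 ≤ θ x)
    (hw : ∀ a x y, 1 ≤ x → 1 ≤ y → 2 * a = x + y →
      a ^ (γ / 2) * slope p N (2 * a) * √(x * y) ≤ K * (θ x * y + θ y * x)) :
    gainInt B g (vwt p N) ≤
      ENNReal.ofReal (32 * K) * (upMass bUp * (wint θ g * wint id g)) := by
  have t1 := lintegral_tensor hB.meas_up hm hθ measurable_id
  have t2 := lintegral_tensor hB.meas_up hm measurable_id hθ
  have mθ : Measurable fun x : V × V × S2 => θ (en x.1) :=
    hθ.comp (measurable_en.comp measurable_fst)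
  have me : Measurable fun x : V × V × S2 => en x.2.1 :=
    measurable_en.comp (measurable_fst.comp measurable_snd)
  have ma : Measurable fun x : V × V × S2 => angUp bUp (cs x.1 x.2.1 x.2.2) :=
    (measurable_angUp hB.meas_up).comp measurable_cs
  have mF : AEMeasurable (fun x : V × V × S2 => ENNReal.ofReal (g x.1 * θ (en x.1)) *
      (ENNReal.ofReal (g x.2.1 * en x.2.1) * angUp bUp (cs x.1 x.2.1 x.2.2))) collMeasure :=
    ((aemeasurable_pre hm).mul mθ.aemeasurable).ennreal_ofReal.mul
      (((aemeasurable_preStar hm).mul me.aemeasurable).ennreal_ofReal.mul ma.aemeasurable)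
  -- The weight inequality is symmetric in the two particles, so two tensor integrals of equal value
  -- appear.
  have e : ENNReal.ofReal (32 * K) * (upMass bUp * (wint θ g * wint id g)) =
      ENNReal.ofReal (16 * K) * (upMass bUp * (wint θ g * wint id g) +
        upMass bUp * (wint id g * wint θ g)) := by
    rw [show 32 * K = 16 * K + 16 * K by ring, ENNReal.ofReal_add (by positivity) (by positivity)]
    ring
  rw [e, ← t1, ← t2]
  simp only [id]
  rw [← lintegral_add_left' mF, ← lintegral_const_mul' _ _ ENNReal.ofReal_ne_top]
  refine (setLIntegral_mono' measurableSet_farSet ?_).trans (setLIntegral_le_lintegral _ _)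
  rintro ⟨v, w, σ⟩ hx
  have hx : ¬ Near v w := hx
  simp only
  have hvw := ne_of_not_near hx
  have hk := hB.kernel_nonneg hvw σ
  have h1 := kernel_mul_sn_le_of_far hB hx σ
  have h2 := hB.bUp_mul_sn_nonneg hvw σ
  obtain ⟨l0, l1⟩ := lossFactor_mem hg v w σ
  have h3 := delta_vwt_le (N := N) hp v w σ
  have ha := avg_pos v w
  have hs := slope_nonneg (N := N) hp (x := 2 * avg v w) (by linarith)
  have h4 := hw (avg v w) (en v) (en w) (one_le_en v) (one_le_en w) (by unfold avg; ring)
  have hv0 := (hg v).1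
  have hw0 := (hg w).1
  have tv := hθ0 _ (one_le_en v)
  have tw := hθ0 _ (one_le_en w)
  have ev := (en_pos v).le
  have ew := (en_pos w).le
  rw [angUp, ← ENNReal.ofReal_mul (by positivity), ← ENNReal.ofReal_mul (by positivity),
    ← ENNReal.ofReal_mul (by positivity), ← ENNReal.ofReal_mul (by positivity),
    ← ENNReal.ofReal_add (by positivity) (by positivity), ← ENNReal.ofReal_mul (by positivity)]
  refine ENNReal.ofReal_le_ofReal ?_
  calc kernel B (v - w) σ * lossFactor g v w σ * Δ (vwt p N) v w σ
      ≤ kernel B (v - w) σ * lossFactor g v w σ *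
          (slope p N (2 * avg v w) * (sn (cs v w σ) * √(en v * en w))) := by gcongr
    _ = lossFactor g v w σ * (slope p N (2 * avg v w) * √(en v * en w)) *
          (kernel B (v - w) σ * sn (cs v w σ)) := by ring
    _ ≤ lossFactor g v w σ * (slope p N (2 * avg v w) * √(en v * en w)) *
          (16 * avg v w ^ (γ / 2) * (bUp (cs v w σ) * sn (cs v w σ))) := by gcongr
    _ = lossFactor g v w σ * (16 * (avg v w ^ (γ / 2) * slope p N (2 * avg v w) *
          √(en v * en w)) * (bUp (cs v w σ) * sn (cs v w σ))) := by ring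
    _ ≤ g v * g w * (16 * (K * (θ (en v) * en w + θ (en w) * en v)) *
          (bUp (cs v w σ) * sn (cs v w σ))) := by gcongr
    _ = _ := by ring

lemma aemeasurable_lossFactor (hm : AEMeasurable g) :
    AEMeasurable (fun x : V × V × S2 => lossFactor g x.1 x.2.1 x.2.2) collMeasure :=
  ((aemeasurable_pre hm).mul (aemeasurable_preStar hm)).mul
    (((aemeasurable_post hm).const_sub 1).mul ((aemeasurable_postStar hm).const_sub 1))

/-- The loss integrand is integrable on distant pairs for a truncated weight. -/
lemma integrableOn_far (hB : UpperKernel bUp γ B) (hup : upMass bUp ≠ ∞) (hp : 2 ≤ p) (hN : 0 < N)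
    (hm : AEMeasurable g) (hg : ∀ u, g u ∈ Icc (0 : ℝ) 1) (hE : wint id g ≠ ∞) :
    IntegrableOn (fun x : V × V × S2 => kernel B (x.1 - x.2.1) x.2.2 *
      lossFactor g x.1 x.2.1 x.2.2 * Δ (vwt p N) x.1 x.2.1 x.2.2) farSet collMeasure := by
  have mk := (measurable_kernel hB.meas).aemeasurable (μ := collMeasure)
  have md := (measurable_delta (measurable_vwt (N := N) hp)).aemeasurable (μ := collMeasure)
  refine ⟨((mk.mul (aemeasurable_lossFactor hm)).mul md).restrict.aestronglyMeasurable, ?_⟩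
  have t1 := lintegral_tensor hB.meas_up hm measurable_id measurable_id
  have hS := slope_nonneg (N := N) hp (x := 2 * N) (by linarith)
  set S := slope p N (2 * N)
  have hfin : ENNReal.ofReal (32 * S) * (upMass bUp * (wint id g * wint id g)) < ∞ :=
    ENNReal.mul_lt_top ENNReal.ofReal_lt_top
      (ENNReal.mul_lt_top hup.lt_top (ENNReal.mul_lt_top hE.lt_top hE.lt_top))
  refine lt_of_le_of_lt ?_ hfin
  rw [← t1, ← lintegral_const_mul' _ _ ENNReal.ofReal_ne_top]
  refine (setLIntegral_mono' measurableSet_farSet ?_).trans (setLIntegral_le_lintegral _ _)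
  rintro ⟨v, w, σ⟩ hx
  have hx : ¬ Near v w := hx
  simp only [id]
  have hvw := ne_of_not_near hx
  have hk := hB.kernel_nonneg hvw σ
  have h1 := kernel_mul_sn_le_of_far hB hx σ
  have h2 := hB.bUp_mul_sn_nonneg hvw σ
  obtain ⟨l0, l1⟩ := lossFactor_mem hg v w σ
  have h3 := abs_delta_vwt_le (N := N) hp hN v w σ
  have ha := avg_pos v w
  have hv0 := (hg v).1
  have hw0 := (hg w).1
  have ev := one_le_en v
  have ew := one_le_en w
  have ha1 : avg v w ^ (γ / 2) ≤ 1 :=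
    Real.rpow_le_one_of_one_le_of_nonpos (one_le_avg v w) (by linarith [hB.exponent.2])
  have ha2 : avg v w ≤ en v * en w := by unfold avg; nlinarith
  rw [← ofReal_norm, angUp, ← ENNReal.ofReal_mul (by positivity),
    ← ENNReal.ofReal_mul (by positivity), ← ENNReal.ofReal_mul (by positivity)]
  refine ENNReal.ofReal_le_ofReal ?_
  rw [Real.norm_eq_abs, abs_mul, abs_of_nonneg (mul_nonneg hk l0)]
  calc kernel B (v - w) σ * lossFactor g v w σ * |Δ (vwt p N) v w σ|
      ≤ kernel B (v - w) σ * lossFactor g v w σ * (S * (2 * sn (cs v w σ) * avg v w)) := by gcongr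
    _ = lossFactor g v w σ * (2 * S * avg v w) * (kernel B (v - w) σ * sn (cs v w σ)) := by ring
    _ ≤ lossFactor g v w σ * (2 * S * avg v w) *
          (16 * avg v w ^ (γ / 2) * (bUp (cs v w σ) * sn (cs v w σ))) := by gcongr
    _ ≤ g v * g w * (2 * S * (en v * en w)) *
          (16 * 1 * (bUp (cs v w σ) * sn (cs v w σ))) := by gcongr
    _ = _ := by ring

/-- The gain factor is the loss factor of the reverse collision. Since `Δ` is odd and the kernel
even under the collision map, the two contribute equally. -/
lemma PiF_eq_lossFactor (x : V × V × S2) :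
    PiF g x.1 x.2.1 x.2.2 =
      lossFactor g (collMap x).1 (collMap x).2.1 (collMap x).2.2 -
        lossFactor g x.1 x.2.1 x.2.2 := by
  simp only [collMap, lossFactor, PiF, post_post, postStar_post]; ring

lemma farIntegrand_collMap (B : ℝ → ℝ → ℝ) (g ψ : V → ℝ) (x : V × V × S2) :
    farSet.indicator (fun x : V × V × S2 => kernel B (x.1 - x.2.1) x.2.2 *
      lossFactor g x.1 x.2.1 x.2.2 * Δ ψ x.1 x.2.1 x.2.2) (collMap x) =
    farSet.indicator (fun x : V × V × S2 => -(kernel B (x.1 - x.2.1) x.2.2 *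
      lossFactor g (collMap x).1 (collMap x).2.1 (collMap x).2.2 * Δ ψ x.1 x.2.1 x.2.2)) x := by
  by_cases h : x ∈ farSet
  · rw [indicator_of_mem ((mem_farSet_collMap x).2 h), indicator_of_mem h]
    simp only [collMap, delta_collMap, kernel_post]; ring
  · rw [indicator_of_notMem (mt (mem_farSet_collMap x).1 h), indicator_of_notMem h]

/-- The weak collision operator splits into a part on close pairs, a gain and a loss. -/
theorem neg_integral_collision_le (hB : UpperKernel bUp γ B) (hup : upMass bUp ≠ ∞) (hp : 2 ≤ p)
    (hN : 0 < N) (hm : AEMeasurable g) (hg : ∀ u, g u ∈ Icc (0 : ℝ) 1) (hE : wint id g ≠ ∞)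
    (hI : Integrable (fun x : V × V × S2 => kernel B (x.1 - x.2.1) x.2.2 *
      PiF g x.1 x.2.1 x.2.2 * Δ (vwt p N) x.1 x.2.1 x.2.2) collMeasure) :
    nearInt B g (vwt p N) ≠ ∞ ∧ lossInt B g (vwt p N) ≠ ∞ ∧
    -(1 / 4) * ∫ x : V × V × S2, kernel B (x.1 - x.2.1) x.2.2 *
        PiF g x.1 x.2.1 x.2.2 * Δ (vwt p N) x.1 x.2.1 x.2.2 ∂collMeasure +
      1 / 2 * (lossInt B g (vwt p N)).toReal ≤
      1 / 4 * (nearInt B g (vwt p N)).toReal + 1 / 2 * (gainInt B g (vwt p N)).toReal := by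
  set ψ := vwt p N
  have hF := integrableOn_far hB hup hp hN hm hg hE
  have hmf := measurableSet_farSet
  have hnear : nearInt B g ψ = ∫⁻ x in farSetᶜ, ENNReal.ofReal |kernel B (x.1 - x.2.1) x.2.2 *
      PiF g x.1 x.2.1 x.2.2 * Δ ψ x.1 x.2.1 x.2.2| ∂collMeasure := by
    refine lintegral_congr fun x => ?_
    obtain ⟨v, w, σ⟩ := x
    simp only
    by_cases hvw : v = w
    · subst hvw; simp [delta_self]
    · rw [abs_mul, abs_mul, abs_of_nonneg (hB.kernel_nonneg hvw σ)]
  have hnear' : nearInt B g ψ ≠ ∞ := by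
    rw [hnear]
    have := (hI.integrableOn (s := farSetᶜ)).2
    rw [hasFiniteIntegral_iff_norm] at this
    exact this.ne
  have hloss : lossInt B g ψ = ∫⁻ x in farSet, ENNReal.ofReal (-(kernel B (x.1 - x.2.1) x.2.2 *
      lossFactor g x.1 x.2.1 x.2.2 * Δ ψ x.1 x.2.1 x.2.2)) ∂collMeasure := by
    simp only [lossInt, mul_neg]
  have hloss' : lossInt B g ψ ≠ ∞ := by
    rw [hloss]
    have := hF.2
    rw [hasFiniteIntegral_iff_norm] at this
    exact ((lintegral_mono fun x => ENNReal.ofReal_le_ofReal (neg_le_abs _)).trans_lt this).ne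
  refine ⟨hnear', hloss', ?_⟩
  have e1 : ∫ x in farSet, kernel B (x.1 - x.2.1) x.2.2 *
      lossFactor g x.1 x.2.1 x.2.2 * Δ ψ x.1 x.2.1 x.2.2 ∂collMeasure =
      (gainInt B g ψ).toReal - (lossInt B g ψ).toReal := by
    rw [hloss, integral_eq_lintegral_pos_part_sub_lintegral_neg_part hF]; rfl
  have hF' : IntegrableOn (fun x : V × V × S2 => kernel B (x.1 - x.2.1) x.2.2 *
      lossFactor g (collMap x).1 (collMap x).2.1 (collMap x).2.2 * Δ ψ x.1 x.2.1 x.2.2)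
      farSet collMeasure := by
    have h1 := (integrable_indicator_iff hmf).2 hF
    have h2 := (measurePreserving_collMap.integrable_comp_emb
      collEquiv.measurableEmbedding).2 h1
    have h3 := h2.congr (Eventually.of_forall fun x => farIntegrand_collMap B g ψ x)
    have h4 := ((integrable_indicator_iff hmf).1 h3).neg
    simpa using h4
  have e2 : ∫ x in farSet, kernel B (x.1 - x.2.1) x.2.2 *
      lossFactor g (collMap x).1 (collMap x).2.1 (collMap x).2.2 * Δ ψ x.1 x.2.1 x.2.2
        ∂collMeasure =
      -∫ x in farSet, kernel B (x.1 - x.2.1) x.2.2 *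
      lossFactor g x.1 x.2.1 x.2.2 * Δ ψ x.1 x.2.1 x.2.2 ∂collMeasure := by
    rw [← integral_indicator hmf (f := fun x : V × V × S2 => kernel B (x.1 - x.2.1) x.2.2 *
      lossFactor g x.1 x.2.1 x.2.2 * Δ ψ x.1 x.2.1 x.2.2), ← integral_collMap,
      integral_congr_ae (Eventually.of_forall fun x => farIntegrand_collMap B g ψ x),
      integral_indicator hmf, integral_neg, neg_neg]
  -- Both parts of `Π_F` give the same value, whence the `2`; the prefactor `-1/4` of the equation
  -- then leaves `1/2 (gain - loss)`.
  have e3 : ∫ x in farSet, kernel B (x.1 - x.2.1) x.2.2 *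
        PiF g x.1 x.2.1 x.2.2 * Δ ψ x.1 x.2.1 x.2.2 ∂collMeasure =
      -(2 * ((gainInt B g ψ).toReal - (lossInt B g ψ).toReal)) := by
    have : ∀ x : V × V × S2, kernel B (x.1 - x.2.1) x.2.2 *
        PiF g x.1 x.2.1 x.2.2 * Δ ψ x.1 x.2.1 x.2.2 = kernel B (x.1 - x.2.1) x.2.2 *
      lossFactor g (collMap x).1 (collMap x).2.1 (collMap x).2.2 * Δ ψ x.1 x.2.1 x.2.2 -
      kernel B (x.1 - x.2.1) x.2.2 *
      lossFactor g x.1 x.2.1 x.2.2 * Δ ψ x.1 x.2.1 x.2.2 := fun x => by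
      rw [PiF_eq_lossFactor]; ring
    simp_rw [this]
    rw [integral_sub hF' hF, e2, e1]; ring
  have e4 : -∫ x in farSetᶜ, kernel B (x.1 - x.2.1) x.2.2 *
        PiF g x.1 x.2.1 x.2.2 * Δ ψ x.1 x.2.1 x.2.2 ∂collMeasure ≤ (nearInt B g ψ).toReal := by
    refine (neg_le_abs _).trans ?_
    have := norm_integral_le_lintegral_norm (μ := collMeasure.restrict farSetᶜ)
      (fun x : V × V × S2 => kernel B (x.1 - x.2.1) x.2.2 *
        PiF g x.1 x.2.1 x.2.2 * Δ ψ x.1 x.2.1 x.2.2)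
    rw [hnear]; exact this
  rw [← integral_add_compl hmf hI, e3]
  linarith

end estimates

/-! ### Joint measurability in time and velocity -/

section joint

variable {f : ℝ → V → ℝ} {B : ℝ → ℝ → ℝ} {q : ℝ → V → V → S2 → ℝ} {μ : Measure ℝ} [SFinite μ]

lemma aemeasurable_joint_comp (hf : AEMeasurable (fun x : ℝ × V => f x.1 x.2) (μ.prod volume))
    {T : V × V × S2 → V} (hT : Measure.QuasiMeasurePreserving T collMeasure volume) :
    AEMeasurable (fun x : ℝ × V × V × S2 => f x.1 (T x.2)) (μ.prod collMeasure) :=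
  hf.comp_quasiMeasurePreserving (QuasiMeasurePreserving.prodMap (Measure.QuasiMeasurePreserving.id μ) hT)

lemma measurable_gam : Measurable fun p : ℝ × ℝ => Gam p.1 p.2 := by
  have h1 : MeasurableSet {p : ℝ × ℝ | p.1 = 0} := measurableSet_eq_fun measurable_fst
    measurable_const
  have h2 : MeasurableSet {p : ℝ × ℝ | p.2 = 0} := measurableSet_eq_fun measurable_snd
    measurable_const
  unfold Gam
  refine Measurable.ite (h1.inter h2) measurable_const
    (Measurable.ite (h1.union h2) measurable_const ?_)
  exact ((measurable_fst.sub measurable_snd).mul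
    (Real.measurable_log.comp (measurable_fst.div measurable_snd))).ennreal_ofReal

lemma aemeasurable_dissipation (hB : Measurable (Function.uncurry B))
    (hf : AEMeasurable (fun x : ℝ × V => f x.1 x.2) (μ.prod volume))
    (hq : AEMeasurable (fun x : ℝ × V × V × S2 => q x.1 x.2.1 x.2.2.1 x.2.2.2)
      (μ.prod collMeasure)) :
    AEMeasurable (fun t => dissipation B (f t) (q t)) μ := by
  have m1 := aemeasurable_joint_comp hf quasiMeasurePreserving_pre
  have m2 := aemeasurable_joint_comp hf quasiMeasurePreserving_preStar
  have m3 := aemeasurable_joint_comp hf quasiMeasurePreserving_post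
  have m4 := aemeasurable_joint_comp hf quasiMeasurePreserving_postStar
  have mk : AEMeasurable (fun x : ℝ × V × V × S2 => kernel B (x.2.1 - x.2.2.1) x.2.2.2)
      (μ.prod collMeasure) := ((measurable_kernel hB).comp measurable_snd).aemeasurable
  have mp := ((m3.mul m4).mul ((m1.const_sub 1).sub m2)).add hq
  have mm := ((m1.mul m2).mul ((m3.const_sub 1).sub m4)).add hq
  exact ((mk.ennreal_ofReal.mul
    (measurable_gam.comp_aemeasurable (mp.prodMk mm))).lintegral_prod_right').const_mul _

lemma aemeasurable_variation (hB : Measurable (Function.uncurry B))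
    (hf : AEMeasurable (fun x : ℝ × V => f x.1 x.2) (μ.prod volume)) {ψ : V → ℝ}
    (hψ : Measurable ψ) :
    AEMeasurable (fun t => ∫⁻ x : V × V × S2, ENNReal.ofReal (kernel B (x.1 - x.2.1) x.2.2 *
      |PiF (f t) x.1 x.2.1 x.2.2| * |Δ ψ x.1 x.2.1 x.2.2|) ∂collMeasure) μ := by
  have m1 := aemeasurable_joint_comp hf quasiMeasurePreserving_pre
  have m2 := aemeasurable_joint_comp hf quasiMeasurePreserving_preStar
  have m3 := aemeasurable_joint_comp hf quasiMeasurePreserving_post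
  have m4 := aemeasurable_joint_comp hf quasiMeasurePreserving_postStar
  have mk : AEMeasurable (fun x : ℝ × V × V × S2 => kernel B (x.2.1 - x.2.2.1) x.2.2.2)
      (μ.prod collMeasure) := ((measurable_kernel hB).comp measurable_snd).aemeasurable
  have md : AEMeasurable (fun x : ℝ × V × V × S2 => Δ ψ x.2.1 x.2.2.1 x.2.2.2)
      (μ.prod collMeasure) := ((measurable_delta hψ).comp measurable_snd).aemeasurable
  have mp := (((m3.mul m4).mul (m1.const_sub 1)).mul (m2.const_sub 1)).sub
    (((m1.mul m2).mul (m3.const_sub 1)).mul (m4.const_sub 1))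
  have mp' := continuous_abs.measurable.comp_aemeasurable mp
  have md' := continuous_abs.measurable.comp_aemeasurable md
  exact ((mk.mul mp').mul md').ennreal_ofReal.lintegral_prod_right'

end joint

lemma aemeasurable_wint {f : ℝ → V → ℝ} {μ : Measure ℝ}
    (hf : AEMeasurable (fun x : ℝ × V => f x.1 x.2) (μ.prod volume))
    {θ : ℝ → ℝ} (hθ : Measurable θ) : AEMeasurable (fun t => wint θ (f t)) μ := by
  have m : Measurable fun x : ℝ × V => θ (en x.2) := hθ.comp (measurable_en.comp measurable_snd)
  exact ((hf.mul m.aemeasurable).ennreal_ofReal).lintegral_prod_right'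

/-! ### Compactly supported test functions -/

lemma isC2b_of_hasCompactSupport {g : V → ℝ} (hg : ContDiff ℝ 2 g) (hc : HasCompactSupport g) :
    IsC2b fun x => g x.2 := by
  have hφ : ContDiff ℝ 2 (g ∘ ContinuousLinearMap.snd ℝ ℝ V) :=
    hg.comp (ContinuousLinearMap.snd ℝ ℝ V).contDiff
  refine ⟨hφ.contDiffOn, fun k hk => ?_⟩
  have hu : UniqueDiffOn ℝ halfSpace := (uniqueDiffOn_Ici 0).prod uniqueDiffOn_univ
  have hk' : (k : WithTop ℕ∞) ≤ 2 := by exact_mod_cast hk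
  obtain ⟨K, hK⟩ := (hg.continuous_iteratedFDeriv hk').bounded_above_of_compact_support
    (hc.iteratedFDeriv k)
  refine ⟨K * ∏ _i : Fin k, ‖ContinuousLinearMap.snd ℝ ℝ V‖, fun x hx => ?_⟩
  have e1 : iteratedFDerivWithin ℝ k (fun x : ℝ × V => g x.2) halfSpace x =
      iteratedFDeriv ℝ k (g ∘ ContinuousLinearMap.snd ℝ ℝ V) x :=
    iteratedFDerivWithin_eq_iteratedFDeriv hu (hφ.of_le hk').contDiffAt hx
  rw [e1, ContinuousLinearMap.iteratedFDeriv_comp_right _ hg _ hk']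
  refine (ContinuousMultilinearMap.norm_compContinuousLinearMap_le _ _).trans ?_
  gcongr
  exact hK _

/-- The truncated weight, corrected by a multiple of the energy so as to have compact support. -/
def testFun (p N : ℝ) (v : V) : ℝ :=
  vwt p N v - slope p N (2 * N) * en v + (slope p N (2 * N) * (2 * N) - wt p N (2 * N))

section testFun

variable {p N : ℝ}

lemma contDiff_en : ContDiff ℝ 2 en := by
  unfold en
  exact contDiff_const.add (contDiff_norm_sq ℝ)

lemma contDiff_testFun (hp : 2 ≤ p) : ContDiff ℝ 2 (testFun p N) :=
  (((contDiff_wt hp).comp contDiff_en).sub (contDiff_const.mul contDiff_en)).add contDiff_const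

lemma hasCompactSupport_testFun (hp : 2 ≤ p) (hN : 0 < N) : HasCompactSupport (testFun p N) := by
  refine HasCompactSupport.intro (K := Metric.closedBall 0 (2 * N + 1))
    (isCompact_closedBall _ _) fun v hv => ?_
  have h1 : 2 * N + 1 < ‖v‖ := by simpa using hv
  have h2 : 2 * N ≤ en v := by unfold en; nlinarith
  rw [testFun, vwt, wt_of_ge hp hN h2]; ring

lemma isC2b_testFun (hp : 2 ≤ p) (hN : 0 < N) : IsC2b fun x => testFun p N x.2 :=
  isC2b_of_hasCompactSupport (contDiff_testFun hp) (hasCompactSupport_testFun hp hN)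

/-- Constants and the energy are collision invariants, so the correction does not change the
increment. -/
lemma delta_testFun (v w : V) (σ : S2) : Δ (testFun p N) v w σ = Δ (vwt p N) v w σ := by
  have := en_post_add v w σ
  unfold Δ testFun
  linear_combination -slope p N (2 * N) * this

lemma wt_le_mul (hp : 2 ≤ p) (hN : 0 < N) {x : ℝ} (hx : 0 ≤ x) :
    wt p N x ≤ slope p N (2 * N) * x := by
  have h1 := wt_le_mul_slope (N := N) hp hx
  have h2 := slope_le_max hp hN x
  nlinarith

end testFun

/-! ### Evolution of truncated moments -/

lemma toReal_wint {g : V → ℝ} (hm : AEMeasurable g) (hg : ∀ u, 0 ≤ g u) {θ : ℝ → ℝ}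
    (hθ : Measurable θ) (hθ0 : ∀ x ≥ 1, 0 ≤ θ x) :
    ∫ v, g v * θ (en v) = (wint θ g).toReal :=
  integral_eq_lintegral_of_nonneg_ae
    (Eventually.of_forall fun v => mul_nonneg (hg v) (hθ0 _ (one_le_en v)))
    (hm.mul (hθ.comp measurable_en).aemeasurable).aestronglyMeasurable

lemma integrable_weight {g : V → ℝ} (hm : AEMeasurable g) (hg : ∀ u, 0 ≤ g u) {θ : ℝ → ℝ}
    (hθ : Measurable θ) (hθ0 : ∀ x ≥ 1, 0 ≤ θ x) (h : wint θ g ≠ ∞) :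
    Integrable fun v => g v * θ (en v) := by
  refine ⟨(hm.mul (hθ.comp measurable_en).aemeasurable).aestronglyMeasurable, ?_⟩
  rw [hasFiniteIntegral_iff_ofReal
    (Eventually.of_forall fun v => mul_nonneg (hg v) (hθ0 _ (one_le_en v)))]
  exact h.lt_top

lemma wint_wt_le {p N : ℝ} (hp : 2 ≤ p) (hN : 0 < N) {g : V → ℝ} (hg : ∀ u, 0 ≤ g u) :
    wint (wt p N) g ≤ ENNReal.ofReal (slope p N (2 * N)) * wint id g := by
  rw [wint, wint, ← lintegral_const_mul' _ _ ENNReal.ofReal_ne_top]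
  refine lintegral_mono fun v => ?_
  rw [← ENNReal.ofReal_mul (slope_nonneg hp (by linarith))]
  refine ENNReal.ofReal_le_ofReal ?_
  have := mul_le_mul_of_nonneg_left (wt_le_mul hp hN (en_pos v).le) (hg v)
  simp only [id]
  linarith

/-- The truncated weight grows linearly in the energy and is not itself an admissible test function.
The equation is applied to `testFun`, and the subtracted multiples of mass and energy, constant in
time, are added back. -/
theorem exists_moment_evolution {bUp : ℝ → ℝ} {γ p N : ℝ} {B : ℝ → ℝ → ℝ} {f₀ : V → ℝ}
    {f : ℝ → V → ℝ} {m₀ M₂ : ℝ} (hB : UpperKernel bUp γ B) (hup : upMass bUp ≠ ∞) (hp : 2 ≤ p)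
    (hN : 0 < N) (hf : IsWeakSolution B f₀ f)
    (hmass : ∀ t ≥ 0, ∫⁻ v, ENNReal.ofReal (f t v) = ENNReal.ofReal m₀)
    (hen : ∀ t ≥ 0, wint id (f t) = ENNReal.ofReal M₂) :
    ∃ Y : ℝ → ℝ, (∀ t ≥ 0, 0 ≤ Y t) ∧ (∀ t ≥ 0, wint (wt p N) (f t) = ENNReal.ofReal (Y t)) ∧
      (∀ T > 0, AbsolutelyContinuousOnInterval Y 0 T) ∧
      ∀ᵐ t ∂((volume : Measure ℝ).restrict (Ici 0)), DifferentiableAt ℝ Y t ∧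
        nearInt B (f t) (vwt p N) ≠ ∞ ∧ lossInt B (f t) (vwt p N) ≠ ∞ ∧
        deriv Y t + 1 / 2 * (lossInt B (f t) (vwt p N)).toReal ≤
          1 / 4 * (nearInt B (f t) (vwt p N)).toReal +
          1 / 2 * (gainInt B (f t) (vwt p N)).toReal := by
  have hm : ∀ t ≥ 0, AEMeasurable (f t) := fun t ht => (hf.memL1_two t ht).1.aemeasurable
  have h0 : ∀ t ≥ 0, ∀ u, 0 ≤ f t u := fun t ht u => (hf.mem_Icc t ht u).1
  have hC := isC2b_testFun hp hN
  have mwt := (continuous_wt (N := N) hp).measurable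
  have nwt : ∀ x ≥ 1, 0 ≤ wt p N x := fun x hx => wt_nonneg hp (by linarith)
  have hfin : ∀ t ≥ 0, wint (wt p N) (f t) ≠ ∞ := fun t ht =>
    ((wint_wt_le hp hN (h0 t ht)).trans_lt (ENNReal.mul_lt_top ENNReal.ofReal_lt_top
      (by rw [hen t ht]; exact ENNReal.ofReal_lt_top))).ne
  set c := slope p N (2 * N) with hc
  set e := c * (2 * N) - wt p N (2 * N) with he
  -- The conserved difference between the moment of `vwt` and that of `testFun`.
  set k := c * (ENNReal.ofReal M₂).toReal - e * (ENNReal.ofReal m₀).toReal with hk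
  have hY : ∀ t ≥ 0, (∫ v, f t v * testFun p N v) + k = (wint (wt p N) (f t)).toReal := by
    intro t ht
    have i1 := integrable_weight (hm t ht) (h0 t ht) mwt nwt (hfin t ht)
    have i2 := integrable_weight (hm t ht) (h0 t ht) measurable_id
      (fun x hx => zero_le_one.trans hx) (by rw [hen t ht]; exact ENNReal.ofReal_ne_top)
    have e1 : wint (fun _ => 1) (f t) = ENNReal.ofReal m₀ := by
      rw [← hmass t ht]; simp [wint]
    have i3 := integrable_weight (hm t ht) (h0 t ht) (measurable_const (a := (1 : ℝ)))
      (fun x hx => zero_le_one) (by rw [e1]; exact ENNReal.ofReal_ne_top)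
    rw [← toReal_wint (hm t ht) (h0 t ht) mwt nwt, hk, ← hen t ht, ← e1,
      ← toReal_wint (hm t ht) (h0 t ht) measurable_id (fun x hx => zero_le_one.trans hx),
      ← toReal_wint (hm t ht) (h0 t ht) (measurable_const (a := (1 : ℝ)))
      (fun x hx => zero_le_one)]
    have e2 : ∀ v, f t v * testFun p N v =
        f t v * wt p N (en v) - c * (f t v * id (en v)) + e * (f t v * 1) := fun v => by
      simp only [testFun, vwt, id, ← hc, ← he]; ring
    simp_rw [e2]
    have i4 := i1.sub (i2.const_mul c)
    simp only [Pi.sub_def] at i4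
    rw [integral_add i4 (i3.const_mul e), integral_sub i1 (i2.const_mul c),
      integral_const_mul, integral_const_mul]
    ring
  refine ⟨fun t => (∫ v, f t v * testFun p N v) + k, fun t ht => ?_, fun t ht => ?_,
    fun T hT => ?_, ?_⟩
  · simp only [hY t ht]; exact ENNReal.toReal_nonneg
  · simp only [hY t ht]; exact (ENNReal.ofReal_toReal (hfin t ht)).symm
  · exact (hf.absolutelyContinuous _ hC T hT).add
      ((LipschitzWith.const k).lipschitzOnWith.absolutelyContinuousOnInterval)
  -- Integrability in time on each `[0, n + 1]` gives an absolutely convergent collision integral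
  -- for almost every `t`; only then does Fubini identify the iterated integral of the equation with
  -- one over `collMeasure`.
  have hae : ∀ᵐ t ∂((volume : Measure ℝ).restrict (Ici 0)),
      ∫⁻ x : V × V × S2, ENNReal.ofReal (kernel B (x.1 - x.2.1) x.2.2 *
        |PiF (f t) x.1 x.2.1 x.2.2| * |Δ (testFun p N) x.1 x.2.1 x.2.2|) ∂collMeasure < ∞ := by
    have mv := aemeasurable_variation hB.meas hf.aemeasurable
      (contDiff_testFun (N := N) hp).continuous.measurable
    have e3 : Ici (0 : ℝ) = ⋃ n : ℕ, Icc 0 (n + 1 : ℝ) := by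
      ext t
      simp only [mem_Ici, mem_iUnion, mem_Icc]
      refine ⟨fun h => ?_, fun ⟨n, h⟩ => h.1⟩
      obtain ⟨n, hn⟩ := exists_nat_ge t
      exact ⟨n, h, by linarith⟩
    rw [e3, ae_restrict_iUnion_iff]
    intro n
    refine ae_lt_top' (mv.mono_measure (Measure.restrict_mono (fun t ht => ht.1) le_rfl)) ?_
    exact (hf.integrable _ hC (n + 1) (by positivity)).ne
  have hpos : ∀ᵐ t ∂((volume : Measure ℝ).restrict (Ici 0)), 0 < t := by
    rw [← Measure.restrict_congr_set Ioi_ae_eq_Ici]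
    exact ae_restrict_mem measurableSet_Ioi
  filter_upwards [hae, hpos, hf.equation _ hC] with t h1 h2 h3
  have h01 := hf.mem_Icc t h2.le
  simp only [delta_testFun] at h1
  have m1 := aemeasurable_pre (hm t h2.le)
  have m2 := aemeasurable_preStar (hm t h2.le)
  have m3 := aemeasurable_post (hm t h2.le)
  have m4 := aemeasurable_postStar (hm t h2.le)
  have mk := (measurable_kernel hB.meas).aemeasurable (μ := collMeasure)
  have md := (measurable_delta (measurable_vwt (N := N) hp)).aemeasurable (μ := collMeasure)
  have hI : Integrable (fun x : V × V × S2 => kernel B (x.1 - x.2.1) x.2.2 *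
      PiF (f t) x.1 x.2.1 x.2.2 * Δ (vwt p N) x.1 x.2.1 x.2.2) collMeasure := by
    refine ⟨((mk.mul ((((m3.mul m4).mul (m1.const_sub 1)).mul (m2.const_sub 1)).sub
      (((m1.mul m2).mul (m3.const_sub 1)).mul (m4.const_sub 1)))).mul md).aestronglyMeasurable, ?_⟩
    rw [hasFiniteIntegral_iff_norm]
    refine lt_of_eq_of_lt (lintegral_congr fun x => ?_) h1
    obtain ⟨v, w, σ⟩ := x
    simp only [Real.norm_eq_abs]
    by_cases hvw : v = w
    · subst hvw; simp [delta_self]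
    · rw [abs_mul, abs_mul, abs_of_nonneg (hB.kernel_nonneg hvw σ)]
  have h4 : HasDerivAt (fun t => (∫ v, f t v * testFun p N v) + k)
      (-(1 / 4) * ∫ x : V × V × S2, kernel B (x.1 - x.2.1) x.2.2 *
        PiF (f t) x.1 x.2.1 x.2.2 * Δ (vwt p N) x.1 x.2.1 x.2.2 ∂collMeasure) t := by
    refine (h3.add_const k).congr_deriv ?_
    have e5 : ∫ v, QWeak B (f t) (fun u => testFun p N u) v =
        ∫ x : V × V × S2, kernel B (x.1 - x.2.1) x.2.2 *
        PiF (f t) x.1 x.2.1 x.2.2 * Δ (vwt p N) x.1 x.2.1 x.2.2 ∂collMeasure := by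
      rw [collMeasure, integral_prod _ hI]
      simp only [QWeak, ← delta_testFun]
    rw [e5]
    simp
  obtain ⟨c1, c2, c3⟩ := neg_integral_collision_le hB hup hp hN (hm t h2.le) h01
    (by rw [hen t h2.le]; exact ENNReal.ofReal_ne_top) hI
  refine ⟨h4.differentiableAt, c1, c2, ?_⟩
  rw [h4.deriv]
  exact c3

/-! ### A comparison principle for absolutely continuous functions -/

lemma abs_exp_neg_sub_exp_neg_le {a b : ℝ} (ha : 0 ≤ a) (hb : 0 ≤ b) :
    |Real.exp (-a) - Real.exp (-b)| ≤ |a - b| := by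
  have key : ∀ {a b : ℝ}, 0 ≤ a → a ≤ b → Real.exp (-a) - Real.exp (-b) ≤ b - a := by
    intro a b ha hab
    have h1 : Real.exp (-b) = Real.exp (-a) * Real.exp (-(b - a)) := by
      rw [← Real.exp_add]; ring_nf
    have h2 := Real.add_one_le_exp (-(b - a))
    have h3 : Real.exp (-a) ≤ 1 := Real.exp_le_one_iff.2 (by linarith)
    have h4 := Real.exp_pos (-a)
    rw [h1]
    nlinarith
  rcases le_total a b with h | h
  · rw [abs_of_nonneg (sub_nonneg.2 (Real.exp_le_exp.2 (by linarith))), abs_sub_comm,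
      abs_of_nonneg (sub_nonneg.2 h)]
    exact key ha h
  · rw [abs_sub_comm, abs_of_nonneg (sub_nonneg.2 (Real.exp_le_exp.2 (by linarith))),
      abs_of_nonneg (sub_nonneg.2 h)]
    exact key hb h

/-- `x ↦ exp (-x)` is `1`-Lipschitz on `[0, ∞)`. -/
lemma absolutelyContinuousOnInterval_exp_neg {P : ℝ → ℝ} {a b : ℝ}
    (hP : AbsolutelyContinuousOnInterval P a b) (h0 : ∀ x ∈ uIcc a b, 0 ≤ P x) :
    AbsolutelyContinuousOnInterval (fun x => Real.exp (-P x)) a b := by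
  rw [absolutelyContinuousOnInterval_iff] at hP ⊢
  intro ε hε
  obtain ⟨δ, hδ, h⟩ := hP ε hε
  refine ⟨δ, hδ, fun E hE hs => (Finset.sum_le_sum fun i hi => ?_).trans_lt (h E hE hs)⟩
  exact abs_exp_neg_sub_exp_neg_le (h0 _ (hE.1 i hi).1) (h0 _ (hE.1 i hi).2)

/-- The integrating factor `exp (-∫₀ᵗ k)`. -/
def decay (k : ℝ → ℝ) (t : ℝ) : ℝ := Real.exp (-∫ u in (0 : ℝ)..t, k u)

lemma decay_pos (k : ℝ → ℝ) (t : ℝ) : 0 < decay k t := Real.exp_pos _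

lemma decay_zero (k : ℝ → ℝ) : decay k 0 = 1 := by simp [decay]

section comparison

variable {Z k h ℓ : ℝ → ℝ} {T : ℝ}

lemma decay_absolutelyContinuous (hT : 0 < T) (hk : IntervalIntegrable k volume 0 T)
    (hk0 : ∀ t, 0 ≤ k t) : AbsolutelyContinuousOnInterval (decay k) 0 T := by
  refine absolutelyContinuousOnInterval_exp_neg
    (hk.absolutelyContinuousOnInterval_intervalIntegral (c := 0) (by simp)) fun x hx => ?_
  rw [uIcc_of_le hT.le] at hx
  exact intervalIntegral.integral_nonneg hx.1 fun u _ => hk0 u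

lemma ae_deriv_decay (hk : IntervalIntegrable k volume 0 T) :
    ∀ᵐ t, t ∈ uIcc 0 T → deriv (decay k) t = -(k t * decay k t) := by
  filter_upwards [hk.ae_hasDerivAt_integral] with t h1 h2
  have := ((h1 h2 0 (by simp)).fun_neg).exp
  have e : decay k = fun x => Real.exp (-∫ u in (0 : ℝ)..x, k u) := rfl
  rw [e, this.deriv]; ring

/-- A differential inequality `Z' + ℓ ≤ k Z + h`, integrated against the integrating factor. -/
theorem exists_comparison (hT : 0 < T) (hZ : AbsolutelyContinuousOnInterval Z 0 T)
    (hZ0 : ∀ t ∈ Icc 0 T, 0 ≤ Z t) (hk : IntervalIntegrable k volume 0 T) (hk0 : ∀ t, 0 ≤ k t)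
    (hh : IntervalIntegrable h volume 0 T) (hh0 : ∀ t, 0 ≤ h t) (hℓ : ∀ t, 0 ≤ ℓ t)
    (hd : ∀ᵐ t ∂(volume.restrict (Ioc 0 T)), deriv Z t + ℓ t ≤ k t * Z t + h t) :
    ∃ r : ℝ → ℝ≥0∞, AEMeasurable r (volume.restrict (Ioc 0 T)) ∧
      (∀ᵐ t ∂(volume.restrict (Ioc 0 T)), ENNReal.ofReal (ℓ t) ≤ r t) ∧
      (∫⁻ t in Ioc 0 T, r t * ENNReal.ofReal (decay k t)) + ENNReal.ofReal (Z T * decay k T) ≤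
        ENNReal.ofReal (Z 0) + ∫⁻ t in Ioc 0 T, ENNReal.ofReal (h t) *
          ENNReal.ofReal (decay k t) := by
  have hE := decay_absolutelyContinuous hT hk hk0
  have hkZ : IntervalIntegrable (fun t => k t * Z t) volume 0 T := hk.mul_continuousOn hZ.continuousOn
  have hρ : IntervalIntegrable (fun t => k t * Z t + h t - deriv Z t) volume 0 T :=
    (hkZ.add hh).sub hZ.intervalIntegrable_deriv
  have hρE := hρ.mul_continuousOn hE.continuousOn
  have hhE := hh.mul_continuousOn hE.continuousOn
  -- The fundamental theorem of calculus for the absolutely continuous product `Z * decay k`.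
  have i0 : ∫ t in (0 : ℝ)..T, (k t * Z t + h t - deriv Z t) * decay k t =
      (∫ t in (0 : ℝ)..T, h t * decay k t) - (Z T * decay k T - Z 0) := by
    have h1 := hZ.integral_deriv_mul_eq_sub hE
    rw [decay_zero, mul_one] at h1
    have h2 : ∫ t in (0 : ℝ)..T, (deriv Z t * decay k t + Z t * deriv (decay k) t) =
        ∫ t in (0 : ℝ)..T, (h t * decay k t - (k t * Z t + h t - deriv Z t) * decay k t) := by
      refine intervalIntegral.integral_congr_ae ?_
      filter_upwards [ae_deriv_decay hk] with t h3 h4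
      rw [h3 (uIoc_subset_uIcc h4)]; ring
    rw [← h1, h2, intervalIntegral.integral_sub hhE hρE]; ring
  have hpos : ∀ᵐ t ∂(volume.restrict (Ioc 0 T)), 0 ≤ k t * Z t + h t - deriv Z t := by
    filter_upwards [hd] with t ht
    linarith [hℓ t]
  -- Measurability of `ℓ` is not assumed. This function dominates it, is measurable, and satisfies
  -- an exact identity, so Fatou's lemma can later be applied to it.
  refine ⟨fun t => ENNReal.ofReal (k t * Z t + h t - deriv Z t), ?_, ?_, ?_⟩
  · exact (hρ.1.aestronglyMeasurable.aemeasurable).ennreal_ofReal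
  · filter_upwards [hd] with t ht
    exact ENNReal.ofReal_le_ofReal (by linarith)
  have e1 : ∫⁻ t in Ioc 0 T, ENNReal.ofReal (k t * Z t + h t - deriv Z t) *
      ENNReal.ofReal (decay k t) =
      ENNReal.ofReal (∫ t in (0 : ℝ)..T, (k t * Z t + h t - deriv Z t) * decay k t) := by
    rw [intervalIntegral.integral_of_le hT.le, ofReal_integral_eq_lintegral_ofReal hρE.1]
    · refine lintegral_congr_ae ?_
      filter_upwards [hpos] with t ht
      rw [ENNReal.ofReal_mul ht]
    · filter_upwards [hpos] with t ht
      exact mul_nonneg ht (decay_pos k t).le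
  have e2 : ∫⁻ t in Ioc 0 T, ENNReal.ofReal (h t) * ENNReal.ofReal (decay k t) =
      ENNReal.ofReal (∫ t in (0 : ℝ)..T, h t * decay k t) := by
    rw [intervalIntegral.integral_of_le hT.le, ofReal_integral_eq_lintegral_ofReal hhE.1]
    · refine lintegral_congr fun t => ?_
      rw [ENNReal.ofReal_mul (hh0 t)]
    · exact Eventually.of_forall fun t => mul_nonneg (hh0 t) (decay_pos k t).le
  have p1 : 0 ≤ ∫ t in (0 : ℝ)..T, (k t * Z t + h t - deriv Z t) * decay k t := by
    rw [intervalIntegral.integral_of_le hT.le]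
    refine integral_nonneg_of_ae ?_
    filter_upwards [hpos] with t ht
    exact mul_nonneg ht (decay_pos k t).le
  have p2 : 0 ≤ ∫ t in (0 : ℝ)..T, h t * decay k t :=
    intervalIntegral.integral_nonneg hT.le fun t _ => mul_nonneg (hh0 t) (decay_pos k t).le
  have p3 := hZ0 0 (left_mem_Icc.2 hT.le)
  have p4 := mul_nonneg (hZ0 T (right_mem_Icc.2 hT.le)) (decay_pos k T).le
  rw [e1, e2, ← ENNReal.ofReal_add p1 p4, ← ENNReal.ofReal_add p3 p2, i0]
  exact ENNReal.ofReal_le_ofReal (by linarith)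

end comparison

/-! ### Pointwise inequalities for the truncated weights -/

section weights

variable {p N γ : ℝ}

/-- Crude form, with the truncated weight on both particles: `γ < 0` is used only through `a ^ ((γ +
4) / 2) ≤ a ^ 2`. It suffices for the estimate that is local in time. -/
lemma near_weight_le (hp : 2 ≤ p) (hN : 0 < N) (hγ : γ ∈ Ico (-4 : ℝ) 0) {a x y : ℝ} (ha : 1 ≤ a)
    (hx : 1 ≤ x) (hy : 1 ≤ y) (hax : a ≤ 2 * x) (hay : a ≤ 2 * y) :
    a ^ ((γ + 4) / 2) * slope p N a ^ 2 ≤ (p * 2 ^ p) ^ 2 * (wt p N x * wt p N y) := by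
  have h1 : a ^ ((γ + 4) / 2) ≤ a ^ 2 := by
    rw [← Real.rpow_natCast]
    exact Real.rpow_le_rpow_of_exponent_le ha (by push_cast; linarith [hγ.2])
  have h2 := mul_slope_le (N := N) hp hN (x := a) (by linarith)
  have h3 := (wt_mono (N := N) hp (by linarith) hax).trans (wt_two_mul_le hp hN (by linarith))
  have h4 := (wt_mono (N := N) hp (by linarith) hay).trans (wt_two_mul_le hp hN (by linarith))
  have h5 := slope_nonneg (N := N) hp (x := a) (by linarith)
  have h6 := wt_nonneg (N := N) hp (x := a) (by linarith)
  have h7 := wt_nonneg (N := N) hp (x := x) (by linarith)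
  calc a ^ ((γ + 4) / 2) * slope p N a ^ 2 ≤ a ^ 2 * slope p N a ^ 2 := by gcongr
    _ = (a * slope p N a) * (a * slope p N a) := by ring
    _ ≤ (p * wt p N a) * (p * wt p N a) := by gcongr
    _ ≤ (p * (2 ^ p * wt p N x)) * (p * (2 ^ p * wt p N y)) := by gcongr
    _ = _ := by ring

/-- Sharp form: one slope is replaced by the full power, giving exactly the exponent `p + γ / 2`
that the loss controls, while the other keeps the truncated weight, to be cancelled by `1 / (Y +
1)`. -/
lemma near_weight_le_rpow (hp : 2 ≤ p) (hN : 0 < N) (hq : 0 ≤ p + γ / 2)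
    {a x y : ℝ} (ha : 1 ≤ a) (hx : 1 ≤ x) (hy : 1 ≤ y) (hax : a ≤ 2 * x) (hay : a ≤ 2 * y) :
    a ^ ((γ + 4) / 2) * slope p N a ^ 2 ≤
      (p * 2 ^ p * 2 ^ (p + γ / 2)) * (x ^ (p + γ / 2) * wt p N y) := by
  have ha0 : 0 < a := by linarith
  have h2 := mul_slope_le (N := N) hp hN ha0.le
  have h4 := (wt_mono (N := N) hp (by linarith) hay).trans (wt_two_mul_le hp hN (by linarith))
  have h5 := slope_nonneg (N := N) hp ha0.le
  have h6 := wt_nonneg (N := N) hp ha0.le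
  have h7 := wt_nonneg (N := N) hp (x := y) (by linarith)
  have h8 := slope_le_rpow (N := N) hp ha0.le
  have h9 : a ^ (p + γ / 2) ≤ (2 * x) ^ (p + γ / 2) := by gcongr
  have e1 : a ^ ((γ + 4) / 2) = a ^ (γ / 2 + 1) * a := by
    rw [← Real.rpow_add_one ha0.ne']; ring_nf
  have e2 : a ^ (γ / 2 + 1) * a ^ (p - 1) = a ^ (p + γ / 2) := by
    rw [← Real.rpow_add ha0]; ring_nf
  calc a ^ ((γ + 4) / 2) * slope p N a ^ 2
      = a ^ (γ / 2 + 1) * slope p N a * (a * slope p N a) := by rw [e1]; ring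
    _ ≤ a ^ (γ / 2 + 1) * a ^ (p - 1) * (p * (2 ^ p * wt p N y)) := by
        gcongr ?_ * ?_
        · gcongr
        · exact h2.trans (by gcongr)
    _ = a ^ (p + γ / 2) * (p * (2 ^ p * wt p N y)) := by rw [e2]
    _ ≤ (2 * x) ^ (p + γ / 2) * (p * (2 ^ p * wt p N y)) := by gcongr
    _ = _ := by rw [Real.mul_rpow (by norm_num) (by linarith)]; ring

lemma gain_weight_le (hp : 2 ≤ p) (hN : 0 < N) (hγ : γ ∈ Ico (-4 : ℝ) 0) {a x y : ℝ}
    (hx : 1 ≤ x) (hy : 1 ≤ y) (ha : 2 * a = x + y) :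
    a ^ (γ / 2) * slope p N (2 * a) * √(x * y) ≤
      (p * 2 ^ (p - 1)) * (wt p N x * y + wt p N y * x) := by
  wlog hxy : x ≤ y generalizing x y
  · have := this hy hx (by linarith) (le_of_not_ge hxy)
    rw [mul_comm y x, add_comm (wt p N y * x)] at this
    exact this
  have h1 : a ^ (γ / 2) ≤ 1 :=
    Real.rpow_le_one_of_one_le_of_nonpos (by linarith) (by linarith [hγ.2])
  have h2 : slope p N (2 * a) ≤ 2 ^ (p - 1) * slope p N y :=
    (slope_mono hp (by linarith)).trans (slope_two_mul_le hp hN (by linarith))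
  have h3 : √(x * y) ≤ y := Real.sqrt_le_iff.2 ⟨by linarith, by nlinarith⟩
  have h4 := mul_slope_le (N := N) hp hN (x := y) (by linarith)
  have h5 := slope_nonneg (N := N) hp (x := y) (by linarith)
  have h6 := wt_nonneg (N := N) hp (x := x) (by linarith)
  have h7 := wt_nonneg (N := N) hp (x := y) (by linarith)
  have h8 := slope_nonneg (N := N) hp (x := 2 * a) (by linarith)
  calc a ^ (γ / 2) * slope p N (2 * a) * √(x * y)
      ≤ 1 * (2 ^ (p - 1) * slope p N y) * y := by gcongr
    _ = 2 ^ (p - 1) * (y * slope p N y) := by ring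
    _ ≤ 2 ^ (p - 1) * (p * wt p N y) := by gcongr
    _ = (p * 2 ^ (p - 1)) * (0 + wt p N y * 1) := by ring
    _ ≤ _ := by gcongr; positivity

/-- If `y` is the larger energy, then `√(x y) ≤ x √y`: the smaller energy pays one full power and
the larger only a half. The resulting exponent lies `1/2` below the one controlled by the loss,
leaving room for interpolation. -/
lemma gain_weight_le_rpow (hp : 2 ≤ p) (hγ : γ ∈ Ico (-4 : ℝ) 0) {a x y : ℝ}
    (hx : 1 ≤ x) (hy : 1 ≤ y) (ha : 2 * a = x + y) :
    a ^ (γ / 2) * slope p N (2 * a) * √(x * y) ≤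
      (4 * 2 ^ (p - 1)) * (x ^ (p + γ / 2 - 1 / 2) * y + y ^ (p + γ / 2 - 1 / 2) * x) := by
  wlog hxy : x ≤ y generalizing x y
  · have := this hy hx (by linarith) (le_of_not_ge hxy)
    rw [mul_comm y x, add_comm (y ^ (p + γ / 2 - 1 / 2) * x)] at this
    exact this
  have hy0 : 0 < y := by linarith
  have h1 : a ^ (γ / 2) ≤ 4 * y ^ (γ / 2) := by
    have e1 : a ^ (γ / 2) ≤ (2⁻¹ * y) ^ (γ / 2) :=
      Real.rpow_le_rpow_of_nonpos (by positivity) (by linarith) (by linarith [hγ.2])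
    have e2 : (2⁻¹ : ℝ) ^ (γ / 2) ≤ 2⁻¹ ^ (-2 : ℝ) :=
      Real.rpow_le_rpow_of_exponent_ge (by norm_num) (by norm_num) (by linarith [hγ.1])
    have e3 : (2⁻¹ : ℝ) ^ (-2 : ℝ) = 4 := by
      rw [show (-2 : ℝ) = -(2 : ℕ) by norm_num, Real.rpow_neg (by norm_num), Real.rpow_natCast]
      norm_num
    rw [Real.mul_rpow (by norm_num) hy0.le] at e1
    refine e1.trans ?_
    gcongr
    exact e2.trans_eq e3
  have h2 : slope p N (2 * a) ≤ 2 ^ (p - 1) * y ^ (p - 1) := by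
    refine (slope_mono hp (by linarith)).trans
      ((slope_le_rpow (x := 2 * y) hp (by linarith)).trans_eq ?_)
    rw [Real.mul_rpow (by norm_num) hy0.le]
  have h3 : √(x * y) ≤ x * y ^ (1 / 2 : ℝ) := by
    rw [← Real.sqrt_eq_rpow, Real.sqrt_mul (by linarith)]
    gcongr
    exact Real.sqrt_le_iff.2 ⟨by linarith, by nlinarith⟩
  have h8 := slope_nonneg (N := N) hp (x := 2 * a) (by linarith)
  have h9 : 0 ≤ x ^ (p + γ / 2 - 1 / 2) * y := by positivity
  have e : y ^ (γ / 2) * y ^ (p - 1) * y ^ (1 / 2 : ℝ) = y ^ (p + γ / 2 - 1 / 2) := by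
    rw [← Real.rpow_add hy0, ← Real.rpow_add hy0]; ring_nf
  calc a ^ (γ / 2) * slope p N (2 * a) * √(x * y)
      ≤ (4 * y ^ (γ / 2)) * (2 ^ (p - 1) * y ^ (p - 1)) * (x * y ^ (1 / 2 : ℝ)) := by gcongr
    _ = (4 * 2 ^ (p - 1)) * (y ^ (γ / 2) * y ^ (p - 1) * y ^ (1 / 2 : ℝ) * x) := by ring
    _ = (4 * 2 ^ (p - 1)) * (0 + y ^ (p + γ / 2 - 1 / 2) * x) := by rw [e, zero_add]
    _ ≤ _ := by gcongr

/-- Interpolation between a power and a lower one. -/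
lemma exists_rpow_sub_half_le {q ε : ℝ} (hq : 1 ≤ q) (hε : 0 < ε) :
    ∃ C ≥ 0, ∀ x ≥ (1 : ℝ), x ^ (q - 1 / 2) ≤ ε * x ^ q + C := by
  refine ⟨(max 1 (1 / ε ^ 2)) ^ (q - 1 / 2), by positivity, fun x hx => ?_⟩
  have hx0 : 0 < x := by linarith
  rcases le_total x (max 1 (1 / ε ^ 2)) with h | h
  · have : x ^ (q - 1 / 2) ≤ (max 1 (1 / ε ^ 2)) ^ (q - 1 / 2) :=
      Real.rpow_le_rpow hx0.le h (by linarith)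
    have : 0 ≤ ε * x ^ q := by positivity
    linarith
  · have h1 : 1 / ε ^ 2 ≤ x := (le_max_right _ _).trans h
    have h2 : 1 ≤ ε * √x := by
      have : 1 / ε ≤ √x := Real.le_sqrt_of_sq_le (by rw [div_pow, one_pow]; exact h1)
      rwa [div_le_iff₀' hε] at this
    have e : x ^ q = x ^ (q - 1 / 2) * √x := by
      rw [Real.sqrt_eq_rpow, ← Real.rpow_add hx0]; ring_nf
    have h3 : 0 < x ^ (q - 1 / 2) := by positivity
    have h4 : 0 ≤ (max 1 (1 / ε ^ 2)) ^ (q - 1 / 2) := by positivity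
    rw [e]
    nlinarith

end weights

/-! ### Bounds for the collision terms at a fixed time -/

section fixedTime

variable {bUp : ℝ → ℝ} {γ : ℝ} {B : ℝ → ℝ → ℝ} {g : V → ℝ} {q : V → V → S2 → ℝ} {p N : ℝ}

lemma toReal_nearInt_le (hB : UpperKernel bUp γ B) (hp : 2 ≤ p) (hN : 0 < N)
    (hgq : EntropyPair g q) {θ : ℝ → ℝ} (hθ : Measurable θ) {K η A m Y : ℝ} (hη : 0 < η)
    (hK : 0 ≤ K) (hθ0 : ∀ x ≥ 1, 0 ≤ θ x)
    (hw : ∀ a x y, 1 ≤ a → 1 ≤ x → 1 ≤ y → a ≤ 2 * x → a ≤ 2 * y →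
      a ^ ((γ + 4) / 2) * slope p N a ^ 2 ≤ K * (θ x * wt p N y))
    (hA : upMass bUp = ENNReal.ofReal A) (hA0 : 0 ≤ A) (hm : wint θ g = ENNReal.ofReal m)
    (hm0 : 0 ≤ m) (hY : wint (wt p N) g = ENNReal.ofReal Y) (hY0 : 0 ≤ Y)
    (hD : dissipation B g q ≠ ∞) :
    (nearInt B g (vwt p N)).toReal ≤ 1 / η * (dissipation B g q).toReal +
      η * ((p * 2 ^ (p + 2)) ^ 2 * K) * (A * (m * Y)) := by
  have h := nearInt_le hB hp hN hgq hθ hη hK hθ0 hw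
  rw [hA, hm, hY, ← ENNReal.ofReal_toReal hD, ← ENNReal.ofReal_mul hm0, ← ENNReal.ofReal_mul hA0,
    ← ENNReal.ofReal_mul (by positivity), ← ENNReal.ofReal_mul (by positivity),
    ← ENNReal.ofReal_add (by positivity) (by positivity)] at h
  exact ENNReal.toReal_le_of_le_ofReal (by positivity) h

lemma toReal_gainInt_le (hB : UpperKernel bUp γ B) (hp : 2 ≤ p) (hgm : AEMeasurable g)
    (hg : ∀ u, g u ∈ Icc (0 : ℝ) 1) {θ : ℝ → ℝ} (hθ : Measurable θ) {K A m M₂ : ℝ} (hK : 0 ≤ K)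
    (hθ0 : ∀ x ≥ 1, 0 ≤ θ x)
    (hw : ∀ a x y, 1 ≤ x → 1 ≤ y → 2 * a = x + y →
      a ^ (γ / 2) * slope p N (2 * a) * √(x * y) ≤ K * (θ x * y + θ y * x))
    (hA : upMass bUp = ENNReal.ofReal A) (hA0 : 0 ≤ A) (hm : wint θ g = ENNReal.ofReal m)
    (hm0 : 0 ≤ m) (hM : wint id g = ENNReal.ofReal M₂) (hM0 : 0 ≤ M₂) :
    (gainInt B g (vwt p N)).toReal ≤ 32 * K * (A * (m * M₂)) := by
  have h := gainInt_le hB hp hgm hg hθ hK hθ0 hw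
  rw [hA, hm, hM, ← ENNReal.ofReal_mul hm0, ← ENNReal.ofReal_mul hA0,
    ← ENNReal.ofReal_mul (by positivity)] at h
  exact ENNReal.toReal_le_of_le_ofReal (by positivity) h

/-- The growth of a truncated moment is at most linear in the moment itself. -/
theorem collision_le_self (hB : UpperKernel bUp γ B) (hp : 2 ≤ p) (hN : 0 < N)
    (hgq : EntropyPair g q) {A Y M₂ : ℝ} (hA : upMass bUp = ENNReal.ofReal A) (hA0 : 0 ≤ A)
    (hY : wint (wt p N) g = ENNReal.ofReal Y) (hY0 : 0 ≤ Y) (hM : wint id g = ENNReal.ofReal M₂)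
    (hM0 : 0 ≤ M₂) (hD : dissipation B g q ≠ ∞) :
    1 / 4 * (nearInt B g (vwt p N)).toReal + 1 / 2 * (gainInt B g (vwt p N)).toReal ≤
      ((dissipation B g q).toReal / 4 + ((p * 2 ^ (p + 2)) ^ 2 * (p * 2 ^ p) ^ 2 * A +
        16 * (p * 2 ^ (p - 1)) * A * M₂)) * (Y + 1) := by
  have hZ : 0 < Y + 1 := by linarith
  have nwt : ∀ x ≥ 1, 0 ≤ wt p N x := fun x hx => wt_nonneg hp (by linarith)
  have mwt := (continuous_wt (N := N) hp).measurable
  -- With `η = 1 / (Y + 1)` the entropy term is multiplied by `Y + 1`, and the quadratic term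
  -- becomes `Y ^ 2 / (Y + 1) ≤ Y + 1`.
  have h1 := toReal_nearInt_le hB hp hN hgq mwt (η := 1 / (Y + 1)) (by positivity) (by positivity)
    nwt (fun a x y => near_weight_le hp hN hB.exponent) hA hA0 hY hY0 hY hY0 hD
  have h2 := toReal_gainInt_le hB hp hgq.meas hgq.mem mwt (K := p * 2 ^ (p - 1)) (by positivity)
    nwt (fun a x y => gain_weight_le hp hN hB.exponent) hA hA0 hY hY0 hM hM0
  set D := (dissipation B g q).toReal
  have h3 : 1 / (Y + 1) * ((p * 2 ^ (p + 2)) ^ 2 * (p * 2 ^ p) ^ 2) * (A * (Y * Y)) ≤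
      ((p * 2 ^ (p + 2)) ^ 2 * (p * 2 ^ p) ^ 2) * A * (Y + 1) := by
    have : 1 / (Y + 1) * (Y * Y) ≤ Y + 1 := by
      rw [one_div, inv_mul_le_iff₀ hZ]; nlinarith
    calc _ = ((p * 2 ^ (p + 2)) ^ 2 * (p * 2 ^ p) ^ 2) * A * (1 / (Y + 1) * (Y * Y)) := by ring
      _ ≤ _ := by gcongr
  rw [one_div_one_div] at h1
  have h4 : 0 ≤ ((p * 2 ^ (p + 2)) ^ 2 * (p * 2 ^ p) ^ 2) * A * (Y + 1) := by positivity
  have h5 : 0 ≤ 16 * (p * 2 ^ (p - 1)) * A * M₂ := by positivity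
  nlinarith

/-- The growth of a truncated moment of order `p` is controlled by the entropy production and by
an arbitrarily small multiple of the moment of order `p + γ / 2`. -/
theorem exists_collision_le {A m₀ M₂ κ : ℝ} (hA0 : 0 ≤ A) (hm₀ : 0 ≤ m₀) (hM0 : 0 ≤ M₂)
    (hp : 2 ≤ p) (hpγ : 1 ≤ p + γ / 2) (hκ : 0 < κ) :
    ∃ ε > 0, ∃ C ≥ 0, ∀ (bUp : ℝ → ℝ) (B : ℝ → ℝ → ℝ) (g : V → ℝ) (q : V → V → S2 → ℝ)
      (N Y m : ℝ), UpperKernel bUp γ B → upMass bUp = ENNReal.ofReal A → 0 < N →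
      EntropyPair g q → ∫⁻ u, ENNReal.ofReal (g u) = ENNReal.ofReal m₀ →
      wint id g = ENNReal.ofReal M₂ → wint (wt p N) g = ENNReal.ofReal Y → 0 ≤ Y →
      wint (fun x => x ^ (p + γ / 2)) g = ENNReal.ofReal m → 0 ≤ m → dissipation B g q ≠ ∞ →
      1 / 4 * (nearInt B g (vwt p N)).toReal + 1 / 2 * (gainInt B g (vwt p N)).toReal ≤
        (dissipation B g q).toReal / (4 * ε) * (Y + 1) + (κ * m + C) := by
  set K₁ := (p * 2 ^ (p + 2)) ^ 2 * (p * 2 ^ p * 2 ^ (p + γ / 2)) with hK₁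
  set K₂ := 16 * (4 * 2 ^ (p - 1)) * A * M₂ with hK₂
  have hK₁0 : 0 ≤ K₁ := by positivity
  have hK₂0 : 0 ≤ K₂ := by positivity
  -- `ε` makes the quadratic part of the close collisions at most `κ / 2 * m`; `δ`, the
  -- interpolation parameter, leaves another `κ / 2 * m` from the gain.
  set ε := 2 * κ / (K₁ * A + 1) with hε
  set δ := κ / (2 * (K₂ + 1)) with hδ
  have hε0 : 0 < ε := by positivity
  have hδ0 : 0 < δ := by positivity
  obtain ⟨C, hC0, hC⟩ := exists_rpow_sub_half_le hpγ hδ0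
  refine ⟨ε, hε0, K₂ * (C * m₀), by positivity, ?_⟩
  intro bUp B g q N Y m hB hA hN hgq hmass hM hY hY0 hm hm0 hD
  have hZ : 0 < Y + 1 := by linarith
  have pow0 : ∀ r : ℝ, ∀ x ≥ (1 : ℝ), 0 ≤ x ^ r := fun r x hx => Real.rpow_nonneg (by linarith) _
  have mpow : ∀ r : ℝ, Measurable fun x : ℝ => x ^ r := fun r => measurable_id.pow_const r
  have h1 := toReal_nearInt_le hB hp hN hgq (mpow (p + γ / 2)) (η := ε / (Y + 1)) (by positivity)
    (by positivity) (pow0 _) (fun a x y => near_weight_le_rpow hp hN (by linarith))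
    hA hA0 hm hm0 hY hY0 hD
  have hlow : wint (fun x => x ^ (p + γ / 2 - 1 / 2)) g ≤
      ENNReal.ofReal (δ * m + C * m₀) := by
    rw [ENNReal.ofReal_add (by positivity) (by positivity), ENNReal.ofReal_mul hδ0.le,
      ENNReal.ofReal_mul hC0, ← hm, ← hmass, wint, wint,
      ← lintegral_const_mul' _ _ ENNReal.ofReal_ne_top,
      ← lintegral_const_mul' _ _ ENNReal.ofReal_ne_top,
      ← lintegral_add_right' _ (hgq.meas.ennreal_ofReal.const_mul _)]
    refine lintegral_mono fun v => ?_
    have hv := (hgq.mem v).1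
    rw [← ENNReal.ofReal_mul hδ0.le, ← ENNReal.ofReal_mul hC0,
      ← ENNReal.ofReal_add (mul_nonneg hδ0.le (mul_nonneg hv (pow0 _ _ (one_le_en v))))
        (by positivity)]
    refine ENNReal.ofReal_le_ofReal ?_
    have := mul_le_mul_of_nonneg_left (hC _ (one_le_en v)) hv
    linarith
  set m' := (wint (fun x => x ^ (p + γ / 2 - 1 / 2)) g).toReal
  have hm' : wint (fun x => x ^ (p + γ / 2 - 1 / 2)) g = ENNReal.ofReal m' :=
    (ENNReal.ofReal_toReal (hlow.trans_lt ENNReal.ofReal_lt_top).ne).symm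
  have hm'0 : 0 ≤ m' := ENNReal.toReal_nonneg
  have hm'1 : m' ≤ δ * m + C * m₀ := ENNReal.toReal_le_of_le_ofReal (by positivity) hlow
  have h2 := toReal_gainInt_le hB hp hgq.meas hgq.mem (N := N) (mpow (p + γ / 2 - 1 / 2))
    (K := 4 * 2 ^ (p - 1)) (by positivity) (pow0 _)
    (fun a x y => gain_weight_le_rpow hp hB.exponent) hA hA0 hm' hm'0 hM hM0
  set D := (dissipation B g q).toReal
  have e1 : 1 / 4 * (1 / (ε / (Y + 1)) * D) = D / (4 * ε) * (Y + 1) := by field_simp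
  have e2 : 1 / 4 * (ε / (Y + 1) * K₁ * (A * (m * Y))) ≤ κ / 2 * m := by
    have h3 : Y / (Y + 1) ≤ 1 := by rw [div_le_one hZ]; linarith
    have h4 : ε * (K₁ * A) ≤ 2 * κ := by
      rw [hε, div_mul_eq_mul_div, div_le_iff₀ (by positivity)]
      nlinarith [mul_nonneg hK₁0 hA0]
    calc 1 / 4 * (ε / (Y + 1) * K₁ * (A * (m * Y))) =
        1 / 4 * ((ε * (K₁ * A)) * m * (Y / (Y + 1))) := by ring
      _ ≤ 1 / 4 * (2 * κ * m * 1) := by gcongr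
      _ = _ := by ring
  have e3 : 1 / 2 * (32 * (4 * 2 ^ (p - 1)) * (A * (m' * M₂))) ≤
      κ / 2 * m + K₂ * (C * m₀) := by
    have h4 : K₂ * δ ≤ κ / 2 := by
      rw [hδ, ← mul_div_assoc, div_le_iff₀ (by positivity)]
      nlinarith
    calc 1 / 2 * (32 * (4 * 2 ^ (p - 1)) * (A * (m' * M₂))) = K₂ * m' := by rw [hK₂]; ring
      _ ≤ K₂ * (δ * m + C * m₀) := by gcongr
      _ = K₂ * δ * m + K₂ * (C * m₀) := by ring
      _ ≤ _ := by gcongr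
  nlinarith

end fixedTime

/-! ### Removing the truncation -/

section limit

variable {p : ℝ}

lemma tendsto_wt (hp : 2 ≤ p) {x : ℝ} (hx : 0 ≤ x) :
    ∀ᶠ n : ℕ in atTop, wt p (n + 1) x = x ^ p / (p * (p - 1)) := by
  obtain ⟨n₀, hn₀⟩ := exists_nat_ge x
  filter_upwards [eventually_ge_atTop n₀] with n hn
  have : (n₀ : ℝ) ≤ n := by exact_mod_cast hn
  exact wt_of_le hp (by positivity) hx (by linarith)

/-- At each point the truncated weight is eventually equal to the normalized power, so Fatou's lemma
applies. -/
lemma wint_rpow_le_liminf (hp : 2 ≤ p) {g : V → ℝ} (hg : AEMeasurable g) :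
    ENNReal.ofReal (1 / (p * (p - 1))) * wint (fun x => x ^ p) g ≤
      liminf (fun n : ℕ => wint (wt p (n + 1)) g) atTop := by
  have hpp : 0 ≤ 1 / (p * (p - 1)) := by
    have : 0 < p - 1 := by linarith
    positivity
  rw [wint, ← lintegral_const_mul' _ _ ENNReal.ofReal_ne_top]
  refine le_trans (le_of_eq (lintegral_congr fun v => ?_)) (lintegral_liminf_le' fun n =>
    aemeasurable_weight hg (continuous_wt hp).measurable)
  refine (Tendsto.liminf_eq (tendsto_const_nhds.congr' ?_)).symm
  filter_upwards [tendsto_wt hp (en_pos v).le] with n hn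
  rw [hn, ← ENNReal.ofReal_mul hpp]
  ring_nf

/-- Fatou's lemma again: `ENNReal.ofReal` keeps only the decrease of the weight, so no domination
uniform in the truncation is needed. -/
lemma lossInt_pwt_le_liminf (hp : 2 ≤ p) {B : ℝ → ℝ → ℝ} (hB : Measurable (Function.uncurry B))
    {g : V → ℝ} (hg : AEMeasurable g) :
    ENNReal.ofReal (1 / (p * (p - 1))) * lossInt B g (pwt p) ≤
      liminf (fun n : ℕ => lossInt B g (vwt p (n + 1))) atTop := by
  have hpp : 0 ≤ 1 / (p * (p - 1)) := by
    have : 0 < p - 1 := by linarith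
    positivity
  have mk := (measurable_kernel hB).aemeasurable (μ := collMeasure)
  rw [lossInt, ← lintegral_const_mul' _ _ ENNReal.ofReal_ne_top]
  refine le_trans (le_of_eq (lintegral_congr fun x => ?_)) (lintegral_liminf_le' fun n =>
    ((mk.mul (aemeasurable_lossFactor hg)).mul
      (measurable_delta (measurable_vwt hp)).aemeasurable.neg).ennreal_ofReal.restrict)
  obtain ⟨v, w, σ⟩ := x
  refine (Tendsto.liminf_eq (tendsto_const_nhds.congr' ?_)).symm
  filter_upwards [tendsto_wt hp (en_pos v).le, tendsto_wt hp (en_pos w).le,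
    tendsto_wt hp (en_pos (post v w σ)).le, tendsto_wt hp (en_pos (postStar v w σ)).le]
    with n h1 h2 h3 h4
  simp only [Δ, vwt, pwt, h1, h2, h3, h4]
  rw [← ENNReal.ofReal_mul hpp]
  ring_nf

end limit

/-! ### The entropy -/

/-- The part in `1 - g` is at most `g`; the other comes from `log x ≤ x - 1` at `x = exp (-e) / g`.
Taking for `e` the energy bounds the entropy by energy plus a Gaussian integral. -/
lemma entropy_integrand_le {g : ℝ} (hg : g ∈ Icc (0 : ℝ) 1) {e : ℝ} :
    -(1 - g) * Real.log (1 - g) - g * Real.log g ≤ g * e + Real.exp (-e) := by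
  obtain ⟨h0, h1⟩ := hg
  have a1 : -(1 - g) * Real.log (1 - g) ≤ g := by
    rcases h1.eq_or_lt with h | h
    · simp [h]
    · have := Real.one_sub_inv_le_log_of_pos (show 0 < 1 - g by linarith)
      have h2 : (1 - g) * (1 - (1 - g)⁻¹) = -g := by
        have : (1 - g) ≠ 0 := by linarith
        field_simp; ring
      nlinarith
  have a2 : -(g * Real.log g) ≤ g * e + Real.exp (-e) - g := by
    rcases h0.eq_or_lt with h | h
    · simp [← h, Real.exp_nonneg]
    · have h3 := Real.log_le_sub_one_of_pos (show 0 < Real.exp (-e) / g by positivity)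
      rw [Real.log_div (Real.exp_ne_zero _) h.ne', Real.log_exp] at h3
      have h4 := mul_le_mul_of_nonneg_left h3 h.le
      have h5 : g * (Real.exp (-e) / g - 1) = Real.exp (-e) - g := by field_simp
      linarith
  linarith

/-- The integral of the Gaussian `exp (-(1 + |v|²))`. -/
def gaussMass : ℝ≥0∞ := ∫⁻ v : V, ENNReal.ofReal (Real.exp (-en v))

lemma gaussMass_ne_top : gaussMass ≠ ∞ := by
  have h := (GaussianFourier.integrable_cexp_neg_mul_sq_norm_add (V := V) (b := 1) (by simp) 0 0).norm
  have h2 : Integrable fun v : V => Real.exp (-en v) := by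
    refine h.mono' (by unfold en; fun_prop) (Eventually.of_forall fun v => ?_)
    rw [Real.norm_eq_abs, abs_of_pos (Real.exp_pos _), Complex.norm_exp]
    refine Real.exp_le_exp.2 ?_
    unfold en
    simp [← Complex.ofReal_pow]
  have h3 := h2.2
  rw [hasFiniteIntegral_iff_ofReal (Eventually.of_forall fun v => Real.exp_nonneg _)] at h3
  exact h3.ne

lemma entropy_le {g : V → ℝ} (hm : AEMeasurable g) (hg : ∀ u, g u ∈ Icc (0 : ℝ) 1) :
    entropy g ≤ wint id g + gaussMass := by
  rw [wint, gaussMass, entropy, ← lintegral_add_left' (aemeasurable_weight hm measurable_id)]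
  refine lintegral_mono fun v => ?_
  have := (hg v).1
  have := en_pos v
  rw [← ENNReal.ofReal_add (by simp only [id]; positivity) (Real.exp_nonneg _)]
  exact ENNReal.ofReal_le_ofReal (entropy_integrand_le (hg v))

/-- A conservative weak solution with finite total entropy production. -/
structure Trajectory (bUp : ℝ → ℝ) (γ : ℝ) (B : ℝ → ℝ → ℝ) (f₀ : V → ℝ) (f : ℝ → V → ℝ)
    (q : ℝ → V → V → S2 → ℝ) (A m₀ M₂ S : ℝ) : Prop where
  kernel : UpperKernel bUp γ B
  up : upMass bUp = ENNReal.ofReal A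
  sol : IsWeakSolution B f₀ f
  meas_diss : AEMeasurable (fun t => dissipation B (f t) (q t)) (volume.restrict (Ici 0))
  pair : ∀ t ≥ 0, EntropyPair (f t) (q t)
  mass : ∀ t ≥ 0, ∫⁻ v, ENNReal.ofReal (f t v) = ENNReal.ofReal m₀
  energy : ∀ t ≥ 0, wint id (f t) = ENNReal.ofReal M₂
  diss : ∀ t ≥ 0, ∫⁻ τ in Icc 0 t, dissipation B (f τ) (q τ) ≤ ENNReal.ofReal S

/-! ### A priori finiteness of moments on bounded time intervals. -/

section trajectory

variable {bUp : ℝ → ℝ} {γ p : ℝ} {B : ℝ → ℝ → ℝ} {f₀ : V → ℝ} {f : ℝ → V → ℝ}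
  {q : ℝ → V → V → S2 → ℝ} {A m₀ M₂ S mₛ : ℝ}

namespace Trajectory

lemma restrict_Ioc_le (T : ℝ) :
    (volume : Measure ℝ).restrict (Ioc 0 T) ≤ volume.restrict (Ici 0) :=
  Measure.restrict_mono (fun _ ht => ht.1.le) le_rfl

lemma diss_Ioc (h : Trajectory bUp γ B f₀ f q A m₀ M₂ S) {T : ℝ} (hT : 0 ≤ T) :
    ∫⁻ τ in Ioc 0 T, dissipation B (f τ) (q τ) ≤ ENNReal.ofReal S :=
  (lintegral_mono_set Ioc_subset_Icc_self).trans (h.diss T hT)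

lemma ae_diss (h : Trajectory bUp γ B f₀ f q A m₀ M₂ S) {T : ℝ} (hT : 0 ≤ T) :
    ∀ᵐ t ∂(volume.restrict (Ioc 0 T)), dissipation B (f t) (q t) ≠ ∞ := by
  filter_upwards [ae_lt_top' (h.meas_diss.mono_measure (restrict_Ioc_le T))
    ((h.diss_Ioc hT).trans_lt ENNReal.ofReal_lt_top).ne] with t ht using ht.ne

lemma integrable_diss (h : Trajectory bUp γ B f₀ f q A m₀ M₂ S) {T : ℝ} (hT : 0 ≤ T) :
    IntervalIntegrable (fun t => (dissipation B (f t) (q t)).toReal) volume 0 T := by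
  rw [intervalIntegrable_iff_integrableOn_Ioc_of_le hT]
  exact integrable_toReal_of_lintegral_ne_top (h.meas_diss.mono_measure (restrict_Ioc_le T))
    ((h.diss_Ioc hT).trans_lt ENNReal.ofReal_lt_top).ne

lemma integral_diss_le (h : Trajectory bUp γ B f₀ f q A m₀ M₂ S) (hS : 0 ≤ S) {T : ℝ}
    (hT : 0 ≤ T) : ∫ t in (0 : ℝ)..T, (dissipation B (f t) (q t)).toReal ≤ S := by
  rw [intervalIntegral.integral_of_le hT, integral_toReal
    (h.meas_diss.mono_measure (restrict_Ioc_le T)) ((h.ae_diss hT).mono fun t ht => ht.lt_top)]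
  exact ENNReal.toReal_le_of_le_ofReal hS (h.diss_Ioc hT)

lemma aemeasurable_moment (h : Trajectory bUp γ B f₀ f q A m₀ M₂ S) {θ : ℝ → ℝ}
    (hθ : Measurable θ) (T : ℝ) :
    AEMeasurable (fun t => wint θ (f t)) (volume.restrict (Ioc 0 T)) :=
  (aemeasurable_wint h.sol.aemeasurable hθ).mono_measure (restrict_Ioc_le T)

lemma wint_wt_zero_le (h : Trajectory bUp γ B f₀ f q A m₀ M₂ S) (hp : 2 ≤ p) (N : ℝ)
    (h0 : wint (fun x => x ^ p) (f 0) ≤ ENNReal.ofReal mₛ) :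
    wint (wt p N) (f 0) ≤ ENNReal.ofReal mₛ := by
  refine le_trans (lintegral_mono fun v => ENNReal.ofReal_le_ofReal ?_) h0
  exact mul_le_mul_of_nonneg_left (wt_le_rpow hp (en_pos v).le) ((h.pair 0 le_rfl).mem v).1

/-- Propagation of moments, locally in time. -/
theorem exists_moment_bound (h : Trajectory bUp γ B f₀ f q A m₀ M₂ S) (hp : 2 ≤ p) (hA : 0 ≤ A)
    (hM₂ : 0 ≤ M₂) (hS : 0 ≤ S) (hmₛ : 0 ≤ mₛ)
    (h0 : wint (fun x => x ^ p) (f 0) ≤ ENNReal.ofReal mₛ) (T : ℝ) :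
    ∃ K : ℝ, 0 ≤ K ∧ ∀ t ∈ Ioc 0 T, wint (fun x => x ^ p) (f t) ≤ ENNReal.ofReal K := by
  set C := (p * 2 ^ (p + 2)) ^ 2 * (p * 2 ^ p) ^ 2 * A + 16 * (p * 2 ^ (p - 1)) * A * M₂ with hC
  have hC0 : 0 ≤ C := by positivity
  set k : ℝ → ℝ := fun t => (dissipation B (f t) (q t)).toReal / 4 + C with hk
  have hk0 : ∀ t, 0 ≤ k t := fun t => by positivity
  have hpp : 0 < p * (p - 1) := mul_pos (by linarith) (by linarith)
  refine ⟨p * (p - 1) * ((mₛ + 1) * Real.exp (S / 4 + C * T)), by positivity, fun t ht => ?_⟩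
  have hki : IntervalIntegrable k volume 0 t :=
    ((h.integrable_diss ht.1.le).div_const 4).add intervalIntegrable_const
  have hkS : ∫ u in (0 : ℝ)..t, k u ≤ S / 4 + C * T := by
    rw [hk, intervalIntegral.integral_add ((h.integrable_diss ht.1.le).div_const 4)
      intervalIntegrable_const, intervalIntegral.integral_div, intervalIntegral.integral_const,
      smul_eq_mul, sub_zero, mul_comm t]
    have := h.integral_diss_le hS ht.1.le
    have := mul_le_mul_of_nonneg_left ht.2 hC0
    gcongr
  have key : ∀ n : ℕ, wint (wt p (n + 1)) (f t) ≤
      ENNReal.ofReal ((mₛ + 1) * Real.exp (S / 4 + C * T)) := by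
    intro n
    have hN : (0 : ℝ) < n + 1 := by positivity
    obtain ⟨Y, hY0, hY, hYac, hYd⟩ := exists_moment_evolution (m₀ := m₀) (M₂ := M₂) h.kernel
      (by rw [h.up]; exact ENNReal.ofReal_ne_top) hp hN h.sol h.mass h.energy
    -- The loss is discarded here, so the resulting bound grows exponentially in `T`.
    have hd : ∀ᵐ τ ∂(volume.restrict (Ioc 0 t)),
        deriv (fun τ => Y τ + 1) τ + 0 ≤ k τ * (Y τ + 1) + 0 := by
      filter_upwards [ae_mono (restrict_Ioc_le t) hYd, h.ae_diss ht.1.le,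
        ae_restrict_mem measurableSet_Ioc] with τ ⟨_, _, _, h1⟩ h2 h3
      have h4 := collision_le_self h.kernel hp hN (h.pair τ h3.1.le) h.up hA (hY τ h3.1.le)
        (hY0 τ h3.1.le) (h.energy τ h3.1.le) hM₂ h2
      rw [deriv_add_const]
      have h5 : 0 ≤ 1 / 2 * (lossInt B (f τ) (vwt p (n + 1))).toReal := by positivity
      simp only [hk]
      linarith
    have hac : AbsolutelyContinuousOnInterval (fun τ => Y τ + 1) 0 t :=
      (hYac t ht.1).add ((LipschitzWith.const (1 : ℝ)).lipschitzOnWith.absolutelyContinuousOnInterval)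
    obtain ⟨r, -, -, hr⟩ := exists_comparison (ℓ := fun _ => 0) (h := fun _ => 0) ht.1 hac
      (fun τ hτ => add_nonneg (hY0 τ hτ.1) zero_le_one) hki hk0 intervalIntegrable_const
      (fun _ => le_rfl) (fun _ => le_rfl) hd
    simp only [ENNReal.ofReal_zero, zero_mul, lintegral_zero, add_zero] at hr
    have h6 : ENNReal.ofReal ((Y t + 1) * decay k t) ≤ ENNReal.ofReal (Y 0 + 1) :=
      le_add_self.trans hr
    have h7 := (ENNReal.ofReal_le_ofReal_iff (by linarith [hY0 0 le_rfl])).1 h6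
    have h8 : Y 0 ≤ mₛ := by
      have := h.wint_wt_zero_le hp (n + 1) h0
      rw [hY 0 le_rfl] at this
      exact (ENNReal.ofReal_le_ofReal_iff hmₛ).1 this
    rw [hY t ht.1.le]
    refine ENNReal.ofReal_le_ofReal ?_
    have h9 : decay k t * Real.exp (∫ u in (0 : ℝ)..t, k u) = 1 := by
      rw [decay, ← Real.exp_add]; simp
    calc Y t ≤ Y t + 1 := by linarith
      _ = (Y t + 1) * decay k t * Real.exp (∫ u in (0 : ℝ)..t, k u) := by
          rw [mul_assoc, h9, mul_one]
      _ ≤ (Y 0 + 1) * Real.exp (∫ u in (0 : ℝ)..t, k u) := by gcongr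
      _ ≤ (mₛ + 1) * Real.exp (S / 4 + C * T) := by gcongr
  have h1 := wint_rpow_le_liminf hp (h.pair t ht.1.le).meas
  have h2 : liminf (fun n : ℕ => wint (wt p (n + 1)) (f t)) atTop ≤
      ENNReal.ofReal ((mₛ + 1) * Real.exp (S / 4 + C * T)) :=
    (liminf_le_liminf (Eventually.of_forall key)).trans_eq (liminf_const _)
  have h3 := h1.trans h2
  have h4 : wint (fun x => x ^ p) (f t) = ENNReal.ofReal (p * (p - 1)) *
      (ENNReal.ofReal (1 / (p * (p - 1))) * wint (fun x => x ^ p) (f t)) := by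
    rw [← mul_assoc, ← ENNReal.ofReal_mul hpp.le, mul_one_div_cancel hpp.ne', ENNReal.ofReal_one,
      one_mul]
  rw [h4, ENNReal.ofReal_mul hpp.le]
  exact mul_le_mul_right h3 _

end Trajectory

end trajectory

/-! ### Linear growth and time averages of moments. -/

lemma const_mul_liminf_le (c : ℝ≥0∞) (u : ℕ → ℝ≥0∞) :
    c * liminf u atTop ≤ liminf (fun n => c * u n) atTop := by
  have := ENNReal.le_liminf_mul (u := fun _ : ℕ => c) (v := u) (f := atTop)
  rwa [liminf_const] at this

lemma decay_le_one {k : ℝ → ℝ} (hk : ∀ t, 0 ≤ k t) {t : ℝ} (ht : 0 ≤ t) : decay k t ≤ 1 :=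
  Real.exp_le_one_iff.2 (neg_nonpos.2 (intervalIntegral.integral_nonneg ht fun u _ => hk u))

lemma wint_mono_rpow {a b : ℝ} (hab : a ≤ b) {g : V → ℝ} (hg : ∀ u, 0 ≤ g u) :
    wint (fun x => x ^ a) g ≤ wint (fun x => x ^ b) g := by
  refine lintegral_mono fun v => ENNReal.ofReal_le_ofReal ?_
  exact mul_le_mul_of_nonneg_left (Real.rpow_le_rpow_of_exponent_le (one_le_en v) hab) (hg v)

/-- Moments of order `p` grow at most linearly, and those of order `p + γ / 2` are bounded in
time average. -/
theorem exists_linear_bound {bLow : ℝ → ℝ} (hb : Measurable bLow)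
    (hbpos : ∀ c ∈ Ioo (-1 : ℝ) 1, 0 < bLow c) {γ p A m₀ M₂ S mₛ : ℝ} (hγ : γ ∈ Ico (-4 : ℝ) 0)
    (hp : 2 ≤ p) (hpγ : 1 ≤ p + γ / 2) (hA : 0 ≤ A) (hm₀ : 0 < m₀) (hM₂ : 0 ≤ M₂) (hS : 0 ≤ S)
    (hmₛ : 0 ≤ mₛ) :
    ∃ C > 0, ∀ (bUp : ℝ → ℝ) (B : ℝ → ℝ → ℝ) (f₀ : V → ℝ) (f : ℝ → V → ℝ)
      (q : ℝ → V → V → S2 → ℝ), Trajectory bUp γ B f₀ f q A m₀ M₂ S →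
      (∀ r ≥ 1, ∀ c ∈ Ioo (-1 : ℝ) 1, r ^ γ * bLow c ≤ B r c) →
      wint (fun x => x ^ p) (f 0) ≤ ENNReal.ofReal mₛ → ∀ T > 0,
      wint (fun x => x ^ p) (f T) ≤ ENNReal.ofReal (C * (1 + T)) ∧
      ∫⁻ t in Ioc 0 T, wint (fun x => x ^ (p + γ / 2)) (f t) ≤ ENNReal.ofReal (C * (1 + T)) := by
  obtain ⟨c, hc, X, hX, hloss⟩ := exists_lossInt_ge hb hbpos hm₀ hM₂
  have hpp : 0 < p * (p - 1) := mul_pos (by linarith) (by linarith)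
  set a := 1 / (p * (p - 1)) with ha
  have ha0 : 0 < a := by positivity
  -- After normalization by `a` and the factor `1/2` of the evolution, the loss controls `a * c / 2
  -- = 2 κ` times the moment; the other collision terms may spend one `κ`.
  set κ := a * c / 4 with hκ
  have hκ0 : 0 < κ := by positivity
  set C' := a / 2 * (c * X ^ (p + γ / 2) * m₀) with hC'
  have hC'0 : 0 < C' := by positivity
  obtain ⟨ε, hε, C, hC0, hcoll⟩ := exists_collision_le (γ := γ) hA hm₀.le hM₂ hp hpγ hκ0
  set L := Real.exp (S / (4 * ε)) with hL
  have hL0 : 0 < L := Real.exp_pos _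
  set R₀ := mₛ + 1 + (C + C') with hR₀
  have hR₀0 : 0 < R₀ := by positivity
  refine ⟨max (p * (p - 1) * (2 * R₀ * L)) (R₀ / κ * L), by positivity, ?_⟩
  intro bUp B f₀ f q h hlow h0 T hT
  set θ : ℝ → ℝ := fun x => x ^ (p + γ / 2) with hθ
  have mθ : Measurable θ := measurable_id.pow_const _
  -- local bound
  obtain ⟨K, hK0, hK⟩ := h.exists_moment_bound hp hA hM₂ hS hmₛ h0 T
  have hKθ : ∀ t ∈ Ioc 0 T, wint θ (f t) ≤ ENNReal.ofReal K := fun t ht =>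
    (wint_mono_rpow (by linarith [hγ.2]) fun u => ((h.pair t ht.1.le).mem u).1).trans (hK t ht)
  set m : ℝ → ℝ := fun t => (wint θ (f t)).toReal with hm
  have hm0 : ∀ t, 0 ≤ m t := fun t => ENNReal.toReal_nonneg
  have hmθ : ∀ t ∈ Ioc 0 T, wint θ (f t) = ENNReal.ofReal (m t) := fun t ht =>
    (ENNReal.ofReal_toReal ((hKθ t ht).trans_lt ENNReal.ofReal_lt_top).ne).symm
  have hmm : AEMeasurable m (volume.restrict (Ioc 0 T)) :=
    (h.aemeasurable_moment mθ T).ennreal_toReal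
  have hmi : IntervalIntegrable m volume 0 T := by
    rw [intervalIntegrable_iff_integrableOn_Ioc_of_le hT.le]
    refine Integrable.mono' (g := fun _ => K) (integrable_const K) hmm.aestronglyMeasurable ?_
    filter_upwards [ae_restrict_mem measurableSet_Ioc] with t ht
    rw [Real.norm_of_nonneg (hm0 t)]
    exact ENNReal.toReal_le_of_le_ofReal hK0 (hKθ t ht)
  -- the integrating factor
  set k : ℝ → ℝ := fun t => (dissipation B (f t) (q t)).toReal / (4 * ε) with hk
  have hk0 : ∀ t, 0 ≤ k t := fun t => by positivity
  have hki : IntervalIntegrable k volume 0 T := (h.integrable_diss hT.le).div_const _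
  have hE1 : ∀ t ∈ Ioc 0 T, ENNReal.ofReal (decay k t) ≤ 1 := fun t ht =>
    ENNReal.ofReal_le_one.2 (decay_le_one hk0 ht.1.le)
  -- The total entropy production is at most `S`, so the integrating factor never falls below `1 /
  -- L`, with `L` independent of `T`.
  have hEL : ∀ t ∈ Ioc 0 T, 1 ≤ ENNReal.ofReal L * ENNReal.ofReal (decay k t) := by
    intro t ht
    have h1 : ∫ u in (0 : ℝ)..t, k u ≤ S / (4 * ε) := by
      rw [hk, intervalIntegral.integral_div]
      gcongr
      exact h.integral_diss_le hS ht.1.le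
    rw [← ENNReal.ofReal_mul hL0.le, ← ENNReal.ofReal_one, hL, decay, ← Real.exp_add]
    exact ENNReal.ofReal_le_ofReal (Real.one_le_exp (by linarith))
  have mE : AEMeasurable (fun t => ENNReal.ofReal (decay k t)) (volume.restrict (Ioc 0 T)) := by
    have := (decay_absolutelyContinuous hT hki hk0).continuousOn
    rw [uIcc_of_le hT.le] at this
    exact ((this.mono Ioc_subset_Icc_self).aemeasurable measurableSet_Ioc).ennreal_ofReal
  set J := ∫⁻ t in Ioc 0 T, wint θ (f t) * ENNReal.ofReal (decay k t) with hJ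
  -- The only use of the local moment bound: `κ J` may be subtracted from both sides below, and `K`
  -- does not enter the final constant.
  have hJfin : J ≠ ∞ := by
    have : J ≤ ∫⁻ _ in Ioc 0 T, ENNReal.ofReal K := by
      refine setLIntegral_mono' measurableSet_Ioc fun t ht => ?_
      exact (mul_le_mul' (hKθ t ht) (hE1 t ht)).trans_eq (mul_one _)
    refine (this.trans_lt ?_).ne
    rw [setLIntegral_const, Real.volume_Ioc]
    exact ENNReal.mul_lt_top ENNReal.ofReal_lt_top ENNReal.ofReal_lt_top
  have hconst : ∀ D ≥ (0 : ℝ), ∫⁻ t in Ioc 0 T, ENNReal.ofReal D * ENNReal.ofReal (decay k t) ≤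
      ENNReal.ofReal (D * T) := by
    intro D hD
    calc ∫⁻ t in Ioc 0 T, ENNReal.ofReal D * ENNReal.ofReal (decay k t)
        ≤ ∫⁻ _ in Ioc 0 T, ENNReal.ofReal D := setLIntegral_mono' measurableSet_Ioc fun t ht =>
          (mul_le_mul' le_rfl (hE1 t ht)).trans_eq (mul_one _)
      _ = _ := by rw [setLIntegral_const, Real.volume_Ioc, sub_zero, ENNReal.ofReal_mul hD]
  have mJ : AEMeasurable (fun t => wint θ (f t) * ENNReal.ofReal (decay k t))
      (volume.restrict (Ioc 0 T)) := (h.aemeasurable_moment mθ T).mul mE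
  -- the truncated moments
  have key : ∀ n : ℕ, ∃ r : ℝ → ℝ≥0∞, AEMeasurable r (volume.restrict (Ioc 0 T)) ∧
      (∀ᵐ t ∂(volume.restrict (Ioc 0 T)),
        ENNReal.ofReal (1 / 2) * lossInt B (f t) (vwt p (n + 1)) ≤ r t) ∧
      (∫⁻ t in Ioc 0 T, r t * ENNReal.ofReal (decay k t)) +
        wint (wt p (n + 1)) (f T) * ENNReal.ofReal (decay k T) ≤
        ENNReal.ofReal κ * J + ENNReal.ofReal (mₛ + 1 + C * T) := by
    intro n
    have hN : (0 : ℝ) < n + 1 := by positivity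
    obtain ⟨Y, hY0, hY, hYac, hYd⟩ := exists_moment_evolution (m₀ := m₀) (M₂ := M₂) h.kernel
      (by rw [h.up]; exact ENNReal.ofReal_ne_top) hp hN h.sol h.mass h.energy
    have hYd' := ae_mono (Trajectory.restrict_Ioc_le T) hYd
    have hd : ∀ᵐ τ ∂(volume.restrict (Ioc 0 T)),
        deriv (fun τ => Y τ + 1) τ + 1 / 2 * (lossInt B (f τ) (vwt p (n + 1))).toReal ≤
          k τ * (Y τ + 1) + (κ * m τ + C) := by
      filter_upwards [hYd', h.ae_diss hT.le, ae_restrict_mem measurableSet_Ioc]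
        with τ ⟨_, _, _, h1⟩ h2 h3
      have h4 := hcoll bUp B (f τ) (q τ) (n + 1) (Y τ) (m τ) h.kernel h.up hN (h.pair τ h3.1.le)
        (h.mass τ h3.1.le) (h.energy τ h3.1.le) (hY τ h3.1.le) (hY0 τ h3.1.le) (hmθ τ h3)
        (hm0 τ) h2
      rw [deriv_add_const]
      exact h1.trans h4
    have hac : AbsolutelyContinuousOnInterval (fun τ => Y τ + 1) 0 T :=
      (hYac T hT).add ((LipschitzWith.const (1 : ℝ)).lipschitzOnWith.absolutelyContinuousOnInterval)
    obtain ⟨r, mr, hr1, hr2⟩ := exists_comparison hT hac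
      (fun τ hτ => add_nonneg (hY0 τ hτ.1) zero_le_one) hki hk0
      ((hmi.const_mul κ).add intervalIntegrable_const)
      (fun t => add_nonneg (mul_nonneg hκ0.le (hm0 t)) hC0) (fun _ => by positivity) hd
    refine ⟨r, mr, ?_, ?_⟩
    · filter_upwards [hr1, hYd'] with t h1 ⟨_, _, h2, _⟩
      rwa [ENNReal.ofReal_mul (by norm_num), ENNReal.ofReal_toReal h2] at h1
    · have h8 : Y 0 ≤ mₛ := by
        have := h.wint_wt_zero_le hp (n + 1) h0
        rw [hY 0 le_rfl] at this
        exact (ENNReal.ofReal_le_ofReal_iff hmₛ).1 this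
      have e1 : ∫⁻ t in Ioc 0 T, ENNReal.ofReal (κ * m t + C) * ENNReal.ofReal (decay k t) ≤
          ENNReal.ofReal κ * J + ENNReal.ofReal (C * T) := by
        have e2 : ∀ t ∈ Ioc 0 T, ENNReal.ofReal (κ * m t + C) * ENNReal.ofReal (decay k t) =
            ENNReal.ofReal κ * (wint θ (f t) * ENNReal.ofReal (decay k t)) +
            ENNReal.ofReal C * ENNReal.ofReal (decay k t) := fun t ht => by
          rw [ENNReal.ofReal_add (mul_nonneg hκ0.le (hm0 t)) hC0, ENNReal.ofReal_mul hκ0.le,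
            hmθ t ht]
          ring
        rw [setLIntegral_congr_fun measurableSet_Ioc e2, lintegral_add_left' (mJ.const_mul _),
          lintegral_const_mul' _ _ ENNReal.ofReal_ne_top]
        exact add_le_add le_rfl (hconst C hC0)
      calc _ ≤ (∫⁻ t in Ioc 0 T, r t * ENNReal.ofReal (decay k t)) +
            ENNReal.ofReal ((Y T + 1) * decay k T) := by
            refine add_le_add le_rfl ?_
            rw [hY T hT.le, ← ENNReal.ofReal_mul (hY0 T hT.le)]
            refine ENNReal.ofReal_le_ofReal ?_
            have := decay_pos k T
            gcongr
            linarith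
        _ ≤ ENNReal.ofReal (Y 0 + 1) + (ENNReal.ofReal κ * J + ENNReal.ofReal (C * T)) :=
            hr2.trans (add_le_add le_rfl e1)
        _ ≤ ENNReal.ofReal (mₛ + 1) + (ENNReal.ofReal κ * J + ENNReal.ofReal (C * T)) := by
            gcongr
        _ = _ := by
            rw [ENNReal.ofReal_add (p := mₛ + 1) (q := C * T) (by positivity) (by positivity)]
            ring
  choose r mr hr hrI using key
  -- passage to the limit in the loss term
  have hlim : ENNReal.ofReal (2 * κ) * J ≤
      ENNReal.ofReal κ * J + ENNReal.ofReal (mₛ + 1 + C * T) + ENNReal.ofReal (C' * T) := by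
    have h1 : ∀ᵐ t ∂(volume.restrict (Ioc 0 T)),
        ENNReal.ofReal (2 * κ) * (wint θ (f t) * ENNReal.ofReal (decay k t)) ≤
        liminf (fun n => r n t * ENNReal.ofReal (decay k t)) atTop +
          ENNReal.ofReal C' * ENNReal.ofReal (decay k t) := by
      filter_upwards [ae_all_iff.2 hr, ae_restrict_mem measurableSet_Ioc] with t h1 h2
      have h3 := hloss γ p B (f t) hγ hp (by linarith) hlow (h.pair t h2.1.le).meas
        (h.pair t h2.1.le).mem (h.mass t h2.1.le) (h.energy t h2.1.le).le
      have h4 := lossInt_pwt_le_liminf hp h.kernel.meas (h.pair t h2.1.le).meas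
      have h5 : ENNReal.ofReal (a / 2) * lossInt B (f t) (pwt p) ≤
          liminf (fun n => r n t) atTop := by
        calc ENNReal.ofReal (a / 2) * lossInt B (f t) (pwt p)
            = ENNReal.ofReal (1 / 2) * (ENNReal.ofReal a * lossInt B (f t) (pwt p)) := by
              rw [← mul_assoc, ← ENNReal.ofReal_mul (by norm_num)]; congr 2; ring
          _ ≤ ENNReal.ofReal (1 / 2) *
                liminf (fun n : ℕ => lossInt B (f t) (vwt p (n + 1))) atTop :=
              mul_le_mul_right h4 _
          _ ≤ _ := const_mul_liminf_le _ _
          _ ≤ _ := liminf_le_liminf (Eventually.of_forall h1)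
      have h6 : ENNReal.ofReal (2 * κ) * wint θ (f t) ≤
          liminf (fun n => r n t) atTop + ENNReal.ofReal C' := by
        have e1 : ENNReal.ofReal (2 * κ) = ENNReal.ofReal (a / 2) * ENNReal.ofReal c := by
          rw [← ENNReal.ofReal_mul (by positivity), hκ]; congr 1; ring
        rw [e1, mul_assoc, hC', ENNReal.ofReal_mul (by positivity)]
        refine (mul_le_mul_right h3 _).trans ?_
        rw [mul_add]
        exact add_le_add h5 le_rfl
      calc ENNReal.ofReal (2 * κ) * (wint θ (f t) * ENNReal.ofReal (decay k t))
          = ENNReal.ofReal (decay k t) * (ENNReal.ofReal (2 * κ) * wint θ (f t)) := by ring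
        _ ≤ ENNReal.ofReal (decay k t) * (liminf (fun n => r n t) atTop + ENNReal.ofReal C') :=
            mul_le_mul_right h6 _
        _ = ENNReal.ofReal (decay k t) * liminf (fun n => r n t) atTop +
            ENNReal.ofReal C' * ENNReal.ofReal (decay k t) := by ring
        _ ≤ _ := by
            refine add_le_add ((const_mul_liminf_le _ _).trans_eq ?_) le_rfl
            simp only [mul_comm]
    rw [hJ, ← lintegral_const_mul' _ _ ENNReal.ofReal_ne_top]
    refine (lintegral_mono_ae h1).trans ?_
    rw [lintegral_add_right' _ (mE.const_mul _)]
    -- A second use of Fatou, now in time, on the measurable majorants `r n`.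
    refine add_le_add ((lintegral_liminf_le' fun n => (mr n).mul mE).trans ?_) (hconst C' hC'0.le)
    refine (liminf_le_liminf (Eventually.of_forall fun n => ?_)).trans_eq (liminf_const _)
    exact le_self_add.trans (hrI n)
  -- Absorption: cancel one `κ J` in `hlim`.
  have hR : ENNReal.ofReal κ * J ≤ ENNReal.ofReal (R₀ * (1 + T)) := by
    have e1 : ENNReal.ofReal (2 * κ) * J = ENNReal.ofReal κ * J + ENNReal.ofReal κ * J := by
      rw [two_mul, ENNReal.ofReal_add hκ0.le hκ0.le, add_mul]
    rw [e1, add_assoc] at hlim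
    have h2 := (ENNReal.add_le_add_iff_left
      (ENNReal.mul_ne_top ENNReal.ofReal_ne_top hJfin)).1 hlim
    rw [← ENNReal.ofReal_add (by positivity) (by positivity)] at h2
    refine h2.trans (ENNReal.ofReal_le_ofReal ?_)
    rw [hR₀]
    nlinarith
  have hTT : T ∈ Ioc 0 T := ⟨hT, le_rfl⟩
  constructor
  · have h1 : ∀ n : ℕ, wint (wt p (n + 1)) (f T) ≤ ENNReal.ofReal (2 * R₀ * L * (1 + T)) := by
      intro n
      have h2 : wint (wt p (n + 1)) (f T) * ENNReal.ofReal (decay k T) ≤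
          ENNReal.ofReal (2 * R₀ * (1 + T)) := by
        refine (le_add_self.trans (hrI n)).trans ((add_le_add hR le_rfl).trans ?_)
        rw [← ENNReal.ofReal_add (by positivity) (by positivity)]
        refine ENNReal.ofReal_le_ofReal ?_
        rw [hR₀]
        nlinarith
      calc wint (wt p (n + 1)) (f T)
          ≤ wint (wt p (n + 1)) (f T) * (ENNReal.ofReal L * ENNReal.ofReal (decay k T)) :=
            le_mul_of_one_le_right (zero_le) (hEL T hTT)
        _ = wint (wt p (n + 1)) (f T) * ENNReal.ofReal (decay k T) * ENNReal.ofReal L := by ring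
        _ ≤ ENNReal.ofReal (2 * R₀ * (1 + T)) * ENNReal.ofReal L := by gcongr
        _ = _ := by rw [← ENNReal.ofReal_mul (by positivity)]; ring_nf
    have h3 := (wint_rpow_le_liminf hp (h.pair T hT.le).meas).trans
      ((liminf_le_liminf (Eventually.of_forall h1)).trans_eq (liminf_const _))
    have h4 : wint (fun x => x ^ p) (f T) = ENNReal.ofReal (p * (p - 1)) *
        (ENNReal.ofReal (1 / (p * (p - 1))) * wint (fun x => x ^ p) (f T)) := by
      rw [← mul_assoc, ← ENNReal.ofReal_mul hpp.le, mul_one_div_cancel hpp.ne',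
        ENNReal.ofReal_one, one_mul]
    rw [h4]
    refine (mul_le_mul_right h3 _).trans ?_
    rw [← ENNReal.ofReal_mul hpp.le]
    refine ENNReal.ofReal_le_ofReal ?_
    calc p * (p - 1) * (2 * R₀ * L * (1 + T)) = p * (p - 1) * (2 * R₀ * L) * (1 + T) := by ring
      _ ≤ _ := by gcongr; exact le_max_left _ _
  · have h1 : ∫⁻ t in Ioc 0 T, wint θ (f t) ≤ ENNReal.ofReal L * J := by
      rw [hJ, ← lintegral_const_mul' _ _ ENNReal.ofReal_ne_top]
      refine setLIntegral_mono' measurableSet_Ioc fun t ht => ?_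
      calc wint θ (f t) ≤ wint θ (f t) * (ENNReal.ofReal L * ENNReal.ofReal (decay k t)) :=
            le_mul_of_one_le_right (zero_le) (hEL t ht)
        _ = _ := by ring
    have h2 : J = ENNReal.ofReal (1 / κ) * (ENNReal.ofReal κ * J) := by
      rw [← mul_assoc, ← ENNReal.ofReal_mul (by positivity), one_div_mul_cancel hκ0.ne',
        ENNReal.ofReal_one, one_mul]
    rw [h2] at h1
    refine h1.trans ((mul_le_mul_right (mul_le_mul_right hR _) _).trans ?_)
    rw [← ENNReal.ofReal_mul (by positivity), ← ENNReal.ofReal_mul (by positivity)]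
    refine ENNReal.ofReal_le_ofReal ?_
    calc L * (1 / κ * (R₀ * (1 + T))) = R₀ / κ * L * (1 + T) := by ring
      _ ≤ _ := by gcongr; exact le_max_right _ _

/-! ### From weighted norms and conservation laws to the abstract setting. -/

lemma bracket_rpow (v : V) (s : ℝ) : bracket v ^ s = en v ^ (s / 2) := by
  rw [bracket, Real.sqrt_eq_rpow, ← Real.rpow_mul (by positivity), en]
  congr 1; ring

lemma normL1_eq_wint {g : V → ℝ} (hg : ∀ u, 0 ≤ g u) (s : ℝ) :
    normL1 s g = wint (fun x => x ^ (s / 2)) g := by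
  refine lintegral_congr fun v => ?_
  rw [abs_of_nonneg (hg v), bracket_rpow]

lemma normL1_zero_eq {g : V → ℝ} (hg : ∀ u, 0 ≤ g u) :
    normL1 0 g = ∫⁻ v, ENNReal.ofReal (g v) := by
  rw [normL1_eq_wint hg]; simp [wint]

lemma normL1_two_eq {g : V → ℝ} (hg : ∀ u, 0 ≤ g u) : normL1 2 g = wint id g := by
  rw [normL1_eq_wint hg]; simp [wint]

lemma normL1_congr {g g' : V → ℝ} (h : g =ᵐ[volume] g') (s : ℝ) : normL1 s g = normL1 s g' := by
  refine lintegral_congr_ae ?_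
  filter_upwards [h] with v hv
  rw [hv]

lemma A3.upperKernel {bLow bUp Φ : ℝ → ℝ} {γ : ℝ} {B : ℝ → ℝ → ℝ} (hK : IsKernel B)
    (h1 : A1 bLow bUp Φ) (h3 : A3 bLow bUp Φ γ B) : UpperKernel bUp γ B :=
  ⟨hK.measurable, hK.nonneg, h1.measurable_up, h3.exponent, h3.upper⟩

lemma A3.lower_far {bLow bUp Φ : ℝ → ℝ} {γ : ℝ} {B : ℝ → ℝ → ℝ}
    (h1 : A1 bLow bUp Φ) (h3 : A3 bLow bUp Φ γ B) :
    ∀ r ≥ 1, ∀ c ∈ Ioo (-1 : ℝ) 1, r ^ γ * bLow c ≤ B r c := by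
  intro r hr c hc
  have hr0 : 0 < r := by linarith
  refine le_trans ?_ (h3.lower r hr0 c hc)
  have := h1.one_le_rad r hr
  have := (h1.low_pos c hc).le
  have := Real.rpow_nonneg hr0.le γ
  gcongr
  nlinarith

lemma integrable_of_memL1_two {g : V → ℝ} (hg : ∀ u, 0 ≤ g u) (h : MemL1 2 g) :
    Integrable g ∧ Integrable fun v => g v * ‖v‖ ^ 2 := by
  have hm := h.1.aemeasurable
  have h2 : wint id g ≠ ∞ := by rw [← normL1_two_eq hg]; exact h.2.ne
  have i := integrable_weight hm hg measurable_id (fun x hx => zero_le_one.trans hx) h2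
  have i1 : Integrable g := by
    refine i.mono' h.1 (Eventually.of_forall fun v => ?_)
    rw [Real.norm_of_nonneg (hg v)]
    exact le_mul_of_one_le_right (hg v) (one_le_en v)
  refine ⟨i1, (i.sub i1).congr (Eventually.of_forall fun v => ?_)⟩
  simp only [Pi.sub_apply, id, en]; ring

/-- Conservation of mass and energy in terms of weighted norms. -/
lemma Conserves.normL1_eq {f₀ : V → ℝ} {f : ℝ → V → ℝ} (hc : Conserves f₀ f)
    (hf₀ : ∀ v, 0 ≤ f₀ v) (h₀ : MemL1 2 f₀) {t : ℝ} (ht : 0 ≤ t) (hf : ∀ v, 0 ≤ f t v)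
    (h : MemL1 2 (f t)) : normL1 0 (f t) = normL1 0 f₀ ∧ normL1 2 (f t) = normL1 2 f₀ := by
  obtain ⟨i1, i2⟩ := integrable_of_memL1_two hf h
  obtain ⟨j1, j2⟩ := integrable_of_memL1_two hf₀ h₀
  have e : ∀ {g : V → ℝ}, (∀ v, 0 ≤ g v) → Integrable g → (Integrable fun v => g v * ‖v‖ ^ 2) →
      wint id g = ENNReal.ofReal ((∫ v, g v) + ∫ v, g v * ‖v‖ ^ 2) := by
    intro g hg k1 k2
    rw [← integral_add k1 k2, ofReal_integral_eq_lintegral_ofReal (f := fun v => g v + g v * ‖v‖ ^ 2) (k1.add k2)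
      (Eventually.of_forall fun v => add_nonneg (hg v) (mul_nonneg (hg v) (sq_nonneg _)))]
    refine lintegral_congr fun v => ?_
    simp only [id, en, mul_add, mul_one]
  constructor
  · rw [normL1_zero_eq hf, normL1_zero_eq hf₀,
      ← ofReal_integral_eq_lintegral_ofReal i1 (Eventually.of_forall hf),
      ← ofReal_integral_eq_lintegral_ofReal j1 (Eventually.of_forall hf₀), hc.mass t ht]
  · rw [normL1_two_eq hf, normL1_two_eq hf₀, e hf i1 i2, e hf₀ j1 j2, hc.mass t ht,
      hc.energy t ht]

/-- The initial entropy is nonnegative and can be dropped, so the entropy production up to `t` is at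
most the entropy at `t`. By conservation of energy that is bounded independently of `t`. -/
lemma exists_trajectory {bLow bUp Φ : ℝ → ℝ} {γ s : ℝ} {B : ℝ → ℝ → ℝ} {f₀ : V → ℝ}
    {f : ℝ → V → ℝ} {M₀ M₂ : ℝ≥0} (hK : IsKernel B) (h1 : A1 bLow bUp Φ)
    (h3 : A3 bLow bUp Φ γ B) (hs : MemL1 s f₀) (hf₀ : ∀ v, f₀ v ∈ Icc (0 : ℝ) 1)
    (hM₀ : normL1 0 f₀ = M₀) (hM₂ : normL1 2 f₀ = M₂) (hf : IsWeakSolution B f₀ f)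
    (hc : Conserves f₀ f) (hw : WeakEntropy B f₀ f) :
    ∃ q, Trajectory bUp γ B f₀ f q (upMass bUp).toReal M₀ M₂ (M₂ + gaussMass.toReal) := by
  obtain ⟨q, hq, hq1, hq2⟩ := hw
  have hup := upMass_ne_top h3.cutoff
  have h0 : ∀ t ≥ 0, ∀ v, 0 ≤ f t v := fun t ht v => (hf.mem_Icc t ht v).1
  have hcons := fun t (ht : t ≥ 0) => hc.normL1_eq (fun v => (hf₀ v).1)
    ⟨hs.1, hM₂ ▸ ENNReal.coe_lt_top⟩ ht (h0 t ht) (hf.memL1_two t ht)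
  have hen : ∀ t ≥ 0, wint id (f t) = ENNReal.ofReal M₂ := fun t ht => by
    rw [← normL1_two_eq (h0 t ht), (hcons t ht).2, hM₂, ENNReal.ofReal_coe_nnreal]
  refine ⟨q, ⟨h3.upperKernel hK h1, (ENNReal.ofReal_toReal hup).symm, hf,
    aemeasurable_dissipation hK.measurable hf.aemeasurable hq,
    fun t ht => ⟨(hf.memL1_two t ht).1.aemeasurable, hf.mem_Icc t ht,
      fun v w σ => (hq1 t ht v w σ).2.1, fun v w σ => (hq1 t ht v w σ).2.2⟩,
    fun t ht => ?_, hen, fun t ht => ?_⟩⟩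
  · rw [← normL1_zero_eq (h0 t ht), (hcons t ht).1, hM₀, ENNReal.ofReal_coe_nnreal]
  · refine (le_add_self.trans (hq2 t ht)).trans
      ((entropy_le (hf.memL1_two t ht).1.aemeasurable (hf.mem_Icc t ht)).trans_eq ?_)
    rw [hen t ht, ENNReal.ofReal_add (by positivity) ENNReal.toReal_nonneg,
      ENNReal.ofReal_toReal gaussMass_ne_top]

lemma normL1_eq_zero_of_mass {g : V → ℝ} (hm : AEMeasurable g) (hg : ∀ u, 0 ≤ g u)
    (h : ∫⁻ v, ENNReal.ofReal (g v) = 0) (s : ℝ) : normL1 s g = 0 := by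
  have h1 := (lintegral_eq_zero_iff' hm.ennreal_ofReal).1 h
  rw [normL1]
  refine (lintegral_congr_ae ?_).trans lintegral_zero
  filter_upwards [h1] with v hv
  have : g v = 0 := le_antisymm (ENNReal.ofReal_eq_zero.1 hv) (hg v)
  simp [this]

end BFD

/-! ### The main estimate. -/

theorem proposition2p7
    (bLow bUp : ℝ → ℝ) (γ s : ℝ) (hγ : γ ∈ Set.Ico (-4 : ℝ) 0) (hs : max (2 + |γ|) 4 ≤ s)
    (M₀ M₂ Mₛ : ℝ≥0) :
    ∃ C : ℝ, 0 < C ∧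
      ∀ (Φ : ℝ → ℝ) (B : ℝ → ℝ → ℝ) (f₀ : BFD.V → ℝ) (f : ℝ → BFD.V → ℝ),
        BFD.IsKernel B → BFD.A1 bLow bUp Φ → BFD.A3 bLow bUp Φ γ B →
        BFD.MemL1 s f₀ → (∀ v, f₀ v ∈ Set.Icc (0 : ℝ) 1) →
        BFD.normL1 0 f₀ = M₀ → BFD.normL1 2 f₀ = M₂ → BFD.normL1 s f₀ = Mₛ →
        BFD.IsWeakSolution B f₀ f → BFD.Conserves f₀ f → BFD.WeakEntropy B f₀ f →
        ∀ t : ℝ, 0 < t →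
          BFD.normL1 s (f t) ≤ ENNReal.ofReal (C * (1 + t)) ∧
          ENNReal.ofReal (1 / t) * ∫⁻ τ in Set.Ioc 0 t, BFD.normL1 (s - |γ|) (f τ)
            ≤ ENNReal.ofReal C := by
  -- The constant is chosen before `Φ`. The properties of `bLow` are extracted from any admissible
  -- `Φ'`; without one the claim is vacuous.
  by_cases hex : ∃ Φ, BFD.A1 bLow bUp Φ
  swap
  · exact ⟨1, one_pos, fun Φ B f₀ f _ h1 => absurd ⟨Φ, h1⟩ hex⟩
  obtain ⟨Φ', hΦ'⟩ := hex
  -- The lower bound on the loss needs positive mass; with zero mass the solution vanishes almost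
  -- everywhere.
  rcases eq_or_ne M₀ 0 with hM | hM
  · refine ⟨1, one_pos, fun Φ B f₀ f hK h1 h3 hs₀ hf₀ hM₀ hM₂ hMₛ hf hc hw t ht => ?_⟩
    obtain ⟨q, hT⟩ := BFD.exists_trajectory hK h1 h3 hs₀ hf₀ hM₀ hM₂ hf hc hw
    have hz : ∀ τ ≥ 0, ∀ r, BFD.normL1 r (f τ) = 0 := fun τ hτ =>
      BFD.normL1_eq_zero_of_mass (hf.memL1_two τ hτ).1.aemeasurable
        (fun u => (hf.mem_Icc τ hτ u).1) (by rw [hT.mass τ hτ, hM]; simp)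
    rw [hz t ht.le, setLIntegral_congr_fun measurableSet_Ioc (g := fun _ => 0)
      fun τ hτ => hz τ hτ.1.le _]
    simp
  have hγ' : |γ| = -γ := abs_of_neg hγ.2
  have hs4 : 4 ≤ s := (le_max_right _ _).trans hs
  have hs2 : 2 + |γ| ≤ s := (le_max_left _ _).trans hs
  rw [hγ'] at hs2
  -- With `p = s / 2`, the conditions `2 ≤ p` and `1 ≤ p + γ / 2` read `4 ≤ s` and `2 + |γ| ≤ s`.
  obtain ⟨C, hC, hbound⟩ := BFD.exists_linear_bound hΦ'.measurable_low hΦ'.low_pos (γ := γ)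
    (p := s / 2) (A := (BFD.upMass bUp).toReal) (m₀ := M₀) (M₂ := M₂)
    (S := M₂ + BFD.gaussMass.toReal) (mₛ := Mₛ) hγ (by linarith) (by linarith)
    ENNReal.toReal_nonneg (by positivity) (by positivity) (by positivity) (by positivity)
  refine ⟨2 * C, by positivity, fun Φ B f₀ f hK h1 h3 hs₀ hf₀ hM₀ hM₂ hMₛ hf hc hw t ht => ?_⟩
  obtain ⟨q, hT⟩ := BFD.exists_trajectory hK h1 h3 hs₀ hf₀ hM₀ hM₂ hf hc hw
  have h0 : ∀ τ ≥ 0, ∀ v, 0 ≤ f τ v := fun τ hτ v => (hf.mem_Icc τ hτ v).1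
  have hinit : BFD.wint (fun x => x ^ (s / 2)) (f 0) ≤ ENNReal.ofReal Mₛ := by
    rw [← BFD.normL1_eq_wint (h0 0 le_rfl), BFD.normL1_congr hf.initial, hMₛ,
      ENNReal.ofReal_coe_nnreal]
  have hb := hbound bUp B f₀ f q hT (h3.lower_far h1) hinit
  have hsup : ∀ τ > 0, BFD.normL1 s (f τ) ≤ ENNReal.ofReal (C * (1 + τ)) := fun τ hτ => by
    rw [BFD.normL1_eq_wint (h0 τ hτ.le)]
    exact (hb τ hτ).1
  refine ⟨(hsup t ht).trans (ENNReal.ofReal_le_ofReal (by nlinarith)), ?_⟩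
  have hexp : (s - |γ|) / 2 = s / 2 + γ / 2 := by rw [hγ']; ring
  have e : ∫⁻ τ in Set.Ioc 0 t, BFD.normL1 (s - |γ|) (f τ) =
      ∫⁻ τ in Set.Ioc 0 t, BFD.wint (fun x => x ^ (s / 2 + γ / 2)) (f τ) :=
    setLIntegral_congr_fun measurableSet_Ioc fun τ hτ => by
      simp only [BFD.normL1_eq_wint (h0 τ hτ.1.le), hexp]
  rw [e]
  have hfin : ∫⁻ τ in Set.Ioc 0 t, BFD.wint (fun x => x ^ (s / 2 + γ / 2)) (f τ) ≤
      ENNReal.ofReal (2 * C * t) := by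
    -- For small `t` the integral bound `C (1 + t)` is not of order `t`; there the pointwise bound
    -- `2 C` on the higher moment is integrated instead. For `t ≥ 1`, `1 + t ≤ 2 t`.
    rcases le_total t 1 with h | h
    · calc ∫⁻ τ in Set.Ioc 0 t, BFD.wint (fun x => x ^ (s / 2 + γ / 2)) (f τ)
          ≤ ∫⁻ _ in Set.Ioc 0 t, ENNReal.ofReal (2 * C) := by
            refine setLIntegral_mono' measurableSet_Ioc fun τ hτ => ?_
            refine (BFD.wint_mono_rpow (by linarith [hγ.2]) (h0 τ hτ.1.le)).trans
              (((hb τ hτ.1).1).trans (ENNReal.ofReal_le_ofReal ?_))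
            nlinarith [hτ.2]
        _ = _ := by
            rw [setLIntegral_const, Real.volume_Ioc, sub_zero,
              ENNReal.ofReal_mul (p := 2 * C) (by positivity)]
    · exact ((hb t ht).2).trans (ENNReal.ofReal_le_ofReal (by nlinarith))
  refine (mul_le_mul_right hfin _).trans (le_of_eq ?_)
  rw [← ENNReal.ofReal_mul (by positivity)]
  congr 1
  field_simp

end
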